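/- **Conventions.** A *restriction category* is a category with an operation $(f:A\to B)\mapsto(\bar f:A\to A)$ such that $f\bar f=f$, $\bar f\bar g=\bar g\bar f$, $\overline{g\bar f}=\bar g\bar f$ (for $f,g$ with the same domain) and $\bar g f=f\,\overline{gf}$ (for composable $f,g$). A map $f$ is *total* if $\bar f=1$; $f\le g$ means $f=g\bar f$; parallel maps $f,g$ are *compatible* if $f\bar g=g\bar f$; $t$ is a *partial inverse* of $s$ if $ts=\bar s$ and $st=\bar t$, and $s$ is then a *partial isomorphism*. The category is a *join restriction category* if every pairwise compatible family of parallel maps has a join for $\le$, and these joins are preserved by precomposition. A *local homeomorphism* $p:A\to X$ is a total map that is a join of partial isomorphisms. A *local atlas* on $X$ is a small family $(\varphi_{ij})_{i,j\in I}$ of restriction idempotents on $X$ (maps of the form $\bar f$) with $\varphi_{ij}=\varphi_{ji}$ and $\varphi_{jk}\varphi_{ij}\le\varphi_{ik}$; a *glueing* of it is a local homeomorphism $p:A\to X$ with $p=\bigvee_i p_i$ for partial isomorphisms $p_i$ with partial inverses $s_i$ such that $\varphi_{ij}=p_js_i$ for all $i,j$. The category *has local glueings* if every local atlas has a glueing.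 Let $\mathcal C$ be a (locally small) join restriction category with local glueings. **$\mathrm{eGpd}_c(\mathcal C)$.** An object is an *étale internal groupoid* $A$ in $\mathcal C$: objects $A_0,A_1$, total maps $\sigma,\tau:A_1\to A_0$ (source and target) such that $\sigma$ has pullbacks along all total maps, maps $\eta:A_0\to A_1$, $\mu:A_1\times_{A_0}A_1\to A_1$ and $\iota:A_1\to A_1$ satisfying the usual groupoid axioms, and such that $\sigma$ is a local homeomorphism. A morphism $A\to B$ is an *internal cofunctor*: a total map $F_0:B_0\to A_0$ and a map $F_1:A_1\times_{A_0}B_0\to B_1$ (pullback of $\sigma$ along $F_0$) such that, in terms of generalized elements, $\sigma F_1(a,b)=b$, $F_0\tau F_1(a,b)=\tau(a)$, $F_1(\eta F_0 b,b)=\eta(b)$ and $F_1(\mu(a',a),b)=\mu\bigl(F_1(a',\tau F_1(a,b)),F_1(a,b)\bigr)$. **$\mathrm{PsGrp}(\mathcal C)$.** A *join inverse monoid* is an inverse monoid in which every pairwise bicompatible family (that is, $st^*t=ts^*s$ and $s^*tt^*=t^*ss^*$ for all members $s,t$) has a join for the natural partial order, and these joins are preserved by right multiplication $t\mapsto tu$.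 For $X\in\mathcal C$, $I(X)$ is the inverse monoid of partial isomorphisms $X\to X$. An object is a *complete $\mathcal C$-pseudogroup* $(S,X,\theta)$: a (small) join inverse monoid $S$, an object $X$ of $\mathcal C$ and a monoid homomorphism $\theta:S\to I(X)$ that restricts to an isomorphism between the idempotents of $S$ and those of $I(X)$. A morphism $(S,X,\theta)\to(T,Y,\gamma)$ is a pair of a monoid homomorphism $f:S\to T$ and a total map $g:Y\to X$ with $\theta(s)\,g=g\,\gamma(f(s))$ for all $s\in S$. **Theorem.** There is an equivalence of categories $$\Phi_g:\mathrm{eGpd}_c(\mathcal C)\;\simeq\;\mathrm{PsGrp}(\mathcal C):\Psi_g .$$ Here $\Phi_g$ sends $A$ to $(S,A_0,\theta)$, where $S$ is the join inverse monoid of *partial bisections*, that is, maps $s:A_0\to A_1$ with $\sigma s=\bar s$ and $\tau s$ a partial isomorphism, with unit $\eta$ and product $ts=\bigl(x\mapsto\mu(t(\tau s(x)),s(x))\bigr)$, and $\theta(s)=\tau s$; it sends a cofunctor $F:A\to B$ to the pair of the homomorphism $s\mapsto\bigl(b\mapsto F_1(s(F_0b),b)\bigr)$ and the total map $F_0$.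 The pseudo-inverse $\Psi_g$ sends $(S,X,\theta)$ to an *internalisation* of it: a groupoid with object of objects $X$ (up to isomorphism) whose source map is a glueing of the local atlas $[\![s=t]\!]=\bigvee\{\theta(e): e\in S\text{ idempotent},\ e\le s^*st^*t,\ se=te\}$ $(s,t\in S)$, witnessed by partial sections $\sigma_s$ $(s\in S)$ with $\tau\sigma_s=\theta(s)$, $\sigma_1=\eta$ and $\sigma_{ts}=\sigma_t*\sigma_s$, where $*$ is the product $\mu(t(\tau s(x)),s(x))$ of partial sections. -/

import Mathlib

open CategoryTheory CategoryTheory.Limits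

universe v u

namespace EtaleCorr

/-! ### Restriction categories

Composition in Mathlib is diagrammatic: the composite of `f : A ⟶ B` and `g : B ⟶ D`,
classically written `g f`, is `f ≫ g`. -/

/-- A restriction category: a category with an operation `f ↦ rst f` (classically an overline)
satisfying the four restriction axioms. -/
class RestrictionCategory (C : Type u) [Category.{v} C] where
  rst : ∀ {A B : C}, (A ⟶ B) → (A ⟶ A)
  rst_comp_self : ∀ {A B : C} (f : A ⟶ B), rst f ≫ f = f
  rst_comm : ∀ {A B D : C} (f : A ⟶ B) (g : A ⟶ D), rst f ≫ rst g = rst g ≫ rst f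
  rst_rst_comp : ∀ {A B D : C} (f : A ⟶ B) (g : A ⟶ D), rst (rst f ≫ g) = rst f ≫ rst g
  comp_rst : ∀ {A B D : C} (f : A ⟶ B) (g : B ⟶ D), f ≫ rst g = rst (f ≫ g) ≫ f

open RestrictionCategory

section Restriction

variable {C : Type u} [Category.{v} C] [RestrictionCategory C]

/-- A map is total if its restriction is the identity. -/
class IsTotal {A B : C} (f : A ⟶ B) : Prop where
  rst_eq : rst f = 𝟙 A

/-- A restriction idempotent: a map of the form `rst f`. -/
def IsRestrictionIdem {A : C} (e : A ⟶ A) : Prop := ∃ (B : C) (f : A ⟶ B), e = rst f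

/-- The canonical partial order on maps: `f ≤ g` iff `f` is the restriction of `g` to the
domain of `f`. -/
def RLe {A B : C} (f g : A ⟶ B) : Prop := f = rst f ≫ g

/-- Compatibility of parallel maps. -/
def Compat {A B : C} (f g : A ⟶ B) : Prop := rst g ≫ f = rst f ≫ g

/-- `j` is the join (least upper bound) of the family `S` for the canonical order. -/
def IsJoin {A B : C} (S : Set (A ⟶ B)) (j : A ⟶ B) : Prop :=
  (∀ f ∈ S, RLe f j) ∧ ∀ k : A ⟶ B, (∀ f ∈ S, RLe f k) → RLe j k

/-- `t` is a partial inverse of `s`. -/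
def IsPartialInverse {A B : C} (s : A ⟶ B) (t : B ⟶ A) : Prop :=
  s ≫ t = rst s ∧ t ≫ s = rst t

/-- A partial isomorphism: a map with a partial inverse. -/
def IsPartialIso {A B : C} (s : A ⟶ B) : Prop := ∃ t : B ⟶ A, IsPartialInverse s t

/-- A local homeomorphism: a total map which is a join of partial isomorphisms. -/
def IsLocalHomeo {A X : C} (p : A ⟶ X) : Prop :=
  IsTotal p ∧ ∃ S : Set (A ⟶ X), (∀ q ∈ S, IsPartialIso q) ∧ IsJoin S p

/-- A partial section of `p`. -/
def IsPartialSection {A X : C} (p : A ⟶ X) (s : X ⟶ A) : Prop := s ≫ p = rst s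

/-- A local atlas on `X`. -/
structure IsLocalAtlas {X : C} {I : Type v} (φ : I → I → (X ⟶ X)) : Prop where
  idem : ∀ i j, IsRestrictionIdem (φ i j)
  symm : ∀ i j, φ i j = φ j i
  trans : ∀ i j k, RLe (φ i j ≫ φ j k) (φ i k)

/-- The local homeomorphism `p` is a glueing of `φ`, as witnessed by the partial sections `s`:
`p` is total and is a join of partial isomorphisms `q i`, each with partial inverse `s i`, and
`φ i j` is the composite of `s i` and `q j`. -/
def IsGlueing {A X : C} {I : Type v} (p : A ⟶ X) (φ : I → I → (X ⟶ X)) (s : I → (X ⟶ A)) :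
    Prop :=
  IsTotal p ∧ ∃ q : I → (A ⟶ X),
    (∀ i, IsPartialInverse (q i) (s i)) ∧ IsJoin (Set.range q) p ∧ ∀ i j, φ i j = s i ≫ q j

variable (C) in
/-- A join restriction category: compatible families of parallel maps have joins, and these
are preserved by precomposition. -/
class JoinRestrictionCategory : Prop where
  exists_join : ∀ {A B : C} (S : Set (A ⟶ B)), (∀ f ∈ S, ∀ g ∈ S, Compat f g) → ∃ j, IsJoin S j
  join_precomp : ∀ {A' A B : C} (S : Set (A ⟶ B)) (j : A ⟶ B),
    (∀ f ∈ S, ∀ g ∈ S, Compat f g) → IsJoin S j →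
    ∀ g : A' ⟶ A, IsJoin ((fun f => g ≫ f) '' S) (g ≫ j)

variable (C) in
/-- `C` has local glueings: every local atlas on every object is induced by a local
homeomorphism. -/
def HasLocalGlueings : Prop :=
  ∀ (X : C) (I : Type v) (φ : I → I → (X ⟶ X)), IsLocalAtlas φ →
    ∃ (A : C) (p : A ⟶ X) (s : I → (X ⟶ A)), IsGlueing p φ s

/-! Basic calculations with restrictions. -/

@[simp] lemma rst_id (A : C) : rst (𝟙 A) = 𝟙 A := by
  simpa using rst_comp_self (𝟙 A)

@[simp] lemma rst_rst {A B : C} (f : A ⟶ B) : rst (rst f) = rst f := by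
  simpa using rst_rst_comp f (𝟙 A)

lemma rst_idem {A B : C} (f : A ⟶ B) : rst f ≫ rst f = rst f := by
  rw [← rst_rst_comp, rst_comp_self]

lemma rst_comp_rst_comp {A B D : C} (f : A ⟶ B) (g : B ⟶ D) :
    rst (f ≫ g) ≫ rst f = rst (f ≫ g) := by
  rw [rst_comm, ← rst_rst_comp, ← Category.assoc, rst_comp_self]

lemma rst_comp_rst {A B D : C} (f : A ⟶ B) (g : B ⟶ D) : rst (f ≫ rst g) = rst (f ≫ g) := by
  rw [comp_rst, rst_rst_comp, rst_comp_rst_comp]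

lemma rst_comp_total {A B D : C} (f : A ⟶ B) (g : B ⟶ D) [hg : IsTotal g] :
    rst (f ≫ g) = rst f := by
  rw [← rst_comp_rst, hg.rst_eq, Category.comp_id]

lemma rst_eq_of_comp_total {A B B' D : C} {f : A ⟶ B} {g : B ⟶ D} [IsTotal g]
    {f' : A ⟶ B'} {g' : B' ⟶ D} [IsTotal g'] (h : f ≫ g = f' ≫ g') : rst f = rst f' := by
  rw [← rst_comp_total f g, h, rst_comp_total]

lemma IsTotal.of_comp {A B D : C} (f : A ⟶ B) (g : B ⟶ D) [h : IsTotal (f ≫ g)] : IsTotal f := by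
  constructor
  have := rst_comp_rst_comp f g
  rwa [h.rst_eq, Category.id_comp] at this

instance (A : C) : IsTotal (𝟙 A) := ⟨rst_id A⟩

instance {A B D : C} (f : A ⟶ B) (g : B ⟶ D) [hf : IsTotal f] [IsTotal g] : IsTotal (f ≫ g) :=
  ⟨by rw [rst_comp_total, hf.rst_eq]⟩

lemma RLe.refl {A B : C} (f : A ⟶ B) : RLe f f := (rst_comp_self f).symm

lemma RLe.rst_comp {A B : C} {f g : A ⟶ B} (h : RLe f g) : rst f ≫ rst g = rst f := by
  rw [← rst_rst_comp, ← h]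

lemma RLe.antisymm {A B : C} {f g : A ⟶ B} (h : RLe f g) (h' : RLe g f) : f = g := by
  have e : rst f = rst g := by rw [← h.rst_comp, rst_comm, h'.rst_comp]
  rw [h, e, rst_comp_self]

lemma RLe.trans {A B : C} {f g k : A ⟶ B} (h : RLe f g) (h' : RLe g k) : RLe f k := by
  unfold RLe
  conv_lhs => rw [h, h', ← Category.assoc, h.rst_comp]

lemma RLe.eq_of_rst {A B : C} {f g : A ⟶ B} (h : RLe f g) (e : rst f = rst g) : f = g := by
  rw [h, e, rst_comp_self]

lemma RLe.precomp {A' A B : C} {f g : A ⟶ B} (h : RLe f g) (k : A' ⟶ A) :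
    RLe (k ≫ f) (k ≫ g) := by
  unfold RLe
  conv_lhs => rw [h, ← Category.assoc, comp_rst, Category.assoc]

lemma RLe.postcomp {A B D : C} {f g : A ⟶ B} (h : RLe f g) (k : B ⟶ D) :
    RLe (f ≫ k) (g ≫ k) := by
  have e : f ≫ k = rst f ≫ g ≫ k := by rw [← Category.assoc, ← h]
  unfold RLe
  conv_rhs => rw [e, rst_rst_comp, Category.assoc, rst_comp_self]
  exact e

lemma RLe.rst_le {A B : C} {f g : A ⟶ B} (h : RLe f g) : RLe (rst f) (rst g) := by
  unfold RLe
  rw [rst_rst, h.rst_comp]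

lemma rst_le_id {A B : C} (f : A ⟶ B) : RLe (rst f) (𝟙 A) := by
  simp [RLe]

lemma RLe.compat {A B : C} {f g k : A ⟶ B} (h : RLe f k) (h' : RLe g k) : Compat f g := by
  unfold Compat
  conv_lhs => rw [h]
  conv_rhs => rw [h']
  rw [← Category.assoc, ← Category.assoc, rst_comm]

lemma Compat.postcomp {A B D : C} {f g : A ⟶ B} (h : Compat f g) (k : B ⟶ D) :
    Compat (f ≫ k) (g ≫ k) := by
  have key : ∀ {f g : A ⟶ B}, Compat f g → rst (g ≫ k) ≫ f ≫ k = rst f ≫ g ≫ k := by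
    intro f g h
    unfold Compat at h
    calc rst (g ≫ k) ≫ f ≫ k = rst (g ≫ k) ≫ (rst g ≫ f) ≫ k := by
          rw [Category.assoc (rst g), ← Category.assoc (rst (g ≫ k)) (rst g), rst_comp_rst_comp]
      _ = rst (g ≫ k) ≫ (rst f ≫ g) ≫ k := by rw [h]
      _ = rst f ≫ rst (g ≫ k) ≫ g ≫ k := by
          rw [Category.assoc, ← Category.assoc, rst_comm, Category.assoc]
      _ = _ := by rw [rst_comp_self]
  have h2 : Compat g f := Eq.symm h
  unfold Compat
  rw [key h, key h2, ← Category.assoc, ← Category.assoc, h2]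

/-! Partial isomorphisms. -/

lemma IsPartialInverse.symm {A B : C} {s : A ⟶ B} {t : B ⟶ A} (h : IsPartialInverse s t) :
    IsPartialInverse t s := ⟨h.2, h.1⟩

lemma IsPartialInverse.unique {A B : C} {s : A ⟶ B} {t t' : B ⟶ A} (h : IsPartialInverse s t)
    (h' : IsPartialInverse s t') : t = t' := by
  have key : ∀ {t t' : B ⟶ A}, IsPartialInverse s t → IsPartialInverse s t' → RLe t t' := by
    intro t t' h h'
    unfold RLe
    rw [← h.2, Category.assoc, h'.1, ← h.1, ← Category.assoc, h.2, rst_comp_self]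
  exact (key h h').antisymm (key h' h)

lemma IsPartialInverse.comp {A B D : C} {s : A ⟶ B} {s' : B ⟶ A} {t : B ⟶ D} {t' : D ⟶ B}
    (h : IsPartialInverse s s') (h' : IsPartialInverse t t') :
    IsPartialInverse (s ≫ t) (t' ≫ s') := by
  have key : ∀ {A B D : C} {s : A ⟶ B} {s' : B ⟶ A} {t : B ⟶ D} {t' : D ⟶ B},
      IsPartialInverse s s' → IsPartialInverse t t' → (s ≫ t) ≫ t' ≫ s' = rst (s ≫ t) := by
    intro A B D s s' t t' h h'
    rw [Category.assoc, ← Category.assoc t, h'.1, ← Category.assoc, comp_rst, Category.assoc,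
      h.1, rst_comp_rst_comp]
  exact ⟨key h h', key h'.symm h.symm⟩

lemma IsPartialInverse.rst_self {A B : C} (f : A ⟶ B) : IsPartialInverse (rst f) (rst f) := by
  simp [IsPartialInverse, rst_idem]

/-- The monoid of partial automorphisms of `X`. In `End X` the product `s * t` is the composite
"`s` after `t`". -/
def PartialAut (X : C) : Submonoid (End X) where
  carrier := {s | IsPartialIso (End.asHom s)}
  one_mem' := ⟨𝟙 X, by
    change IsPartialInverse (𝟙 X) (𝟙 X)
    simp [IsPartialInverse]⟩
  mul_mem' := by
    rintro s t ⟨s', hs⟩ ⟨t', ht⟩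
    exact ⟨s' ≫ t', ht.comp hs⟩

/-! Joins. -/

lemma IsJoin.unique {A B : C} {S : Set (A ⟶ B)} {j j' : A ⟶ B} (h : IsJoin S j)
    (h' : IsJoin S j') : j = j' :=
  (h.2 _ h'.1).antisymm (h'.2 _ h.1)

lemma IsJoin.compat {A B : C} {S : Set (A ⟶ B)} {j : A ⟶ B} (h : IsJoin S j) :
    ∀ f ∈ S, ∀ g ∈ S, Compat f g := fun f hf g hg => (h.1 f hf).compat (h.1 g hg)

variable [JoinRestrictionCategory C]

lemma IsJoin.join_rst {A B : C} {S : Set (A ⟶ B)} {j : A ⟶ B} (h : IsJoin S j) :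
    IsJoin ((fun f => rst f) '' S) (rst j) := by
  have hc : ∀ f ∈ (fun f : A ⟶ B => rst f) '' S,
      ∀ g ∈ (fun f : A ⟶ B => rst f) '' S, Compat f g := by
    rintro _ ⟨f, hf, rfl⟩ _ ⟨g, hg, rfl⟩
    exact (rst_le_id f).compat (rst_le_id g)
  obtain ⟨e, he⟩ := JoinRestrictionCategory.exists_join _ hc
  have hej : RLe e (rst j) := by
    refine he.2 _ ?_
    rintro _ ⟨f, hf, rfl⟩
    exact (h.1 f hf).rst_le
  have hee : e = rst e := by
    have := hej.trans (rst_le_id j)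
    unfold RLe at this
    simpa using this
  have hje : RLe j (e ≫ j) := by
    refine h.2 _ fun f hf => ?_
    have h1 : RLe (rst f) e := he.1 _ ⟨f, hf, rfl⟩
    have h2 := h1.postcomp j
    rwa [← h.1 f hf] at h2
  have h3 : RLe (rst j) e := by
    have := hje.rst_comp
    unfold RLe
    rw [hee, rst_rst_comp, rst_comm e j, ← Category.assoc, rst_idem, ← hee] at this
    rw [rst_rst, this]
  rwa [hej.antisymm h3] at he

lemma IsJoin.postcomp {A B D : C} {S : Set (A ⟶ B)} {j : A ⟶ B} (h : IsJoin S j) (k : B ⟶ D) :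
    IsJoin ((fun f => f ≫ k) '' S) (j ≫ k) := by
  have hc : ∀ f ∈ (fun f : A ⟶ B => f ≫ k) '' S,
      ∀ g ∈ (fun f : A ⟶ B => f ≫ k) '' S, Compat f g := by
    rintro _ ⟨f, hf, rfl⟩ _ ⟨g, hg, rfl⟩
    exact (h.compat f hf g hg).postcomp k
  obtain ⟨w, hw⟩ := JoinRestrictionCategory.exists_join _ hc
  have hle : RLe w (j ≫ k) := by
    refine hw.2 _ ?_
    rintro _ ⟨f, hf, rfl⟩
    exact (h.1 f hf).postcomp k
  have h1 := JoinRestrictionCategory.join_precomp _ _ h.join_rst.compat h.join_rst (rst (j ≫ k))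
  rw [rst_comp_rst_comp] at h1
  have h2 := hw.join_rst
  have hs : (fun f => rst (j ≫ k) ≫ f) '' ((fun f => rst f) '' S) =
      (fun f => rst f) '' ((fun f => f ≫ k) '' S) := by
    rw [Set.image_image, Set.image_image]
    refine Set.image_congr fun f hf => ?_
    have := h.1 f hf
    unfold RLe at this
    conv_rhs => rw [this, Category.assoc, rst_rst_comp]
    rw [rst_comm]
  rw [hs] at h1
  rwa [hle.eq_of_rst (h2.unique h1)] at hw

lemma IsJoin.comp_eq {A B : C} {E : Set (A ⟶ A)} {e : A ⟶ A} (h : IsJoin E e) {f g : A ⟶ B}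
    (hfg : ∀ d ∈ E, d ≫ f = d ≫ g) : e ≫ f = e ≫ g := by
  have h1 := h.postcomp f
  rw [Set.image_congr hfg] at h1
  exact h1.unique (h.postcomp g)

/-- The join of a family of partial isomorphisms whose partial inverses are also compatible is
a partial isomorphism. -/
lemma IsJoin.isPartialIso {A B : C} {S : Set (A ⟶ B)} {j : A ⟶ B} (h : IsJoin S j)
    (hS : ∀ s ∈ S, ∃ t, IsPartialInverse s t)
    (hc : ∀ s ∈ S, ∀ s' ∈ S, ∀ t t', IsPartialInverse s t → IsPartialInverse s' t' →
      Compat t t') : IsPartialIso j := by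
  let T : Set (B ⟶ A) := {t | ∃ s ∈ S, IsPartialInverse s t}
  have hT : ∀ t ∈ T, ∀ t' ∈ T, Compat t t' := by
    rintro t ⟨s, hs, hst⟩ t' ⟨s', hs', hst'⟩
    exact hc s hs s' hs' t t' hst hst'
  obtain ⟨k, hk⟩ := JoinRestrictionCategory.exists_join T hT
  -- the two halves of the claim are instances of one statement
  have key : ∀ {A B : C} {S : Set (A ⟶ B)} {j : A ⟶ B} {T : Set (B ⟶ A)} {k : B ⟶ A},
      IsJoin S j → IsJoin T k → (∀ s ∈ S, ∃ t ∈ T, IsPartialInverse s t) → j ≫ k = rst j := by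
    intro A B S j T k hj hk hST
    have e1 : rst j ≫ (j ≫ k) = rst j ≫ 𝟙 A := by
      refine hj.join_rst.comp_eq ?_
      rintro _ ⟨s, hs, rfl⟩
      obtain ⟨t, ht, hst⟩ := hST s hs
      have h1 : rst s ≫ j = s := (hj.1 s hs).symm
      have h2 : rst t ≫ k = t := (hk.1 t ht).symm
      have h3 : s ≫ rst t = s := by rw [← hst.2, ← Category.assoc, hst.1, rst_comp_self]
      change rst s ≫ j ≫ k = rst s ≫ 𝟙 A
      rw [← Category.assoc, h1, Category.comp_id, ← h3, Category.assoc, h2, hst.1, h3]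
    rwa [← Category.assoc, rst_comp_self, Category.comp_id] at e1
  refine ⟨k, key h hk ?_, key hk h ?_⟩
  · intro s hs
    obtain ⟨t, ht⟩ := hS s hs
    exact ⟨t, ⟨s, hs, ht⟩, ht⟩
  · rintro t ⟨s, hs, ht⟩
    exact ⟨s, hs, ht.symm⟩

end Restriction

/-! ### Inverse monoids -/

/-- An inverse monoid: every `s` has a unique `s⁻¹` with `s s⁻¹ s = s` and `s⁻¹ s s⁻¹ = s⁻¹`. -/
class InverseMonoid (S : Type v) extends Monoid S, Inv S where
  mul_inv_mul : ∀ s : S, s * s⁻¹ * s = s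
  inv_mul_inv : ∀ s : S, s⁻¹ * s * s⁻¹ = s⁻¹
  inv_unique : ∀ s t : S, s * t * s = s → t * s * t = t → t = s⁻¹

namespace InverseMonoid

variable {S : Type v} [InverseMonoid S]

/-- The natural partial order; the restriction of `s` is `s⁻¹ * s`. -/
def NLe (s t : S) : Prop := s = t * (s⁻¹ * s)

/-- Compatibility. -/
def NCompat (s t : S) : Prop := s * (t⁻¹ * t) = t * (s⁻¹ * s)

/-- Bicompatibility. -/
def BiCompat (s t : S) : Prop := NCompat s t ∧ NCompat s⁻¹ t⁻¹

/-- `j` is the join (least upper bound) of the family `F` for the natural partial order. -/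
def IsNJoin (F : Set S) (j : S) : Prop :=
  (∀ s ∈ F, NLe s j) ∧ ∀ k : S, (∀ s ∈ F, NLe s k) → NLe j k

end InverseMonoid

open InverseMonoid in
/-- A join inverse monoid: bicompatible families have joins, and these are preserved by
precomposition, that is, by multiplication on the right. -/
class JoinInverseMonoid (S : Type v) extends InverseMonoid S where
  exists_join : ∀ F : Set S, (∀ s ∈ F, ∀ t ∈ F, BiCompat s t) → ∃ j, IsNJoin F j
  join_mul : ∀ (F : Set S) (j : S), (∀ s ∈ F, ∀ t ∈ F, BiCompat s t) → IsNJoin F j →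
    ∀ g : S, IsNJoin ((fun s => s * g) '' F) (j * g)

/-- In a monoid with a restriction operation `r` in which each element has a partial inverse,
the partial inverse is the unique inverse in the sense of inverse monoids. -/
lemma eq_inv_of_restriction {S : Type v} [Monoid S] (r i : S → S) (h1 : ∀ s, s * r s = s)
    (h2 : ∀ s t, r s * r t = r t * r s) (h4 : ∀ s t, r t * s = s * r (t * s))
    (hi : ∀ s, i s * s = r s) (hi' : ∀ s, s * i s = r (i s)) :
    ∀ s t : S, s * t * s = s → t * s * t = t → t = i s := by
  intro s t hst hts
  have hr : ∀ e : S, e * e = e → e = r e := by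
    intro e he
    have h5 : r e * e = e := by rw [h4, he, h1]
    calc e = r e * e := h5.symm
      _ = i e * (e * e) := by rw [← hi, mul_assoc]
      _ = r e := by rw [he, hi]
  have hcomm : ∀ e f : S, e * e = e → f * f = f → e * f = f * e := by
    intro e f he hf
    rw [hr e he, hr f hf, h2]
  have hsis : s * i s * s = s := by rw [mul_assoc, hi, h1]
  have hisi : i s * s * i s = i s := by rw [mul_assoc, hi', h1]
  have a1 : s * t = s * i s := by
    calc s * t = (s * i s) * (s * t) := by rw [← mul_assoc, hsis]
      _ = (s * t) * (s * i s) := hcomm _ _ (by rw [← mul_assoc, hsis]) (by rw [← mul_assoc, hst])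
      _ = s * i s := by rw [← mul_assoc, hst]
  have a2 : t * s = i s * s := by
    calc t * s = (t * s) * (i s * s) := by rw [mul_assoc, ← mul_assoc s, hsis]
      _ = (i s * s) * (t * s) := hcomm _ _ (by rw [← mul_assoc, hts]) (by rw [← mul_assoc, hisi])
      _ = i s * s := by rw [mul_assoc, ← mul_assoc s, hst]
  calc t = t * s * t := hts.symm
    _ = i s * (s * t) := by rw [a2, mul_assoc]
    _ = i s := by rw [a1, ← mul_assoc, hisi]

/-! ### Internal categories and étale groupoids -/

section Internal

variable {C : Type u} [Category.{v} C] [RestrictionCategory C]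

/-- `p` admits a pullback along any total map. -/
class PullsBack {A X : C} (p : A ⟶ X) : Prop where
  hasPullback : ∀ {Y : C} (f : Y ⟶ X), IsTotal f → HasPullback p f

instance {A X Y : C} (p : A ⟶ X) (f : Y ⟶ X) [PullsBack p] [h : IsTotal f] : HasPullback p f :=
  PullsBack.hasPullback f h

/-- The pullback `f^* s` of a partial section `s` of `p` along `f`, as a partial section of
`pullback.snd p f`. -/
noncomputable def pullSection {A X Y : C} (p : A ⟶ X) (f : Y ⟶ X) [PullsBack p] [IsTotal f]
    (s : X ⟶ A) (hs : IsPartialSection p s) : Y ⟶ pullback p f :=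
  pullback.lift (f ≫ s) (rst (f ≫ s)) (by
    have : s ≫ p = rst s := hs
    rw [Category.assoc, this, comp_rst])

variable (C) in
/-- An internal category in `C`: objects `obj`, arrows `arr`, with total source and target maps,
the source map having pullbacks along total maps. The composition map is defined on the pullback
of `src` along `tgt`, whose first projection is the second arrow to be applied. Associativity is
the equality of the two maps from the object of composable triples, written as an equality for
all composable triples of generalized elements. (The maps `one` and `comp` are
automatically total.) -/
structure InternalCategory where
  obj : C
  arr : C
  src : arr ⟶ obj
  tgt : arr ⟶ obj
  [total_src : IsTotal src]
  [total_tgt : IsTotal tgt]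
  [pullsBack : PullsBack src]
  one : obj ⟶ arr
  one_src : one ≫ src = 𝟙 obj
  one_tgt : one ≫ tgt = 𝟙 obj
  comp : pullback src tgt ⟶ arr
  comp_src : comp ≫ src = pullback.snd src tgt ≫ src
  comp_tgt : comp ≫ tgt = pullback.fst src tgt ≫ tgt
  comp_one : pullback.lift (𝟙 arr) (src ≫ one) (by simp [one_tgt]) ≫ comp = 𝟙 arr
  one_comp : pullback.lift (tgt ≫ one) (𝟙 arr) (by simp [one_src]) ≫ comp = 𝟙 arr
  comp_assoc : ∀ {Z : C} (h g f : Z ⟶ arr) (hg : h ≫ src = g ≫ tgt) (gf : g ≫ src = f ≫ tgt),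
    pullback.lift h (pullback.lift g f gf ≫ comp) (by rw [Category.assoc, comp_tgt, pullback.lift_fst_assoc, hg]) ≫ comp =
      pullback.lift (pullback.lift h g hg ≫ comp) f (by rw [Category.assoc, comp_src, pullback.lift_snd_assoc, gf]) ≫ comp

attribute [instance] InternalCategory.total_src InternalCategory.total_tgt
  InternalCategory.pullsBack

namespace InternalCategory

variable (A : InternalCategory C)

/-- Composition of composable generalized elements: `g` after `f`. -/
noncomputable def cmp {Z : C} (g f : Z ⟶ A.arr) (h : g ≫ A.src = f ≫ A.tgt) : Z ⟶ A.arr :=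
  pullback.lift g f h ≫ A.comp

variable {A}

lemma cmp_src {Z : C} {g f : Z ⟶ A.arr} (h : g ≫ A.src = f ≫ A.tgt) :
    A.cmp g f h ≫ A.src = f ≫ A.src := by
  rw [cmp, Category.assoc, A.comp_src, pullback.lift_snd_assoc]

lemma cmp_tgt {Z : C} {g f : Z ⟶ A.arr} (h : g ≫ A.src = f ≫ A.tgt) :
    A.cmp g f h ≫ A.tgt = g ≫ A.tgt := by
  rw [cmp, Category.assoc, A.comp_tgt, pullback.lift_fst_assoc]

lemma precomp_cmp {W Z : C} (k : W ⟶ Z) {g f : Z ⟶ A.arr} (h : g ≫ A.src = f ≫ A.tgt) :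
    k ≫ A.cmp g f h = A.cmp (k ≫ g) (k ≫ f) (by simp [h]) := by
  rw [cmp, cmp, ← Category.assoc]
  congr 1
  apply pullback.hom_ext <;> simp only [Category.assoc, pullback.lift_fst, pullback.lift_snd]

lemma cmp_congr {Z : C} {g f g' f' : Z ⟶ A.arr} (hg : g = g') (hf : f = f')
    (h : g ≫ A.src = f ≫ A.tgt) : A.cmp g f h = A.cmp g' f' (by rw [← hg, ← hf, h]) := by
  subst hg hf; rfl

lemma cmp_one {Z : C} (f : Z ⟶ A.arr) {g : Z ⟶ A.arr} (hg : g = f ≫ A.src ≫ A.one) :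
    A.cmp f g (by simp [hg, A.one_tgt]) = f := by
  subst hg
  have := precomp_cmp f (A := A) (g := 𝟙 _) (f := A.src ≫ A.one) (by simp [A.one_tgt])
  rw [cmp_congr (Category.comp_id f).symm rfl, ← this, cmp, A.comp_one, Category.comp_id]

lemma one_cmp {Z : C} (f : Z ⟶ A.arr) {g : Z ⟶ A.arr} (hg : g = f ≫ A.tgt ≫ A.one) :
    A.cmp g f (by simp [hg, A.one_src]) = f := by
  subst hg
  have := precomp_cmp f (A := A) (g := A.tgt ≫ A.one) (f := 𝟙 _) (by simp [A.one_src])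
  rw [cmp_congr rfl (Category.comp_id f).symm, ← this, cmp, A.one_comp, Category.comp_id]

lemma cmp_assoc {Z : C} (h g f : Z ⟶ A.arr) (hg : h ≫ A.src = g ≫ A.tgt)
    (gf : g ≫ A.src = f ≫ A.tgt) :
    A.cmp h (A.cmp g f gf) (by rw [cmp_tgt, hg]) = A.cmp (A.cmp h g hg) f (by rw [cmp_src, gf]) :=
  A.comp_assoc h g f hg gf

lemma rst_cmp {Z : C} {g f : Z ⟶ A.arr} (h : g ≫ A.src = f ≫ A.tgt) :
    rst (A.cmp g f h) = rst f :=
  rst_eq_of_comp_total (cmp_src h)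

variable (A)

instance : IsTotal A.one := by
  have : IsTotal (A.one ≫ A.src) := by rw [A.one_src]; infer_instance
  exact IsTotal.of_comp A.one A.src

/-- Partial sections of the source map. -/
@[ext] structure Section where
  hom : A.obj ⟶ A.arr
  isSection : IsPartialSection A.src hom

variable {A}

lemma Section.src (s : A.Section) : s.hom ≫ A.src = rst s.hom := s.isSection

/-- The product `t * s` of partial sections: `s`, followed by the pullback of `t` along the
target map, followed by composition. -/
noncomputable def Section.mulHom (t s : A.Section) : A.obj ⟶ A.arr :=
  s.hom ≫ pullSection A.src A.tgt t.hom t.isSection ≫ A.comp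

lemma Section.mul_aux (t s : A.Section) :
    (s.hom ≫ A.tgt ≫ t.hom) ≫ A.src = (rst (s.hom ≫ A.tgt ≫ t.hom) ≫ s.hom) ≫ A.tgt := by
  have := comp_rst (s.hom ≫ A.tgt) t.hom
  simp only [Category.assoc] at this
  simp only [Category.assoc, t.src, this]

lemma Section.mulHom_eq (t s : A.Section) :
    t.mulHom s = A.cmp (s.hom ≫ A.tgt ≫ t.hom) (rst (s.hom ≫ A.tgt ≫ t.hom) ≫ s.hom)
      (t.mul_aux s) := by
  rw [mulHom, cmp, ← Category.assoc]
  congr 1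
  apply pullback.hom_ext
  · simp only [pullSection, Category.assoc, pullback.lift_fst]
  · simp only [pullSection, Category.assoc, pullback.lift_snd, comp_rst]

lemma Section.rst_mulHom (t s : A.Section) : rst (t.mulHom s) = rst (s.hom ≫ A.tgt ≫ t.hom) := by
  rw [mulHom_eq, rst_cmp, rst_rst_comp, rst_comp_rst_comp]

noncomputable instance : Mul A.Section where
  mul t s := ⟨t.mulHom s, by
    rw [IsPartialSection, t.rst_mulHom, t.mulHom_eq, cmp_src, Category.assoc, s.src,
      rst_comp_rst_comp]⟩

instance : One A.Section where
  one := ⟨A.one, by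
    rw [IsPartialSection, A.one_src, IsTotal.rst_eq]⟩

lemma Section.one_hom : (1 : A.Section).hom = A.one := rfl

lemma Section.mul_hom (t s : A.Section) :
    (t * s).hom = A.cmp (s.hom ≫ A.tgt ≫ t.hom) (rst (s.hom ≫ A.tgt ≫ t.hom) ≫ s.hom)
      (t.mul_aux s) := t.mulHom_eq s

lemma Section.rst_mul (t s : A.Section) : rst (t * s).hom = rst (s.hom ≫ A.tgt ≫ t.hom) :=
  t.rst_mulHom s

lemma Section.mul_tgt (t s : A.Section) :
    (t * s).hom ≫ A.tgt = (s.hom ≫ A.tgt) ≫ t.hom ≫ A.tgt := by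
  rw [mul_hom, cmp_tgt]; simp

noncomputable instance : Monoid A.Section where
  mul_assoc u t s := by
    ext
    have h1 : s.hom ≫ A.tgt ≫ (u * t).hom =
        A.cmp (s.hom ≫ A.tgt ≫ t.hom ≫ A.tgt ≫ u.hom)
          (rst (s.hom ≫ A.tgt ≫ t.hom ≫ A.tgt ≫ u.hom) ≫ s.hom ≫ A.tgt ≫ t.hom) (by
            have := comp_rst (s.hom ≫ A.tgt ≫ t.hom ≫ A.tgt) u.hom
            simp only [Category.assoc] at this
            simp only [Category.assoc, u.src, this]) := by
      rw [Section.mul_hom, ← Category.assoc, precomp_cmp]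
      refine cmp_congr (by simp only [Category.assoc]) ?_ _
      rw [← Category.assoc, comp_rst]
      simp only [Category.assoc]
    have h2 : (t * s).hom ≫ A.tgt ≫ u.hom = s.hom ≫ A.tgt ≫ t.hom ≫ A.tgt ≫ u.hom := by
      rw [← Category.assoc, Section.mul_tgt]
      simp only [Category.assoc]
    have h3 : rst (s.hom ≫ A.tgt ≫ t.hom ≫ A.tgt ≫ u.hom) ≫ rst (s.hom ≫ A.tgt ≫ t.hom) =
        rst (s.hom ≫ A.tgt ≫ t.hom ≫ A.tgt ≫ u.hom) := by
      have := rst_comp_rst_comp (s.hom ≫ A.tgt ≫ t.hom) (A.tgt ≫ u.hom)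
      simpa only [Category.assoc] using this
    have h4 : rst (s.hom ≫ A.tgt ≫ (u * t).hom) =
        rst (s.hom ≫ A.tgt ≫ t.hom ≫ A.tgt ≫ u.hom) := by
      rw [h1, rst_cmp, rst_rst_comp, h3]
    have h5 : rst (s.hom ≫ A.tgt ≫ t.hom ≫ A.tgt ≫ u.hom) ≫ (t * s).hom =
        A.cmp (rst (s.hom ≫ A.tgt ≫ t.hom ≫ A.tgt ≫ u.hom) ≫ s.hom ≫ A.tgt ≫ t.hom)
          (rst (s.hom ≫ A.tgt ≫ t.hom ≫ A.tgt ≫ u.hom) ≫ s.hom) (by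
            have := comp_rst (s.hom ≫ A.tgt) t.hom
            simp only [Category.assoc] at this
            simp only [Category.assoc, t.src, this]
            rw [← Category.assoc, h3]) := by
      rw [Section.mul_hom, precomp_cmp]
      exact cmp_congr rfl (by rw [← Category.assoc, h3]) _
    rw [Section.mul_hom (u * t) s, Section.mul_hom u (t * s), cmp_congr h1 (by rw [h4]) _,
      cmp_congr h2 (by rw [h2, h5]) _, cmp_assoc]
  one_mul s := by
    ext
    rw [Section.mul_hom]
    simp only [Section.one_hom]
    have e : rst (s.hom ≫ A.tgt ≫ A.one) = rst s.hom := rst_comp_total _ _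
    rw [cmp_congr rfl (by rw [e, rst_comp_self] : _ = s.hom), one_cmp _ rfl]
  mul_one s := by
    ext
    rw [Section.mul_hom]
    simp only [Section.one_hom]
    have e : A.one ≫ A.tgt ≫ s.hom = s.hom := by
      rw [← Category.assoc, A.one_tgt, Category.id_comp]
    rw [cmp_congr e (by rw [e] : _ = rst s.hom ≫ A.one), cmp_one]
    rw [← Category.assoc, s.src]

/-- The restriction of a partial section, as a partial section. -/
def Section.restr (s : A.Section) : A.Section :=
  ⟨rst s.hom ≫ A.one, by
    rw [IsPartialSection, rst_comp_total, rst_rst, Category.assoc, A.one_src, Category.comp_id]⟩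

lemma Section.restr_hom (s : A.Section) : s.restr.hom = rst s.hom ≫ A.one := rfl

lemma Section.mul_restr_hom (t s : A.Section) : (t * s.restr).hom = rst s.hom ≫ t.hom := by
  have e : s.restr.hom ≫ A.tgt ≫ t.hom = rst s.hom ≫ t.hom := by
    rw [restr_hom, Category.assoc, ← Category.assoc A.one, A.one_tgt, Category.id_comp]
  rw [mul_hom, cmp_congr e (by rw [e, rst_rst_comp, restr_hom] : _ =
    (rst s.hom ≫ rst t.hom) ≫ rst s.hom ≫ A.one), cmp_one]
  rw [rst_comm s.hom, Category.assoc, ← Category.assoc (rst s.hom), rst_idem, Category.assoc,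
    ← Category.assoc t.hom, t.src, ← Category.assoc, ← Category.assoc, rst_comm]

lemma Section.restr_mul_hom (t s : A.Section) :
    (t.restr * s).hom = rst (s.hom ≫ A.tgt ≫ t.hom) ≫ s.hom := by
  have e0 : s.hom ≫ A.tgt ≫ rst t.hom = rst (s.hom ≫ A.tgt ≫ t.hom) ≫ s.hom ≫ A.tgt := by
    have := comp_rst (s.hom ≫ A.tgt) t.hom
    simpa only [Category.assoc] using this
  have e : s.hom ≫ A.tgt ≫ t.restr.hom =
      (rst (s.hom ≫ A.tgt ≫ t.hom) ≫ s.hom) ≫ A.tgt ≫ A.one := by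
    rw [restr_hom, ← Category.assoc A.tgt, ← Category.assoc s.hom, e0]
    simp only [Category.assoc]
  have e1 : rst (s.hom ≫ A.tgt ≫ t.restr.hom) = rst (s.hom ≫ A.tgt ≫ t.hom) := by
    rw [e, rst_comp_total, rst_rst_comp, rst_comp_rst_comp]
  rw [mul_hom, cmp_congr e (by rw [e1]), one_cmp _ rfl]

lemma Section.mul_restr_self (s : A.Section) : s * s.restr = s := by
  ext
  rw [mul_restr_hom, rst_comp_self]

lemma Section.restr_comm (s t : A.Section) : s.restr * t.restr = t.restr * s.restr := by
  ext
  rw [mul_restr_hom, mul_restr_hom, restr_hom, restr_hom, ← Category.assoc, rst_comm,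
    Category.assoc]

lemma Section.restr_mul (s t : A.Section) : t.restr * s = s * (t * s).restr := by
  ext
  rw [mul_restr_hom, restr_mul_hom, rst_mul]

lemma Section.le_iff (s t : A.Section) : s = t * s.restr ↔ RLe s.hom t.hom := by
  rw [RLe, ← mul_restr_hom, Section.ext_iff]

lemma Section.mul_le_mul {s t : A.Section} (h : RLe s.hom t.hom) (g : A.Section) :
    RLe (s * g).hom (t * g).hom := by
  rw [← le_iff] at h ⊢
  conv_lhs => rw [h, mul_assoc, restr_mul, ← mul_assoc]

variable (A) in
/-- The partial bisections of `A`: the partial sections `s` of the source map such that `s`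
followed by the target map is a partial isomorphism. -/
def Bisections : Submonoid A.Section where
  carrier := {s | IsPartialIso (s.hom ≫ A.tgt)}
  one_mem' := ⟨𝟙 _, by
    rw [Section.one_hom, A.one_tgt]
    simp [IsPartialInverse]⟩
  mul_mem' := by
    rintro t s ⟨t', ht⟩ ⟨s', hs⟩
    refine ⟨t' ≫ s', ?_⟩
    rw [Section.mul_tgt]
    exact hs.comp ht

end InternalCategory

open InternalCategory

variable (C) in
/-- An étale internal groupoid: an internal category with inverses whose source map is a local
homeomorphism. -/
structure EtaleGroupoid extends InternalCategory C where
  inv : arr ⟶ arr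
  inv_inv : inv ≫ inv = 𝟙 arr
  inv_src : inv ≫ src = tgt
  inv_comp : pullback.lift inv (𝟙 arr) (by simp [inv_src]) ≫ comp = src ≫ one
  etale : IsLocalHomeo src

namespace EtaleGroupoid

variable (G : EtaleGroupoid C)

lemma inv_tgt : G.inv ≫ G.tgt = G.src := by
  rw [← G.inv_src, ← Category.assoc, G.inv_inv, Category.id_comp]

instance : IsTotal G.inv := by
  have : IsTotal (G.inv ≫ G.src) := by rw [G.inv_src]; infer_instance
  exact IsTotal.of_comp G.inv G.src

lemma inv_cmp {Z : C} (f : Z ⟶ G.arr) :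
    G.cmp (f ≫ G.inv) f (by simp [G.inv_src]) = f ≫ G.src ≫ G.one := by
  have := precomp_cmp (A := G.toInternalCategory) f (g := G.inv) (f := 𝟙 _) (by simp [G.inv_src])
  rw [cmp_congr rfl (Category.comp_id f).symm, ← this, InternalCategory.cmp, G.inv_comp]

lemma cmp_inv {Z : C} (f : Z ⟶ G.arr) :
    G.cmp f (f ≫ G.inv) (by simp [G.inv_tgt]) = f ≫ G.tgt ≫ G.one := by
  have h := G.inv_cmp (f ≫ G.inv)
  rw [cmp_congr (by rw [Category.assoc, G.inv_inv, Category.comp_id] : _ = f) rfl] at h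
  rw [h, ← G.inv_src]
  simp only [Category.assoc]

variable {G}

/-- The candidate inverse of a partial section, given a partial inverse `k` of its composite with
the target map. -/
def invSection (s : G.Section) (k : G.obj ⟶ G.obj) (hk : IsPartialInverse (s.hom ≫ G.tgt) k) :
    G.Section :=
  ⟨k ≫ s.hom ≫ G.inv, by
    have e : k ≫ s.hom ≫ G.inv ≫ G.src = rst k := by rw [G.inv_src, hk.2]
    have e1 : (k ≫ s.hom ≫ G.inv) ≫ G.src = rst k := by simpa only [Category.assoc] using e
    rw [IsPartialSection, ← rst_comp_total _ G.src, e1, rst_rst]⟩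

lemma invSection_hom (s : G.Section) (k : G.obj ⟶ G.obj)
    (hk : IsPartialInverse (s.hom ≫ G.tgt) k) :
    (invSection s k hk).hom = k ≫ s.hom ≫ G.inv := rfl

lemma rst_invSection (s : G.Section) (k : G.obj ⟶ G.obj)
    (hk : IsPartialInverse (s.hom ≫ G.tgt) k) : rst (invSection s k hk).hom = rst k := by
  rw [← (invSection s k hk).src, invSection_hom, Category.assoc, Category.assoc, G.inv_src, hk.2]

lemma comp_rst_of_inv (s : G.Section) (k : G.obj ⟶ G.obj)
    (hk : IsPartialInverse (s.hom ≫ G.tgt) k) : k ≫ rst s.hom = k := by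
  rw [← rst_comp_total s.hom G.tgt, ← hk.1, ← Category.assoc, hk.2, rst_comp_self]

lemma invSection_tgt (s : G.Section) (k : G.obj ⟶ G.obj)
    (hk : IsPartialInverse (s.hom ≫ G.tgt) k) : (invSection s k hk).hom ≫ G.tgt = k := by
  rw [invSection_hom, Category.assoc, Category.assoc, G.inv_tgt, s.src, comp_rst_of_inv s k hk]

lemma invSection_mul (s : G.Section) (k : G.obj ⟶ G.obj)
    (hk : IsPartialInverse (s.hom ≫ G.tgt) k) : invSection s k hk * s = s.restr := by
  ext
  have e : s.hom ≫ G.tgt ≫ (invSection s k hk).hom = s.hom ≫ G.inv := by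
    rw [invSection_hom, ← Category.assoc, ← Category.assoc, hk.1, rst_comp_total,
      ← Category.assoc, rst_comp_self]
  rw [Section.mul_hom, cmp_congr e (by rw [e, rst_comp_total, rst_comp_self]), inv_cmp,
    ← Category.assoc, s.src, Section.restr_hom]

lemma mul_invSection (s : G.Section) (k : G.obj ⟶ G.obj)
    (hk : IsPartialInverse (s.hom ≫ G.tgt) k) :
    s * invSection s k hk = (invSection s k hk).restr := by
  ext
  have e : (invSection s k hk).hom ≫ G.tgt ≫ s.hom = k ≫ s.hom := by
    rw [← Category.assoc, invSection_tgt]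
  have e1 : rst (k ≫ s.hom) = rst (invSection s k hk).hom := by
    rw [rst_invSection, ← rst_comp_rst, comp_rst_of_inv s k hk]
  rw [Section.mul_hom, cmp_congr e (by
    rw [e, e1, rst_comp_self, invSection_hom, ← Category.assoc] : _ = (k ≫ s.hom) ≫ G.inv),
    cmp_inv, Section.restr_hom, rst_invSection, ← hk.2]
  simp only [Category.assoc]

noncomputable instance : Inv G.Bisections where
  inv s := ⟨invSection s.1 s.2.choose s.2.choose_spec, _, by
    rw [invSection_tgt]
    exact s.2.choose_spec.symm⟩

lemma inv_mul_eq (s : G.Bisections) : (s⁻¹ * s).1 = s.1.restr :=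
  invSection_mul s.1 s.2.choose s.2.choose_spec

lemma mul_inv_eq (s : G.Bisections) : (s * s⁻¹).1 = (s⁻¹).1.restr :=
  mul_invSection s.1 s.2.choose s.2.choose_spec

lemma isPartialInverse_inv (s : G.Bisections) :
    IsPartialInverse (s.1.hom ≫ G.tgt) ((s⁻¹).1.hom ≫ G.tgt) := by
  have : (s⁻¹).1.hom ≫ G.tgt = s.2.choose :=
    invSection_tgt s.1 s.2.choose s.2.choose_spec
  rw [this]
  exact s.2.choose_spec

noncomputable instance : InverseMonoid G.Bisections where
  mul_inv_mul s := by
    rw [mul_assoc]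
    ext1
    rw [Submonoid.coe_mul, inv_mul_eq, Section.mul_restr_self]
  inv_mul_inv s := by
    rw [mul_assoc]
    ext1
    rw [Submonoid.coe_mul, mul_inv_eq, Section.mul_restr_self]
  inv_unique := by
    refine eq_inv_of_restriction (fun s => s⁻¹ * s) (fun s => s⁻¹) ?_ ?_ ?_ (fun _ => rfl) ?_
    · intro s
      ext1
      rw [Submonoid.coe_mul, inv_mul_eq, Section.mul_restr_self]
    · intro s t
      ext1
      rw [Submonoid.coe_mul _ (s⁻¹ * s), Submonoid.coe_mul _ (t⁻¹ * t), inv_mul_eq, inv_mul_eq,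
        Section.restr_comm]
    · intro s t
      ext1
      rw [Submonoid.coe_mul _ (t⁻¹ * t), Submonoid.coe_mul _ s, inv_mul_eq, inv_mul_eq,
        Submonoid.coe_mul, Section.restr_mul]
    · intro s
      ext1
      rw [mul_inv_eq, inv_mul_eq]

open InverseMonoid

lemma nle_iff (s t : G.Bisections) : NLe s t ↔ RLe s.1.hom t.1.hom := by
  rw [NLe, ← Section.le_iff, Subtype.ext_iff, Submonoid.coe_mul, inv_mul_eq]

lemma ncompat_iff (s t : G.Bisections) : NCompat s t ↔ Compat s.1.hom t.1.hom := by
  rw [NCompat, Subtype.ext_iff, Submonoid.coe_mul _ s, Submonoid.coe_mul _ t, inv_mul_eq, inv_mul_eq,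
    Section.ext_iff, Section.mul_restr_hom, Section.mul_restr_hom, Compat]

variable [JoinRestrictionCategory C]

lemma exists_bisection_join (F : Set G.Bisections) (hF : ∀ s ∈ F, ∀ t ∈ F, BiCompat s t) :
    ∃ j : G.Bisections, IsNJoin F j ∧ IsJoin ((fun s : G.Bisections => s.1.hom) '' F) j.1.hom := by
  have hc : ∀ f ∈ (fun s : G.Bisections => s.1.hom) '' F,
      ∀ g ∈ (fun s : G.Bisections => s.1.hom) '' F, Compat f g := by
    rintro _ ⟨s, hs, rfl⟩ _ ⟨t, ht, rfl⟩
    exact (ncompat_iff s t).1 (hF s hs t ht).1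
  obtain ⟨j, hj⟩ := JoinRestrictionCategory.exists_join _ hc
  have h1 : IsPartialSection G.src j := by
    have h2 := hj.postcomp G.src
    have h3 := hj.join_rst
    rw [Set.image_image] at h2 h3
    rw [Set.image_congr (fun (s : G.Bisections) _ => s.1.src)] at h2
    exact h2.unique h3
  have h2 : IsPartialIso (j ≫ G.tgt) := by
    refine (hj.postcomp G.tgt).isPartialIso ?_ ?_
    · rintro _ ⟨_, ⟨s, hs, rfl⟩, rfl⟩
      exact s.2
    · rintro _ ⟨_, ⟨s, hs, rfl⟩, rfl⟩ _ ⟨_, ⟨s', hs', rfl⟩, rfl⟩ t t' ht ht'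
      rw [ht.unique (isPartialInverse_inv s), ht'.unique (isPartialInverse_inv s')]
      exact ((ncompat_iff _ _).1 (hF s hs s' hs').2).postcomp _
  refine ⟨⟨⟨j, h1⟩, h2⟩, ⟨fun s hs => ?_, fun k hk => ?_⟩, hj⟩
  · rw [nle_iff]
    exact hj.1 _ ⟨s, hs, rfl⟩
  · rw [nle_iff]
    refine hj.2 _ ?_
    rintro _ ⟨s, hs, rfl⟩
    exact (nle_iff _ _).1 (hk s hs)

noncomputable instance : JoinInverseMonoid G.Bisections where
  exists_join F hF := by
    obtain ⟨j, hj, -⟩ := exists_bisection_join F hF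
    exact ⟨j, hj⟩
  join_mul F j hF hj g := by
    obtain ⟨j', hj', hJ⟩ := exists_bisection_join F hF
    have e : j = j' := by
      have a1 := (nle_iff _ _).1 (hj.2 _ hj'.1)
      have a2 := (nle_iff _ _).1 (hj'.2 _ hj.1)
      exact Subtype.ext (Section.ext (a1.antisymm a2))
    subst e
    have hle : ∀ s ∈ F, RLe (s.1 * g.1).hom (j.1 * g.1).hom := fun s hs =>
      Section.mul_le_mul (hJ.1 _ ⟨s, hs, rfl⟩) g.1
    refine ⟨?_, fun k hk => ?_⟩
    · rintro _ ⟨s, hs, rfl⟩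
      exact (nle_iff _ _).2 (hle s hs)
    · have h1 := (JoinRestrictionCategory.join_precomp _ _ hJ.compat hJ
        (g.1.hom ≫ G.tgt)).join_rst
      have h2 : rst ((g.1.hom ≫ G.tgt) ≫ j.1.hom) ≫ (j.1 * g.1).hom =
          rst ((g.1.hom ≫ G.tgt) ≫ j.1.hom) ≫ k.1.hom := by
        refine h1.comp_eq ?_
        rintro _ ⟨_, ⟨_, ⟨s, hs, rfl⟩, rfl⟩, rfl⟩
        have a1 := hle s hs
        have a2 := (nle_iff _ _).1 (hk _ ⟨s, hs, rfl⟩)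
        rw [Submonoid.coe_mul] at a2
        unfold RLe at a1 a2
        rw [Section.rst_mul] at a1 a2
        simp only [Category.assoc]
        rw [← a1, ← a2]
      rw [nle_iff, Submonoid.coe_mul, RLe, Section.rst_mul, ← Category.assoc, ← h2,
        Category.assoc, ← Section.rst_mul, rst_comp_self]

end EtaleGroupoid

/-! ### Cofunctors -/

/-- An internal cofunctor from `A` to `B`: a total map `obj` from the objects of `B` to those of
`A`, and a map `map` sending an arrow `f` of `A` and an object `b` of `B` lying over its source
to an arrow of `B` with source `b`. The composition axiom is written for generalized elements of
the object of triples consisting of two composable arrows of `A` and an object of `B` over the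
source of the first one. (The map `map` is automatically total.) -/
structure Cofunctor (A B : InternalCategory C) where
  obj : B.obj ⟶ A.obj
  [total_obj : IsTotal obj]
  map : pullback A.src obj ⟶ B.arr
  map_src : map ≫ B.src = pullback.snd A.src obj
  map_tgt : map ≫ B.tgt ≫ obj = pullback.fst A.src obj ≫ A.tgt
  map_one : pullback.lift (obj ≫ A.one) (𝟙 B.obj) (by simp [A.one_src]) ≫ map = B.one
  map_comp : ∀ {Z : C} (g f : Z ⟶ A.arr) (b : Z ⟶ B.obj) (hg : g ≫ A.src = f ≫ A.tgt)
    (hf : f ≫ A.src = b ≫ obj),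
    pullback.lift (A.cmp g f hg) b (by rw [cmp_src, hf]) ≫ map =
      B.cmp
        (pullback.lift g ((pullback.lift f b hf ≫ map) ≫ B.tgt)
          (by rw [Category.assoc, Category.assoc, map_tgt, pullback.lift_fst_assoc, hg]) ≫ map)
        (pullback.lift f b hf ≫ map)
        (by rw [Category.assoc, map_src, pullback.lift_snd])

attribute [instance] Cofunctor.total_obj

namespace Cofunctor

variable {A B D : InternalCategory C}

/-- The action of a cofunctor on generalized elements. -/
noncomputable def act (F : Cofunctor A B) {Z : C} (f : Z ⟶ A.arr) (b : Z ⟶ B.obj)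
    (h : f ≫ A.src = b ≫ F.obj) : Z ⟶ B.arr :=
  pullback.lift f b h ≫ F.map

lemma act_src (F : Cofunctor A B) {Z : C} {f : Z ⟶ A.arr} {b : Z ⟶ B.obj}
    (h : f ≫ A.src = b ≫ F.obj) : F.act f b h ≫ B.src = b := by
  rw [act, Category.assoc, F.map_src, pullback.lift_snd]

lemma act_tgt (F : Cofunctor A B) {Z : C} {f : Z ⟶ A.arr} {b : Z ⟶ B.obj}
    (h : f ≫ A.src = b ≫ F.obj) : F.act f b h ≫ B.tgt ≫ F.obj = f ≫ A.tgt := by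
  rw [act, Category.assoc, F.map_tgt, pullback.lift_fst_assoc]

lemma precomp_act (F : Cofunctor A B) {W Z : C} (k : W ⟶ Z) {f : Z ⟶ A.arr} {b : Z ⟶ B.obj}
    (h : f ≫ A.src = b ≫ F.obj) :
    k ≫ F.act f b h = F.act (k ≫ f) (k ≫ b) (by simp [h]) := by
  rw [act, act, ← Category.assoc]
  congr 1
  apply pullback.hom_ext <;> simp only [Category.assoc, pullback.lift_fst, pullback.lift_snd]

lemma act_congr (F : Cofunctor A B) {Z : C} {f f' : Z ⟶ A.arr} {b b' : Z ⟶ B.obj}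
    (hf : f = f') (hb : b = b') (h : f ≫ A.src = b ≫ F.obj) :
    F.act f b h = F.act f' b' (by rw [← hf, ← hb, h]) := by
  subst hf hb; rfl

lemma act_one (F : Cofunctor A B) {Z : C} {f : Z ⟶ A.arr} (b : Z ⟶ B.obj)
    (hf : f = b ≫ F.obj ≫ A.one) : F.act f b (by simp [hf, A.one_src]) = b ≫ B.one := by
  subst hf
  have := F.precomp_act b (f := F.obj ≫ A.one) (b := 𝟙 _) (by simp [A.one_src])
  rw [F.act_congr rfl (Category.comp_id b).symm, ← this, act, F.map_one]

lemma act_cmp (F : Cofunctor A B) {Z : C} (g f : Z ⟶ A.arr) (b : Z ⟶ B.obj)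
    (hg : g ≫ A.src = f ≫ A.tgt) (hf : f ≫ A.src = b ≫ F.obj) :
    F.act (A.cmp g f hg) b (by rw [cmp_src, hf]) =
      B.cmp (F.act g (F.act f b hf ≫ B.tgt) (by rw [Category.assoc, act_tgt, hg]))
        (F.act f b hf) (by rw [act_src]) :=
  F.map_comp g f b hg hf

lemma rst_act (F : Cofunctor A B) {Z : C} {f : Z ⟶ A.arr} {b : Z ⟶ B.obj}
    (h : f ≫ A.src = b ≫ F.obj) : rst (F.act f b h) = rst b := by
  rw [← rst_comp_total _ B.src, act_src]

lemma ext_act {F G : Cofunctor A B} (h : F.obj = G.obj)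
    (h' : ∀ {Z : C} (f : Z ⟶ A.arr) (b : Z ⟶ B.obj) (hF : f ≫ A.src = b ≫ F.obj)
      (hG : f ≫ A.src = b ≫ G.obj), F.act f b hF = G.act f b hG) : F = G := by
  obtain ⟨o, m, _, _, _, _⟩ := F
  obtain ⟨o', m', _, _, _, _⟩ := G
  obtain rfl : o = o' := h
  have : m = m' := by
    have := h' (pullback.fst A.src o) (pullback.snd A.src o) pullback.condition pullback.condition
    have e : pullback.lift (pullback.fst A.src o) (pullback.snd A.src o) pullback.condition =
        𝟙 _ := by
      apply pullback.hom_ext <;> simp only [pullback.lift_fst, pullback.lift_snd, Category.id_comp]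
    simpa only [act, e, Category.id_comp] using this
  subst this
  rfl

variable (A) in
/-- The identity cofunctor. -/
noncomputable def id : Cofunctor A A where
  obj := 𝟙 A.obj
  map := pullback.fst A.src (𝟙 A.obj)
  map_src := by rw [pullback.condition, Category.comp_id]
  map_tgt := by rw [Category.comp_id]
  map_one := by rw [pullback.lift_fst, Category.id_comp]
  map_comp g f b hg hf := by
    rw [pullback.lift_fst]
    exact cmp_congr (by rw [pullback.lift_fst]) (by rw [pullback.lift_fst]) _

lemma id_act {Z : C} {f : Z ⟶ A.arr} {b : Z ⟶ A.obj} (h : f ≫ A.src = b ≫ 𝟙 A.obj) :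
    (id A).act f b h = f := pullback.lift_fst _ _ _

/-- The arrow map of the composite cofunctor: an arrow `f` of `A` and an object `d` of `D` are
sent to `G (F (f, G d), d)`. -/
noncomputable def compMap (F : Cofunctor A B) (G : Cofunctor B D) :
    pullback A.src (G.obj ≫ F.obj) ⟶ D.arr :=
  G.act
    (F.act (pullback.fst A.src (G.obj ≫ F.obj)) (pullback.snd A.src (G.obj ≫ F.obj) ≫ G.obj)
      (by rw [pullback.condition, Category.assoc]))
    (pullback.snd A.src (G.obj ≫ F.obj)) (by rw [act_src])

lemma lift_compMap (F : Cofunctor A B) (G : Cofunctor B D) {Z : C} {f : Z ⟶ A.arr}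
    {d : Z ⟶ D.obj} (h : f ≫ A.src = d ≫ G.obj ≫ F.obj) :
    pullback.lift f d h ≫ F.compMap G =
      G.act (F.act f (d ≫ G.obj) (by rw [h, Category.assoc])) d (by rw [act_src]) := by
  rw [compMap, precomp_act]
  refine act_congr _ ?_ (by rw [pullback.lift_snd]) _
  rw [precomp_act]
  exact act_congr _ (by rw [pullback.lift_fst]) (by rw [pullback.lift_snd_assoc]) _

lemma compMap_cmp (F : Cofunctor A B) (G : Cofunctor B D) {Z : C} (g f : Z ⟶ A.arr)
    (b : Z ⟶ D.obj) (hg : g ≫ A.src = f ≫ A.tgt) (hf : f ≫ A.src = b ≫ G.obj ≫ F.obj)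
    {w : Z ⟶ D.arr}
    (hw : w = G.act (F.act f (b ≫ G.obj) (by rw [hf, Category.assoc])) b (by rw [act_src]))
    (h1 : g ≫ A.src = (w ≫ D.tgt) ≫ G.obj ≫ F.obj)
    (h2 : (pullback.lift g (w ≫ D.tgt) h1 ≫ F.compMap G) ≫ D.src = w ≫ D.tgt) :
    pullback.lift (A.cmp g f hg) b (by rw [cmp_src, hf]) ≫ F.compMap G =
      D.cmp (pullback.lift g (w ≫ D.tgt) h1 ≫ F.compMap G) w h2 := by
  have hf' : f ≫ A.src = (b ≫ G.obj) ≫ F.obj := by rw [hf, Category.assoc]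
  have e1 : (w ≫ D.tgt) ≫ G.obj = F.act f (b ≫ G.obj) hf' ≫ B.tgt := by
    rw [hw, Category.assoc, act_tgt]
  have e2 := F.act_cmp g f (b ≫ G.obj) hg hf'
  have e3 := lift_compMap F G h1
  have hx : g ≫ A.src = (F.act f (b ≫ G.obj) hf' ≫ B.tgt) ≫ F.obj := by
    rw [h1, ← e1]; simp only [Category.assoc]
  have e4 : F.act g ((w ≫ D.tgt) ≫ G.obj) (by rw [h1]; simp only [Category.assoc]) =
      F.act g (F.act f (b ≫ G.obj) hf' ≫ B.tgt) hx := act_congr F rfl e1 _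
  rw [lift_compMap F G]
  refine (act_congr G e2 rfl _).trans ?_
  refine (G.act_cmp _ _ b _ (by rw [act_src])).trans ?_
  refine cmp_congr ?_ hw.symm _
  rw [e3]
  exact act_congr G e4.symm (by rw [hw]) _

/-- The composite cofunctor, `F` followed by `G`. -/
noncomputable def comp (F : Cofunctor A B) (G : Cofunctor B D) : Cofunctor A D where
  obj := G.obj ≫ F.obj
  map := F.compMap G
  map_src := by rw [compMap, act_src]
  map_tgt := by
    have h1 := G.act_tgt (f := F.act (pullback.fst A.src (G.obj ≫ F.obj))
      (pullback.snd A.src (G.obj ≫ F.obj) ≫ G.obj) (by rw [pullback.condition, Category.assoc]))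
      (b := pullback.snd A.src (G.obj ≫ F.obj)) (by rw [act_src])
    have h2 := congrArg (fun k => k ≫ F.obj) h1
    simp only [Category.assoc] at h2
    rw [compMap, h2, act_tgt]
  map_one := by
    rw [lift_compMap, act_congr G (F.act_one (𝟙 _ ≫ G.obj) (by simp)) rfl,
      G.act_one _ (by simp), Category.id_comp]
  map_comp g f b hg hf := compMap_cmp F G g f b hg hf (lift_compMap F G hf) _ _

lemma comp_act (F : Cofunctor A B) (G : Cofunctor B D) {Z : C} {f : Z ⟶ A.arr} {d : Z ⟶ D.obj}
    (h : f ≫ A.src = d ≫ G.obj ≫ F.obj) :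
    (F.comp G).act f d h =
      G.act (F.act f (d ≫ G.obj) (by rw [h, Category.assoc])) d (by rw [act_src]) :=
  lift_compMap F G h

/-- The image of a partial section of `A` under a cofunctor `F`: pull the section back along the
object map of `F`, then apply the arrow map. -/
noncomputable def sectionHom (F : Cofunctor A B) (s : A.Section) : B.obj ⟶ B.arr :=
  pullSection A.src F.obj s.hom s.isSection ≫ F.map

lemma section_aux (F : Cofunctor A B) (s : A.Section) :
    (F.obj ≫ s.hom) ≫ A.src = rst (F.obj ≫ s.hom) ≫ F.obj := by
  rw [Category.assoc, s.src, comp_rst]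

lemma sectionHom_eq (F : Cofunctor A B) (s : A.Section) :
    F.sectionHom s = F.act (F.obj ≫ s.hom) (rst (F.obj ≫ s.hom)) (F.section_aux s) := rfl

/-- The image of a partial section under a cofunctor, as a partial section. -/
noncomputable def mapSection (F : Cofunctor A B) (s : A.Section) : B.Section :=
  ⟨F.sectionHom s, by rw [IsPartialSection, sectionHom_eq, act_src, rst_act, rst_rst]⟩

lemma mapSection_hom (F : Cofunctor A B) (s : A.Section) :
    (F.mapSection s).hom = F.act (F.obj ≫ s.hom) (rst (F.obj ≫ s.hom)) (F.section_aux s) := rfl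

lemma rst_mapSection (F : Cofunctor A B) (s : A.Section) :
    rst (F.mapSection s).hom = rst (F.obj ≫ s.hom) := by
  rw [mapSection_hom, rst_act, rst_rst]

lemma mapSection_tgt (F : Cofunctor A B) (s : A.Section) :
    (F.mapSection s).hom ≫ B.tgt ≫ F.obj = F.obj ≫ s.hom ≫ A.tgt := by
  rw [mapSection_hom, act_tgt, Category.assoc]

lemma mapSection_one (F : Cofunctor A B) : F.mapSection 1 = 1 := by
  ext
  have e : rst (F.obj ≫ A.one) = 𝟙 _ := IsTotal.rst_eq
  rw [mapSection_hom]
  refine (act_congr F (by rw [Section.one_hom, Category.id_comp] : _ =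
    𝟙 _ ≫ F.obj ≫ A.one) e _).trans ?_
  rw [F.act_one _ rfl, Category.id_comp, Section.one_hom]

lemma mapSection_mul (F : Cofunctor A B) (t s : A.Section) :
    F.mapSection (t * s) = F.mapSection t * F.mapSection s := by
  ext
  have h0 : F.obj ≫ s.hom ≫ A.tgt ≫ t.hom = (F.mapSection s).hom ≫ B.tgt ≫ F.obj ≫ t.hom := by
    have := congrArg (fun k => k ≫ t.hom) (F.mapSection_tgt s)
    simp only [Category.assoc] at this
    exact this.symm
  set e := rst (F.obj ≫ s.hom ≫ A.tgt ≫ t.hom) with he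
  have h1 : e ≫ rst (F.obj ≫ s.hom) = e := by
    have := rst_comp_rst_comp (F.obj ≫ s.hom) (A.tgt ≫ t.hom)
    simpa only [Category.assoc] using this
  have hx : (F.obj ≫ s.hom ≫ A.tgt ≫ t.hom) ≫ A.src = (e ≫ F.obj ≫ s.hom) ≫ A.tgt := by
    have := comp_rst (F.obj ≫ s.hom ≫ A.tgt) t.hom
    simp only [Category.assoc] at this
    simp only [Category.assoc, t.src, this, he]
  have h2 : F.obj ≫ (t * s).hom =
      A.cmp (F.obj ≫ s.hom ≫ A.tgt ≫ t.hom) (e ≫ F.obj ≫ s.hom) hx := by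
    rw [Section.mul_hom, precomp_cmp]
    exact cmp_congr rfl (by rw [← Category.assoc, comp_rst, Category.assoc]) _
  have h3 : rst (F.obj ≫ (t * s).hom) = e := by
    rw [h2, rst_cmp, he, rst_rst_comp, ← he, h1]
  have hy : (e ≫ F.obj ≫ s.hom) ≫ A.src = e ≫ F.obj := by
    rw [Category.assoc, F.section_aux, ← Category.assoc, h1]
  have h4 : e ≫ (F.mapSection s).hom = F.act (e ≫ F.obj ≫ s.hom) e hy := by
    rw [mapSection_hom, precomp_act]
    exact act_congr _ rfl h1 _
  have h5 : (F.mapSection s).hom ≫ B.tgt ≫ (F.mapSection t).hom =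
      F.act (F.obj ≫ s.hom ≫ A.tgt ≫ t.hom) (F.act (e ≫ F.obj ≫ s.hom) e hy ≫ B.tgt)
        (by rw [hx, Category.assoc (F.act _ _ _), act_tgt]) := by
    rw [F.mapSection_hom t, ← Category.assoc, precomp_act]
    refine act_congr _ (by rw [h0, Category.assoc]) ?_ _
    rw [comp_rst, Category.assoc, ← h0, ← he, ← Category.assoc, h4]
  have h6 : rst ((F.mapSection s).hom ≫ B.tgt ≫ (F.mapSection t).hom) = e := by
    rw [h5, rst_act, rst_comp_total, rst_act, he, rst_rst]
  rw [mapSection_hom, act_congr F h2 h3, act_cmp _ _ _ _ _ hy, Section.mul_hom]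
  exact cmp_congr h5.symm (by rw [h6, h4]) _

lemma id_mapSection (s : A.Section) : (id A).mapSection s = s := by
  ext
  exact (id_act _).trans (Category.id_comp _)

lemma comp_mapSection (F : Cofunctor A B) (G : Cofunctor B D) (s : A.Section) :
    (F.comp G).mapSection s = G.mapSection (F.mapSection s) := by
  ext
  have e1 : G.obj ≫ (F.mapSection s).hom = F.act ((G.obj ≫ F.obj) ≫ s.hom)
      (rst ((G.obj ≫ F.obj) ≫ s.hom) ≫ G.obj) (by
        rw [Category.assoc, Category.assoc, s.src, Category.assoc, ← Category.assoc, comp_rst,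
          Category.assoc]) := by
    rw [mapSection_hom, precomp_act]
    exact act_congr _ (by rw [Category.assoc]) (by rw [comp_rst, Category.assoc]) _
  have e2 : rst (G.obj ≫ (F.mapSection s).hom) = rst ((G.obj ≫ F.obj) ≫ s.hom) := by
    rw [e1, rst_act, rst_comp_total, rst_rst]
  rw [mapSection_hom, mapSection_hom]
  exact (comp_act F G _).trans (act_congr G e1.symm e2.symm _)

end Cofunctor

/-- Internal categories in `C` and internal cofunctors form a category. -/
noncomputable instance : Category (InternalCategory C) where
  Hom A B := Cofunctor A B
  id A := Cofunctor.id A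
  comp F G := F.comp G
  id_comp F := by
    refine Cofunctor.ext_act (Category.comp_id _) fun f b hF hG => ?_
    exact (Cofunctor.comp_act _ _ hF).trans
      (Cofunctor.act_congr _ (Cofunctor.id_act _) rfl _)
  comp_id F := by
    refine Cofunctor.ext_act (Category.id_comp _) fun f b hF hG => ?_
    exact ((Cofunctor.comp_act _ _ hF).trans (Cofunctor.id_act _)).trans
      (Cofunctor.act_congr _ rfl (Category.comp_id _) _)
  assoc F G H := by
    refine Cofunctor.ext_act (Category.assoc _ _ _).symm fun f b hF hG => ?_
    refine (Cofunctor.comp_act _ _ hF).trans ?_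
    refine Eq.trans ?_ (Cofunctor.comp_act _ _ hG).symm
    refine Eq.trans ?_ (Cofunctor.comp_act _ _ _).symm
    refine Cofunctor.act_congr _ ?_ rfl _
    refine (Cofunctor.comp_act _ _ _).trans ?_
    exact Cofunctor.act_congr _ (Cofunctor.act_congr _ rfl (Category.assoc _ _ _) _) rfl _

/-- Étale internal groupoids in `C` and internal cofunctors form a category. -/
noncomputable instance : Category (EtaleGroupoid C) where
  Hom G H := Cofunctor G.toInternalCategory H.toInternalCategory
  id G := 𝟙 G.toInternalCategory
  comp F F' := CategoryStruct.comp (obj := InternalCategory C) F F'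
  id_comp F := Category.id_comp (obj := InternalCategory C) F
  comp_id F := Category.comp_id (obj := InternalCategory C) F
  assoc F F' F'' := Category.assoc (obj := InternalCategory C) F F' F''

/-! ### Complete pseudogroups -/

variable (C) in
/-- A complete `C`-pseudogroup: a join inverse monoid with a homomorphism to the monoid of
partial automorphisms of an object of `C` which restricts to an isomorphism on idempotents. (A
bijection suffices, as idempotents commute and the homomorphism preserves products.) -/
structure PsGrp where
  carrier : Type v
  [str : JoinInverseMonoid carrier]
  base : C
  θ : carrier →* PartialAut base
  bijOn_idem : Set.BijOn θ {e | IsIdempotentElem e} {e | IsIdempotentElem e}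

attribute [instance] PsGrp.str

namespace PsGrp

/-- The partial automorphism of the base given by an element of the monoid. -/
def act (P : PsGrp C) (s : P.carrier) : P.base ⟶ P.base := End.asHom (P.θ s : End P.base)

/-- A morphism of complete pseudogroups: a monoid homomorphism and a total map between the bases
in the opposite direction, compatible with the actions. -/
@[ext] structure Hom (P Q : PsGrp C) where
  hom : P.carrier →* Q.carrier
  base : Q.base ⟶ P.base
  total_base : IsTotal base
  comm : ∀ s : P.carrier, base ≫ P.act s = Q.act (hom s) ≫ base

instance : Category (PsGrp C) where
  Hom P Q := Hom P Q
  id P := ⟨MonoidHom.id _, 𝟙 _, inferInstance, fun s => by simp⟩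
  comp f g := ⟨g.hom.comp f.hom, g.base ≫ f.base,
    by have := f.total_base; have := g.total_base; infer_instance, fun s => by
      rw [Category.assoc, f.comm, ← Category.assoc, g.comm, Category.assoc]; rfl⟩
  id_comp f := Hom.ext (MonoidHom.ext fun _ => rfl) (Category.comp_id _)
  comp_id f := Hom.ext (MonoidHom.ext fun _ => rfl) (Category.id_comp _)
  assoc f g h := Hom.ext (MonoidHom.ext fun _ => rfl) (Category.assoc _ _ _).symm

end PsGrp

/-! ### From étale groupoids to pseudogroups -/

section Phi

namespace EtaleGroupoid

/-- The homomorphism sending a partial bisection `s` to `s` followed by the target map. -/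
def anchor (G : EtaleGroupoid C) : G.Bisections →* PartialAut G.obj where
  toFun s := ⟨End.of (s.1.hom ≫ G.tgt), s.2⟩
  map_one' := Subtype.ext G.one_tgt
  map_mul' t s := Subtype.ext (Section.mul_tgt t.1 s.1)

/-- An idempotent partial isomorphism is a restriction idempotent. -/
lemma idem_eq_rst {X : C} {e : X ⟶ X} (h : IsPartialIso e) (he : e ≫ e = e) : e = rst e := by
  obtain ⟨t, ht⟩ := h
  have h1 : e ≫ rst e = e := by rw [comp_rst, he, rst_comp_self]
  calc e = e ≫ rst e := h1.symm
    _ = (e ≫ e) ≫ t := by rw [← ht.1, Category.assoc]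
    _ = rst e := by rw [he, ht.1]

lemma idem_eq_restr {G : EtaleGroupoid C} {s : G.Bisections} (h : s * s = s) :
    s.1 = s.1.restr := by
  have h1 : (s⁻¹ * s) * s = s := by
    ext1
    rw [Submonoid.coe_mul (S := G.Bisections) (s⁻¹ * s) s, inv_mul_eq, Section.restr_mul,
      ← Submonoid.coe_mul, h,
      Section.mul_restr_self]
  rw [← inv_mul_eq]
  conv_lhs => rw [← h1, mul_assoc, h]

end EtaleGroupoid

/-- The image of a partial bisection under a cofunctor is a partial bisection. -/
lemma Cofunctor.mapSection_mem {G : EtaleGroupoid C} {B : InternalCategory C}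
    (F : Cofunctor G.toInternalCategory B) (s : G.Bisections) :
    F.mapSection s.1 ∈ B.Bisections := by
  have key : ∀ s t : G.Bisections, t = s⁻¹ → ((F.mapSection s.1).hom ≫ B.tgt) ≫
      (F.mapSection t.1).hom ≫ B.tgt = rst ((F.mapSection s.1).hom ≫ B.tgt) := by
    rintro s _ rfl
    rw [← Section.mul_tgt, ← F.mapSection_mul, ← Submonoid.coe_mul,
      EtaleGroupoid.inv_mul_eq, rst_comp_total, F.rst_mapSection, F.mapSection_hom]
    have e : rst (F.obj ≫ s.1.restr.hom) = rst (F.obj ≫ s.1.hom) := by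
      rw [Section.restr_hom, ← Category.assoc, rst_comp_total, rst_comp_rst]
    rw [F.act_congr (by
      rw [Section.restr_hom, ← Category.assoc, comp_rst, Category.assoc] : _ =
        rst (F.obj ≫ s.1.hom) ≫ F.obj ≫ G.one) e, F.act_one _ rfl, Category.assoc, B.one_tgt,
      Category.comp_id]
  refine ⟨(F.mapSection (s⁻¹).1).hom ≫ B.tgt, key s _ rfl, key s⁻¹ s ?_⟩
  exact InverseMonoid.inv_unique _ _ (InverseMonoid.inv_mul_inv s) (InverseMonoid.mul_inv_mul s)

variable [JoinRestrictionCategory C]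

namespace EtaleGroupoid

/-- The complete pseudogroup of partial bisections of an étale groupoid. -/
noncomputable def toPsGrp (G : EtaleGroupoid C) : PsGrp C where
  carrier := G.Bisections
  base := G.obj
  θ := G.anchor
  bijOn_idem := by
    refine ⟨fun s hs => ?_, fun s hs t ht h => ?_, fun e he => ?_⟩
    · exact IsIdempotentElem.map (show IsIdempotentElem s from hs) G.anchor
    · have h1 : s.1.hom ≫ G.tgt = t.1.hom ≫ G.tgt := congrArg Subtype.val h
      rw [Subtype.ext_iff, idem_eq_restr hs, idem_eq_restr ht, Section.ext_iff,
        Section.restr_hom, Section.restr_hom, rst_eq_of_comp_total h1]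
    · have h1 : End.asHom e.1 = rst (End.asHom e.1) :=
        idem_eq_rst e.2 (congrArg Subtype.val (show e * e = e from he))
      have hs : (rst (End.asHom e.1) ≫ G.one) ≫ G.src = rst (rst (End.asHom e.1) ≫ G.one) := by
        rw [Category.assoc, G.one_src, Category.comp_id, rst_comp_total, rst_rst]
      have ht : (rst (End.asHom e.1) ≫ G.one) ≫ G.tgt = End.asHom e.1 := by
        rw [Category.assoc, G.one_tgt, Category.comp_id, ← h1]
      have hr : (⟨_, hs⟩ : G.Section) = Section.restr ⟨_, hs⟩ := by
        ext
        rw [Section.restr_hom]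
        simp only [rst_comp_total, rst_rst]
      refine ⟨⟨⟨_, hs⟩, ?_⟩, ?_, ?_⟩
      · change IsPartialIso _
        simp only [ht]
        exact e.2
      · refine Subtype.ext ?_
        change (⟨_, hs⟩ : G.Section) * ⟨_, hs⟩ = ⟨_, hs⟩
        conv_lhs =>
          arg 2
          rw [hr]
        rw [Section.mul_restr_self]
      · exact Subtype.ext ht

end EtaleGroupoid

/-- The morphism of pseudogroups induced by a cofunctor: partial bisections are pushed forward,
and the map of bases is the object map. -/
noncomputable def Cofunctor.toPsGrpHom {G H : EtaleGroupoid C}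
    (F : Cofunctor G.toInternalCategory H.toInternalCategory) :
    PsGrp.Hom G.toPsGrp H.toPsGrp where
  hom :=
    { toFun := fun s => (⟨F.mapSection s.1, F.mapSection_mem s⟩ : H.Bisections)
      map_one' := Subtype.ext F.mapSection_one
      map_mul' := fun t s => Subtype.ext (F.mapSection_mul t.1 s.1) }
  base := F.obj
  total_base := F.total_obj
  comm s := by
    have := F.mapSection_tgt s.1
    exact this.symm.trans (Category.assoc _ _ _).symm

variable (C) in
/-- The functor sending an étale internal groupoid to its pseudogroup of partial bisections. -/
noncomputable def bisectionFunctor : EtaleGroupoid C ⥤ PsGrp C where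
  obj G := G.toPsGrp
  map F := Cofunctor.toPsGrpHom F
  map_id _ := PsGrp.Hom.ext
    (MonoidHom.ext fun s => Subtype.ext (Cofunctor.id_mapSection s.1)) rfl
  map_comp F F' := PsGrp.Hom.ext
    (MonoidHom.ext fun s => Subtype.ext (Cofunctor.comp_mapSection F F' s.1)) rfl

end Phi

/-! ### From pseudogroups to étale groupoids -/

/-- `d` is the extent to which `s` and `t` are equal: the join in `C` of the images of the
idempotents `e` of the monoid with `e ≤ (s⁻¹ s)(t⁻¹ t)` and `s e = t e`. -/
def PsGrp.IsExtentOfEquality (P : PsGrp C) (s t : P.carrier) (d : P.base ⟶ P.base) : Prop :=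
  IsJoin {c | ∃ e : P.carrier, IsIdempotentElem e ∧
    InverseMonoid.NLe e ((s⁻¹ * s) * (t⁻¹ * t)) ∧ s * e = t * e ∧ c = P.act e} d

/-- The étale groupoid `G` is an internalisation of the complete pseudogroup `P`: its object of
objects is the base of `P`, up to a specified isomorphism `i`; its source map is a glueing of the
local atlas with components the extents of equality of elements of `P`; and the partial sections
`σ s` witnessing this glueing determine the rest of the structure of `G`: `σ s` followed by the
target map is the action of `s`, and `σ` preserves units and products. -/
def IsInternalisation (P : PsGrp C) (G : EtaleGroupoid C) : Prop :=
  ∃ (i : G.obj ≅ P.base) (φ : P.carrier → P.carrier → (P.base ⟶ P.base))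
    (σ : P.carrier →* G.Section),
    (∀ s t, P.IsExtentOfEquality s t (φ s t)) ∧
    IsGlueing G.src (fun s t => i.hom ≫ φ s t ≫ i.inv) (fun s => (σ s).hom) ∧
    ∀ s, (σ s).hom ≫ G.tgt = i.hom ≫ P.act s ≫ i.inv

end Internal

end EtaleCorr

/-! The functor of partial bisections is shown to be faithful, full and essentially surjective, and
any groupoid whose pseudogroup of partial bisections is isomorphic to `P` is shown to be an
internalisation of `P`. The pseudo-inverse can therefore be chosen abstractly.

One technique carries all of this. Let `p : A ⟶ X` be a local homeomorphism, the join of partial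
isomorphisms `q i` with partial inverses `σ i`. For every generalized element `a : Z ⟶ A`, the
idempotents `rst (a ≫ q i)` have join `rst a`, and on the `i`-th of them `a` lies in the image of `σ
i`, that is, `a ≫ p ≫ σ i = a`. Equations between maps out of `Z` can thus be checked, and maps out
of `Z` constructed, under the assumption that each arrow in play lies in a known partial section
(`IsSectionCover.ext`, `IsSectionCover.exists_glue`). An arrow lying in `σ i` is determined by its
base point (`Lies.ext`).

In an étale groupoid the inverses of the partial bisections already have join the source map
(`EtaleGroupoid.exists_isSectionCover`), since the target map is a local homeomorphism too. On an
arrow lying in a bisection `s`, a cofunctor acts by evaluating the image of `s`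
(`Cofunctor.act_of_lies`). This gives faithfulness, and for a morphism `φ` of pseudogroups it
dictates a local formula for a cofunctor. The formula glues because two bisections containing the
same arrow share a restriction containing it, and `φ` preserves the natural order
(`PsGrp.Hom.comp_sec_eq`).

For essential surjectivity, the extents of equality of elements of `P` form a local atlas. A glueing
has sections `σ s`, to be thought of as germs of elements of `P`. Target, product and inverse are
glued from the action of `s`, from `σ (t * s)` and from `σ s⁻¹`; the groupoid laws then reduce to
laws in the monoid. Finally `s ↦ σ s` is a bijection onto the partial bisections: injectivity comes
from the extents of equality, surjectivity from the existence of joins in `P`. Local glueings also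
supply the pullbacks of the source map that an internal category requires
(`IsSectionCover.pullsBack`). -/

set_option linter.unusedSectionVars false

namespace EtaleCorr

open RestrictionCategory InverseMonoid InternalCategory

/-! ### Covers by restriction idempotents, and local sections of local homeomorphisms -/

section Covers

variable {C : Type u} [Category.{v} C] [RestrictionCategory C]

/-- A family of restriction idempotents with join `e`. -/
structure IsCover {Z : C} {ι : Type*} (d : ι → (Z ⟶ Z)) (e : Z ⟶ Z) : Prop where
  idem : ∀ i, rst (d i) = d i
  join : IsJoin (Set.range d) e

lemma rst_comm_of_idem {Z : C} {d e : Z ⟶ Z} (hd : rst d = d) (he : rst e = e) :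
    d ≫ e = e ≫ d := by
  rw [← hd, ← he, rst_comm]

lemma comp_idem {W Z : C} (f : W ⟶ Z) {d : Z ⟶ Z} (hd : rst d = d) :
    f ≫ d = rst (f ≫ d) ≫ f := by
  conv_lhs => rw [← hd, comp_rst]

variable [JoinRestrictionCategory C]

namespace IsCover

variable {Z B : C} {ι κ : Type*} {d : ι → (Z ⟶ Z)} {e : Z ⟶ Z}

lemma rst_eq (h : IsCover d e) : rst e = e := by
  have h1 := h.join.join_rst
  rw [← Set.range_comp] at h1
  have h2 : (fun f : Z ⟶ Z => rst f) ∘ d = d := funext h.idem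
  rw [h2] at h1
  exact h1.unique h.join

lemma comp_eq (h : IsCover d e) (i : ι) : d i ≫ e = d i := by
  have h1 := h.join.1 (d i) ⟨i, rfl⟩
  rw [RLe, h.idem] at h1
  exact h1.symm

lemma eq_comp (h : IsCover d e) (i : ι) : e ≫ d i = d i := by
  rw [rst_comm_of_idem h.rst_eq (h.idem i), h.comp_eq]

lemma ext (h : IsCover d e) {f g : Z ⟶ B} (hfg : ∀ i, d i ≫ f = d i ≫ g) : e ≫ f = e ≫ g := by
  refine h.join.comp_eq ?_
  rintro _ ⟨i, rfl⟩
  exact hfg i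

/-- Agreement on overlaps says exactly what is needed for the maps `d i ≫ m i` to be pairwise
compatible, and `M` is their join. -/
lemma exists_glue (h : IsCover d e) (m : ι → (Z ⟶ B))
    (hm : ∀ i j, d i ≫ d j ≫ m i = d i ≫ d j ≫ m j) :
    ∃ M : Z ⟶ B, e ≫ M = M ∧ ∀ i, d i ≫ M = d i ≫ m i := by
  have key : ∀ i j, d i ≫ d j ≫ m j = d j ≫ d i ≫ m i := fun i j => by
    rw [← hm i j, ← Category.assoc, rst_comm_of_idem (h.idem i) (h.idem j), Category.assoc]
  have hdd : ∀ i, d i ≫ d i = d i := fun i => by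
    have := rst_idem (d i)
    rwa [h.idem] at this
  have key2 : ∀ i j, rst (d j ≫ m j) ≫ d i ≫ m i = d i ≫ d j ≫ m j := fun i j => by
    have h1 : rst (d j ≫ m j) ≫ d j = rst (d j ≫ m j) := by
      have := rst_comp_rst_comp (d j) (m j)
      rwa [h.idem] at this
    rw [← h1, Category.assoc, ← key, ← Category.assoc, ← h.idem i, rst_comm, Category.assoc,
      rst_comp_self]
  have hc : ∀ f ∈ Set.range (fun i => d i ≫ m i), ∀ g ∈ Set.range (fun i => d i ≫ m i),
      Compat f g := by
    rintro _ ⟨i, rfl⟩ _ ⟨j, rfl⟩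
    change rst (d j ≫ m j) ≫ d i ≫ m i = rst (d i ≫ m i) ≫ d j ≫ m j
    rw [key2, key2, key]
  obtain ⟨M, hM⟩ := JoinRestrictionCategory.exists_join _ hc
  refine ⟨M, ?_, fun i => ?_⟩
  · have h1 := JoinRestrictionCategory.join_precomp _ _ hc hM e
    rw [← Set.range_comp] at h1
    have h2 : (fun f : Z ⟶ B => e ≫ f) ∘ (fun i => d i ≫ m i) = fun i => d i ≫ m i :=
      funext fun i => by
        change e ≫ d i ≫ m i = d i ≫ m i
        rw [← Category.assoc, h.eq_comp]
    rw [h2] at h1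
    exact h1.unique hM
  -- By `key`, the families `d i ≫ d j ≫ m j` and `d j ≫ d i ≫ m i`, indexed by `j`, coincide. The
  -- first has join `d i ≫ M`, the second `e ≫ d i ≫ m i`.
  · have h1 := JoinRestrictionCategory.join_precomp _ _ hc hM (d i)
    have h2 := h.join.postcomp (d i ≫ m i)
    rw [← Set.range_comp] at h1 h2
    have h3 : (fun f : Z ⟶ B => d i ≫ f) ∘ (fun i => d i ≫ m i) =
        (fun f : Z ⟶ Z => f ≫ d i ≫ m i) ∘ d := funext fun j => key i j
    rw [h3] at h1
    rw [h1.unique h2, ← Category.assoc, h.eq_comp]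

/-- Common refinement of two covers. It allows two generalized elements to be localised at once. -/
lemma prod (h : IsCover d e) {d' : κ → (Z ⟶ Z)} (h' : IsCover d' e) :
    IsCover (fun i : ι × κ => d i.1 ≫ d' i.2) e := by
  have hd : ∀ i j, rst (d i ≫ d' j) = d i ≫ d' j := fun i j => by
    conv_lhs => rw [← h.idem, rst_rst_comp, h.idem, h'.idem]
  refine ⟨fun i => hd _ _, ?_, fun k hk => ?_⟩
  · rintro _ ⟨i, rfl⟩
    rw [RLe, hd, Category.assoc, h'.comp_eq]
  · have h1 : ∀ i j, d i ≫ d' j = (d i ≫ d' j) ≫ k := fun i j => by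
      have := hk _ ⟨(i, j), rfl⟩
      rwa [RLe, hd] at this
    have h2 : ∀ i, d i ≫ 𝟙 Z = d i ≫ k := fun i => by
      have h3 : e ≫ d i = e ≫ d i ≫ k := h'.ext fun j => by
        rw [← Category.assoc, rst_comm_of_idem (h'.idem j) (h.idem i), ← h1]
      rw [← Category.assoc, h.eq_comp] at h3
      rw [Category.comp_id, ← h3]
    have h4 := h.ext h2
    rw [RLe, h.rst_eq, ← h4, Category.comp_id]

lemma pullback (h : IsCover d e) {W : C} (f : W ⟶ Z) :
    IsCover (fun i => rst (f ≫ d i)) (rst (f ≫ e)) := by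
  refine ⟨fun i => rst_rst _, ?_⟩
  have h1 := (JoinRestrictionCategory.join_precomp _ _ h.join.compat h.join f).join_rst
  rwa [← Set.range_comp, ← Set.range_comp] at h1

end IsCover

lemma exists_isCover {Z : C} {ι : Type*} (d : ι → (Z ⟶ Z)) (hd : ∀ i, rst (d i) = d i) :
    ∃ e, IsCover d e := by
  obtain ⟨e, he⟩ := JoinRestrictionCategory.exists_join (Set.range d) (by
    rintro _ ⟨i, rfl⟩ _ ⟨j, rfl⟩
    rw [Compat, hd, hd, rst_comm_of_idem (hd j) (hd i)])
  exact ⟨e, hd, he⟩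

/-- Partial sections `σ i` of the total map `p`, with partial inverses `q i` whose join is `p`. -/
structure IsSectionCover {A X : C} {I : Type*} (p : A ⟶ X) (σ : I → (X ⟶ A)) (q : I → (A ⟶ X)) :
    Prop where
  total : IsTotal p
  inv : ∀ i, IsPartialInverse (q i) (σ i)
  join : IsJoin (Set.range q) p

/-- The generalized element `a` lies in the image of the partial section `s` of `p`. -/
def Lies {Z A X : C} (p : A ⟶ X) (s : X ⟶ A) (a : Z ⟶ A) : Prop := a ≫ p ≫ s = a

lemma Lies.precomp {W Z A X : C} {p : A ⟶ X} {s : X ⟶ A} {a : Z ⟶ A} (h : Lies p s a)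
    (k : W ⟶ Z) : Lies p s (k ≫ a) := by
  unfold Lies at *
  rw [Category.assoc, h]

lemma lies_comp {Z A X : C} {p : A ⟶ X} {s : X ⟶ A} (hs : s ≫ p = rst s) (x : Z ⟶ X) :
    Lies p s (x ≫ s) := by
  unfold Lies
  rw [Category.assoc, ← Category.assoc s, hs, rst_comp_self]

namespace IsSectionCover

variable {A X : C} {I : Type*} {p : A ⟶ X} {σ : I → (X ⟶ A)} {q : I → (A ⟶ X)}

lemma q_le (h : IsSectionCover p σ q) (i : I) : rst (q i) ≫ p = q i :=
  (h.join.1 _ ⟨i, rfl⟩).symm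

lemma rst_q (h : IsSectionCover p σ q) (i : I) : q i ≫ σ i = rst (q i) := (h.inv i).1

lemma σ_q (h : IsSectionCover p σ q) (i : I) : σ i ≫ q i = rst (σ i) := (h.inv i).2

lemma σ_rst_q (h : IsSectionCover p σ q) (i : I) : σ i ≫ rst (q i) = σ i := by
  rw [← h.rst_q, ← Category.assoc, h.σ_q, rst_comp_self]

lemma sec (h : IsSectionCover p σ q) (i : I) : σ i ≫ p = rst (σ i) := by
  rw [← h.σ_rst_q, Category.assoc, h.q_le, h.σ_q, h.σ_rst_q]

/-- As `q j` is a restriction of `p`, the composite is a restriction of `s ≫ p = rst s`. It is the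
domain on which `s` and `σ j` agree. -/
lemma sec_comp (h : IsSectionCover p σ q) {s : X ⟶ A} (hs : s ≫ p = rst s) (j : I) :
    rst (s ≫ q j) = s ≫ q j := by
  rw [← h.q_le j, ← Category.assoc, comp_rst, Category.assoc, hs, rst_rst_comp, rst_rst,
    rst_comp_rst_comp]

lemma idem (h : IsSectionCover p σ q) (i j : I) : rst (σ i ≫ q j) = σ i ≫ q j :=
  h.sec_comp (h.sec i) j

/-- The two sides are partial inverses of each other, and a restriction idempotent is its own
partial inverse. -/
lemma symm (h : IsSectionCover p σ q) (i j : I) : σ i ≫ q j = σ j ≫ q i := by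
  have h1 := (h.inv i).symm.comp (h.inv j)
  have h2 := IsPartialInverse.rst_self (σ i ≫ q j)
  rw [h.idem] at h2
  exact h2.unique h1

lemma comp_sec (h : IsSectionCover p σ q) {s : X ⟶ A} (hs : s ≫ p = rst s) (j : I) :
    (s ≫ q j) ≫ s = (s ≫ q j) ≫ σ j := by
  rw [Category.assoc _ _ (σ j), h.rst_q, comp_rst, h.sec_comp hs]

lemma comp_σ (h : IsSectionCover p σ q) (i j : I) : (σ i ≫ q j) ≫ σ i = (σ i ≫ q j) ≫ σ j :=
  h.comp_sec (h.sec i) j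

/-- Precomposing the join `p` of the `q i` with `a` and taking restrictions gives `rst (a ≫ p)`,
which is `rst a` because `p` is total. -/
lemma isCover (h : IsSectionCover p σ q) {Z : C} (a : Z ⟶ A) :
    IsCover (fun i => rst (a ≫ q i)) (rst a) := by
  have := h.total
  refine ⟨fun i => rst_rst _, ?_⟩
  have h1 := (JoinRestrictionCategory.join_precomp _ _ h.join.compat h.join a).join_rst
  rwa [← Set.range_comp, ← Set.range_comp, rst_comp_total] at h1

lemma lies (h : IsSectionCover p σ q) {Z : C} (a : Z ⟶ A) (i : I) :
    Lies p (σ i) (rst (a ≫ q i) ≫ a) := by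
  unfold Lies
  rw [← comp_rst, Category.assoc, ← Category.assoc (rst (q i)), h.q_le, h.rst_q]

lemma lies_q (h : IsSectionCover p σ q) {Z : C} {a : Z ⟶ A} {i : I} (ha : Lies p (σ i) a) :
    a ≫ q i = a ≫ p := by
  unfold Lies at ha
  rw [← ha]
  simp only [Category.assoc, h.sec, h.σ_q]

/-- An element in the image of two sections has its base point in their extent of agreement; this
drives every well-definedness argument below. -/
lemma lies_lies (h : IsSectionCover p σ q) {Z : C} {a : Z ⟶ A} {i j : I} (hi : Lies p (σ i) a)
    (hj : Lies p (σ j) a) : (a ≫ p) ≫ σ i ≫ q j = a ≫ p := by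
  have h1 := h.lies_q hj
  unfold Lies at hi
  calc (a ≫ p) ≫ σ i ≫ q j = (a ≫ p ≫ σ i) ≫ q j := by simp only [Category.assoc]
    _ = a ≫ p := by rw [hi, h1]

lemma ext (h : IsSectionCover p σ q) {Z B : C} (a : Z ⟶ A) {f g : Z ⟶ B}
    (hf : rst a ≫ f = f) (hg : rst a ≫ g = g)
    (hfg : ∀ i (k : Z ⟶ Z), Lies p (σ i) (k ≫ a) → k ≫ f = k ≫ g) : f = g := by
  rw [← hf, ← hg]
  exact (h.isCover a).ext fun i => hfg i _ (h.lies a i)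

/-- The inverse is `p` restricted to the image of `s`; the point is that this image is the domain of
a restriction idempotent. -/
lemma exists_inverse (h : IsSectionCover p σ q) {s : X ⟶ A} (hs : s ≫ p = rst s) :
    ∃ t : A ⟶ X, IsPartialInverse t s ∧ RLe t p := by
  have := h.total
  -- This `e` cuts out the image of `s`: at a point `a` of the image of `σ i` over `x`, the map `q i
  -- ≫ s ≫ q i` is defined when `s x` also lies in the image of `σ i`, and then `s x = σ i x = a`.
  obtain ⟨e, he⟩ := exists_isCover (fun i => rst (q i ≫ s ≫ q i)) fun i => rst_rst _
  have hse : s ≫ e = s := by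
    have h1 := he.pullback s
    have h2 : rst s ≫ s = rst s ≫ rst (s ≫ e) ≫ s := (h.isCover s).ext fun i => by
      have h3 := h1.comp_eq i
      have h4 : rst (s ≫ rst (q i ≫ s ≫ q i)) = rst (s ≫ q i) := by
        rw [rst_comp_rst, ← Category.assoc, ← h.sec_comp hs i, rst_idem]
      simp only [h4] at h3
      rw [← Category.assoc, h3]
    rw [rst_comp_self, ← comp_idem s he.rst_eq, ← Category.assoc, rst_comp_self] at h2
    exact h2.symm
  have hr : rst (e ≫ p) = e := by rw [rst_comp_total, he.rst_eq]
  refine ⟨e ≫ p, ⟨?_, ?_⟩, ?_⟩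
  · rw [hr, Category.assoc]
    conv_rhs => rw [← Category.comp_id e]
    refine he.ext fun i => ?_
    have h1 : rst (q i ≫ s ≫ q i) ≫ p = q i ≫ s ≫ q i := by
      rw [← rst_comp_rst_comp, Category.assoc, h.q_le, ← comp_rst, h.sec_comp hs]
    have h2 : (q i ≫ s ≫ q i) ≫ s = rst (q i ≫ s ≫ q i) := by
      rw [Category.assoc, h.comp_sec hs, ← h.sec_comp hs, ← Category.assoc, comp_rst,
        Category.assoc, h.rst_q, rst_rst_comp, rst_comp_rst_comp]
    rw [← Category.assoc, h1, h2, Category.comp_id]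
  · rw [← Category.assoc, hse, hs]
  · rw [RLe, hr]

lemma trans (h : IsSectionCover p σ q) (i j k : I) :
    RLe ((σ i ≫ q j) ≫ σ j ≫ q k) (σ i ≫ q k) := by
  have h1 : (σ i ≫ q j) ≫ σ j ≫ q k = σ i ≫ rst (q j) ≫ q k := by
    rw [← h.rst_q j]; simp only [Category.assoc]
  rw [h1]
  refine RLe.precomp ?_ _
  rw [RLe, rst_rst_comp, rst_comm, Category.assoc]
  rw [← Category.assoc, rst_comm, Category.assoc, rst_comp_self]

end IsSectionCover

lemma IsLocalHomeo.exists_isSectionCover {A X : C} {p : A ⟶ X} (h : IsLocalHomeo p) :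
    ∃ (I : Type v) (σ : I → (X ⟶ A)) (q : I → (A ⟶ X)), IsSectionCover p σ q := by
  obtain ⟨ht, S, hS, hj⟩ := h
  choose t ht' using hS
  exact ⟨S, fun i => t i.1 i.2, fun i => i.1, ht, fun i => ht' i.1 i.2, by
    rwa [Subtype.range_coe]⟩

lemma IsSectionCover.isLocalHomeo {A X : C} {I : Type*} {p : A ⟶ X} {σ : I → (X ⟶ A)}
    {q : I → (A ⟶ X)} (h : IsSectionCover p σ q) : IsLocalHomeo p := by
  refine ⟨h.total, Set.range q, ?_, h.join⟩
  rintro _ ⟨i, rfl⟩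
  exact ⟨σ i, h.inv i⟩

end Covers

/-! ### Pullbacks of local homeomorphisms from local glueings -/

section Pullbacks

variable {C : Type u} [Category.{v} C] [RestrictionCategory C]

lemma IsGlueing.exists_isSectionCover {A X : C} {I : Type v} {p : A ⟶ X}
    {φ : I → I → (X ⟶ X)} {s : I → (X ⟶ A)} (h : IsGlueing p φ s) :
    ∃ q : I → (A ⟶ X), IsSectionCover p s q ∧ ∀ i j, s i ≫ q j = φ i j := by
  obtain ⟨ht, q, hq, hj, hφ⟩ := h
  exact ⟨q, ⟨ht, hq, hj⟩, fun i j => (hφ i j).symm⟩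

variable [JoinRestrictionCategory C]

namespace IsSectionCover

variable {A X Y B : C} {I : Type v} {p : A ⟶ X} {σ : I → (X ⟶ A)} {q : I → (A ⟶ X)}

/-- The atlas obtained by pulling back the atlas of a section cover. -/
lemma isLocalAtlas_pullback (h : IsSectionCover p σ q) (f : Y ⟶ X) :
    IsLocalAtlas fun i j => rst (f ≫ σ i ≫ q j) where
  idem i j := ⟨_, _, rfl⟩
  symm i j := by rw [h.symm]
  trans i j k := by
    have h1 : rst (f ≫ σ i ≫ q j) ≫ rst (f ≫ σ j ≫ q k) =
        rst (f ≫ (σ i ≫ q j) ≫ σ j ≫ q k) := by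
      rw [← rst_rst_comp]
      conv_rhs => rw [← Category.assoc f, comp_idem f (h.idem i j)]
      simp only [Category.assoc]
    rw [h1]
    exact ((h.trans i j k).precomp f).rst_le

/-- A glueing of the pulled back atlas is a pullback. -/
lemma exists_isPullback (h : IsSectionCover p σ q) (f : Y ⟶ X) [hf : IsTotal f] {p' : B ⟶ Y}
    {τ : I → (Y ⟶ B)} {r : I → (B ⟶ Y)} (h' : IsSectionCover p' τ r)
    (hr : ∀ i j, τ i ≫ r j = rst (f ≫ σ i ≫ q j)) : ∃ g : B ⟶ A, IsPullback g p' p f := by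
  have := h.total
  have := h'.total
  have hcov := h'.isCover (𝟙 B)
  simp only [Category.id_comp, rst_id] at hcov
  have hfr : ∀ i j, (τ i ≫ r j) ≫ f = f ≫ σ i ≫ q j := fun i j => by
    rw [hr, ← comp_idem f (h.idem i j)]
  -- The comparison map sends `τ i y` to `σ i (f y)`. By `hr`, where `τ i` and `τ j` agree at `y`,
  -- so do `σ i` and `σ j` at `f y`.
  obtain ⟨g, -, hg⟩ := hcov.exists_glue (fun i => r i ≫ f ≫ σ i) fun i j => by
    have e1 : ∀ k l, rst (r k) ≫ rst (r l) ≫ r k = r k ≫ τ k ≫ r l := fun k l => by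
      rw [← Category.assoc, rst_comm, Category.assoc, rst_comp_self, ← Category.assoc,
        h'.rst_q]
      nth_rw 1 [← h'.q_le k]
      conv_rhs => rw [← h'.q_le l, ← Category.assoc, rst_comm, Category.assoc]
    have e2 : rst (r i) ≫ rst (r j) ≫ r i ≫ f ≫ σ i = r i ≫ (f ≫ σ i ≫ q j) ≫ σ i := by
      rw [← hfr i j]
      have := congrArg (fun k => k ≫ f ≫ σ i) (e1 i j)
      simpa only [Category.assoc] using this
    have e3 : rst (r i) ≫ rst (r j) ≫ r j ≫ f ≫ σ j = r i ≫ (f ≫ σ i ≫ q j) ≫ σ j := by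
      have e4 : rst (r i) ≫ rst (r j) ≫ r j = r i ≫ τ i ≫ r j := by
        rw [rst_comp_self, ← Category.assoc, h'.rst_q]
      have := congrArg (fun k => k ≫ f ≫ σ j) e4
      rw [← hfr i j]
      simpa only [Category.assoc] using this
    rw [e2, e3, Category.assoc f, Category.assoc f, h.comp_σ]
  replace hg : ∀ i, rst (r i) ≫ g = r i ≫ f ≫ σ i := fun i => by
    rw [hg, ← Category.assoc, rst_comp_self]
  have hgq : ∀ i, g ≫ q i = r i ≫ f := fun i => by
    have h1 : 𝟙 B ≫ g ≫ q i = 𝟙 B ≫ r i ≫ f := hcov.ext fun j => by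
      rw [← Category.assoc, hg, Category.assoc, Category.assoc, ← hfr j i, ← Category.assoc,
        ← Category.assoc (r j), h'.rst_q]
      simp only [Category.assoc]
    simpa using h1
  have w : g ≫ p = p' ≫ f := by
    have h1 : 𝟙 B ≫ g ≫ p = 𝟙 B ≫ p' ≫ f := hcov.ext fun j => by
      rw [← Category.assoc, hg, ← Category.assoc (rst _), h'.q_le, Category.assoc, Category.assoc, h.sec]
      have h2 : τ j ≫ r j ≫ f = f ≫ rst (σ j) := by
        rw [← h.σ_q, ← hfr, Category.assoc]
      rw [← h2, ← Category.assoc, h'.rst_q, ← Category.assoc, rst_comp_self]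
    simpa using h1
  have hτg : ∀ i, τ i ≫ g = rst (τ i) ≫ f ≫ σ i := fun i => by
    rw [← h'.σ_rst_q, Category.assoc, hg, ← Category.assoc, h'.σ_q, h'.σ_rst_q]
  -- The composite with `g` determines the pieces on which `u` lies in each `τ i`, and on such a
  -- piece `u` is recovered from `u ≫ p'`.
  have uniq : ∀ {Z : C} (u v : Z ⟶ B), u ≫ g = v ≫ g → u ≫ p' = v ≫ p' → u = v := by
    intro Z u v e1 e2
    have key : ∀ (u : Z ⟶ B) i, rst (u ≫ r i) ≫ u = rst (u ≫ r i) ≫ u ≫ p' ≫ τ i := fun u i => by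
      have := h'.lies u i
      unfold Lies at this
      rw [← this]
      simp only [Category.assoc]
    have h1 : ∀ (u : Z ⟶ B) i, rst (u ≫ r i) = rst ((u ≫ g) ≫ q i) := fun u i => by
      rw [Category.assoc, hgq, ← Category.assoc, rst_comp_total (u ≫ r i) f]
    have h3 : rst u = rst v := by rw [← rst_comp_total u p', e2, rst_comp_total]
    have h4 : rst u ≫ u = rst u ≫ v := (h'.isCover u).ext fun i => by
      have h5 : rst (u ≫ r i) = rst (v ≫ r i) := by rw [h1, h1, e1]
      rw [key u, h5, key v, ← Category.assoc u, e2, Category.assoc]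
    rw [rst_comp_self, h3, rst_comp_self] at h4
    exact h4
  -- Where `a` lies in `σ i`, the mediating map must be `b ≫ τ i`. By `key`, if `a` lies in both `σ
  -- i` and `σ j`, then `b` lands where `τ i` and `τ j` agree, so these formulas glue.
  have ex : ∀ {Z : C} (a : Z ⟶ A) (b : Z ⟶ Y), a ≫ p = b ≫ f →
      ∃ u : Z ⟶ B, u ≫ g = a ∧ u ≫ p' = b := by
    intro Z a b e
    have hab : rst a = rst b := rst_eq_of_comp_total e
    have key : ∀ (k : Z ⟶ Z) i j, Lies p (σ i) (k ≫ a) → Lies p (σ j) (k ≫ a) →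
        k ≫ b ≫ τ i ≫ r j = k ≫ b := by
      intro k i j hi hj
      have h1 := h.lies_lies hi hj
      rw [Category.assoc k, e] at h1
      rw [hr, ← Category.assoc, comp_rst]
      have h2 : rst ((k ≫ b) ≫ f ≫ σ i ≫ q j) = rst (k ≫ b) := by
        simp only [Category.assoc] at h1 ⊢
        rw [h1, ← Category.assoc, rst_comp_total]
      rw [h2, rst_comp_self]
    obtain ⟨u, hu, hu'⟩ := (h.isCover a).exists_glue (fun i => b ≫ τ i) fun i j => by
      have hi : Lies p (σ i) ((rst (a ≫ q i) ≫ rst (a ≫ q j)) ≫ a) := by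
        rw [rst_comm, Category.assoc]
        exact (h.lies a i).precomp _
      have hj : Lies p (σ j) ((rst (a ≫ q i) ≫ rst (a ≫ q j)) ≫ a) := by
        rw [Category.assoc]
        exact (h.lies a j).precomp _
      have h1 := key _ i j hi hj
      have h2 := congrArg (fun k => k ≫ τ i) h1
      have h3 := congrArg (fun k => k ≫ τ j) h1
      have h4 := h'.comp_σ i j
      simp only [Category.assoc] at h2 h3 h4
      rw [← h2, ← h3, h4]
    refine ⟨u, ?_, ?_⟩
    · have h1 : rst a ≫ u ≫ g = rst a ≫ a := (h.isCover a).ext fun i => by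
        have hi := h.lies a i
        have h2 := key _ i i hi hi
        rw [h'.σ_q] at h2
        have h3 := congrArg (fun k => k ≫ g) (hu' i)
        simp only [Category.assoc] at h3
        rw [h3, hτg]
        have h4 := congrArg (fun k => k ≫ f ≫ σ i) h2
        simp only [Category.assoc] at h4
        unfold Lies at hi
        rw [h4, ← Category.assoc b, ← e, ← hi]
        simp only [Category.assoc]
      rwa [rst_comp_self, ← Category.assoc, hu] at h1
    · have h1 : rst a ≫ u ≫ p' = rst a ≫ b := (h.isCover a).ext fun i => by
        have hi := h.lies a i
        have h2 := key _ i i hi hi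
        rw [h'.σ_q] at h2
        have h3 := congrArg (fun k => k ≫ p') (hu' i)
        simp only [Category.assoc] at h3
        rw [h3, h'.sec, h2]
      rwa [← Category.assoc, hu, hab, rst_comp_self] at h1
  refine ⟨g, ⟨⟨w⟩, ⟨PullbackCone.IsLimit.mk w (fun s => (ex s.fst s.snd s.condition).choose)
    (fun s => (ex s.fst s.snd s.condition).choose_spec.1)
    (fun s => (ex s.fst s.snd s.condition).choose_spec.2) fun s m h1 h2 => ?_⟩⟩⟩
  have h3 := (ex s.fst s.snd s.condition).choose_spec
  exact uniq _ _ (h1.trans h3.1.symm) (h2.trans h3.2.symm)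

lemma pullsBack (h : IsSectionCover p σ q) (hC : HasLocalGlueings C) : PullsBack p where
  hasPullback f hf := by
    obtain ⟨B, p', τ, hg⟩ := hC _ _ _ (h.isLocalAtlas_pullback f)
    obtain ⟨r, h', hr⟩ := hg.exists_isSectionCover
    obtain ⟨g, hg⟩ := h.exists_isPullback f h' hr
    exact hg.hasPullback

end IsSectionCover

end Pullbacks

/-! ### Bisections determine cofunctors: full faithfulness -/

section FullyFaithful

lemma InverseMonoid.map_inv {S T : Type*} [InverseMonoid S] [InverseMonoid T] (f : S →* T)
    (s : S) : f s⁻¹ = (f s)⁻¹ := by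
  refine inv_unique _ _ ?_ ?_
  · rw [← map_mul, ← map_mul, mul_inv_mul]
  · rw [← map_mul, ← map_mul, inv_mul_inv]

lemma InverseMonoid.NLe.map {S T : Type*} [InverseMonoid S] [InverseMonoid T] (f : S →* T)
    {s t : S} (h : NLe s t) : NLe (f s) (f t) := by
  unfold NLe at *
  rw [← map_inv, ← map_mul, ← map_mul, ← h]

variable {C : Type u} [Category.{v} C] [RestrictionCategory C]

/-- The two legs have the same restriction, so `rst g` and the identity become equal after
composition with either leg. -/
lemma isTotal_fst_of_isPullback {A X Y B : C} {p : A ⟶ X} {f : Y ⟶ X} {g : B ⟶ A} {p' : B ⟶ Y}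
    [IsTotal p] [IsTotal f] (h : IsPullback g p' p f) : IsTotal g := by
  constructor
  refine h.hom_ext ?_ ?_
  · rw [rst_comp_self, Category.id_comp]
  · rw [rst_eq_of_comp_total h.w, rst_comp_self, Category.id_comp]

instance isTotal_pullback_fst {A X Y : C} (p : A ⟶ X) (f : Y ⟶ X) [PullsBack p] [IsTotal p]
    [IsTotal f] : IsTotal (pullback.fst p f) :=
  isTotal_fst_of_isPullback (IsPullback.of_hasPullback p f)

instance isTotal_pullback_snd {A X Y : C} (p : A ⟶ X) (f : Y ⟶ X) [PullsBack p] [IsTotal p]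
    [IsTotal f] : IsTotal (pullback.snd p f) :=
  isTotal_fst_of_isPullback (IsPullback.of_hasPullback p f).flip

lemma precomp_lift {A X Y Z W : C} {p : A ⟶ X} {f : Y ⟶ X} [HasPullback p f] (k : W ⟶ Z)
    {a : Z ⟶ A} {b : Z ⟶ Y} (h : a ≫ p = b ≫ f) :
    k ≫ pullback.lift a b h = pullback.lift (k ≫ a) (k ≫ b) (by simp [h]) := by
  apply pullback.hom_ext <;> simp only [Category.assoc, pullback.lift_fst, pullback.lift_snd]

/-- Localises composition of arrows to multiplication of partial sections. -/
lemma InternalCategory.lies_cmp {A : InternalCategory C} {Z : C} {g f : Z ⟶ A.arr}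
    (h : g ≫ A.src = f ≫ A.tgt) {t s : A.Section} (hg : Lies A.src t.hom g)
    (hf : Lies A.src s.hom f) : Lies A.src (t * s).hom (A.cmp g f h) := by
  unfold Lies at *
  have e1 : f ≫ A.src ≫ s.hom ≫ A.tgt ≫ t.hom = g := by
    have := congrArg (fun k => k ≫ A.tgt ≫ t.hom) hf
    simp only [Category.assoc] at this
    rw [this, ← Category.assoc, ← h, Category.assoc, hg]
  have e2 : rst g = rst f := rst_eq_of_comp_total h
  rw [← Category.assoc, cmp_src, Section.mul_hom, precomp_cmp]
  refine cmp_congr (by rw [Category.assoc, e1]) ?_ _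
  rw [← Category.assoc (f ≫ A.src), comp_rst]
  simp only [Category.assoc]
  rw [e1, hf, e2, rst_comp_self]

/-- An arrow in the image of `s` is `s` evaluated at its source, here the point `F.obj b`; so the
action of `F` on it is the image section evaluated at `b`. -/
lemma Cofunctor.act_of_lies {A B : InternalCategory C} (F : Cofunctor A B) {Z : C}
    {f : Z ⟶ A.arr} {b : Z ⟶ B.obj} (h : f ≫ A.src = b ≫ F.obj) {s : A.Section}
    (hf : Lies A.src s.hom f) : F.act f b h = b ≫ (F.mapSection s).hom := by
  have e1 : b ≫ F.obj ≫ s.hom = f := by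
    rw [← Category.assoc, ← h, Category.assoc]
    exact hf
  have e2 : rst f = rst b := rst_eq_of_comp_total h
  rw [F.mapSection_hom, F.precomp_act]
  refine F.act_congr e1.symm ?_ _
  rw [comp_rst, e1, e2, rst_comp_self]

variable [JoinRestrictionCategory C]

namespace IsSectionCover

variable {A X : C} {I : Type*} {p : A ⟶ X} {σ : I → (X ⟶ A)} {q : I → (A ⟶ X)}

lemma ext' (h : IsSectionCover p σ q) {Z B : C} (a : Z ⟶ A) {f g : Z ⟶ B}
    (hf : rst f = rst a) (hg : rst g = rst a)
    (hfg : ∀ i (k : Z ⟶ Z), Lies p (σ i) (k ≫ a) → k ≫ f = k ≫ g) : f = g :=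
  h.ext a (by rw [← hf, rst_comp_self]) (by rw [← hg, rst_comp_self]) hfg

/-- Localises first along `b`, then along `a`; membership in `σ j` survives the second restriction.
Used for identities about composable pairs. -/
lemma ext₂ (h : IsSectionCover p σ q) {Z B : C} (a b : Z ⟶ A) {f g : Z ⟶ B}
    (hab : rst a = rst b) (hf : rst f = rst b) (hg : rst g = rst b)
    (hfg : ∀ i j (k : Z ⟶ Z), Lies p (σ i) (k ≫ a) → Lies p (σ j) (k ≫ b) → k ≫ f = k ≫ g) :
    f = g := by
  have key : ∀ {D D' : C} {x : Z ⟶ D} {y : Z ⟶ D'} (k : Z ⟶ Z), rst x = rst y →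
      rst (k ≫ x) = rst (k ≫ y) := fun {D D' x y} k hxy => by
    rw [← rst_comp_rst, hxy, rst_comp_rst]
  refine h.ext' b hf hg fun j k hk => ?_
  refine h.ext' (k ≫ a) (key k (hf.trans hab.symm)) (key k (hg.trans hab.symm)) fun i l hl => ?_
  simpa only [Category.assoc] using hfg i j (l ≫ k) (by simpa only [Category.assoc] using hl)
    (by simpa only [Category.assoc] using hk.precomp l)

lemma comp_rst_of_lies (h : IsSectionCover p σ q) {W Z : C} (f : Z ⟶ A) [IsTotal f] {k : W ⟶ Z}
    {i : I} (hk : Lies p (σ i) (k ≫ f)) : k ≫ rst (f ≫ q i) = k := by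
  have := h.total
  rw [comp_rst, ← Category.assoc, h.lies_q hk, rst_comp_total, rst_comp_total, rst_comp_self]

/-- Maps that agree on the overlaps of the pieces determined by `f` can be glued. -/
lemma exists_glue (h : IsSectionCover p σ q) {Z B : C} (f : Z ⟶ A) [hf : IsTotal f]
    (m : I → (Z ⟶ B)) (hm : ∀ i j (k : Z ⟶ Z), Lies p (σ i) (k ≫ f) → Lies p (σ j) (k ≫ f) →
      k ≫ m i = k ≫ m j) :
    ∃ M : Z ⟶ B, ∀ {W : C} (k : W ⟶ Z) i, Lies p (σ i) (k ≫ f) → k ≫ M = k ≫ m i := by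
  obtain ⟨M, -, hM⟩ := (h.isCover f).exists_glue m fun i j => by
    have h1 := hm i j (rst (f ≫ q i) ≫ rst (f ≫ q j)) (by
      rw [rst_comm, Category.assoc]
      exact (h.lies f i).precomp _) (by
      rw [Category.assoc]
      exact (h.lies f j).precomp _)
    simpa only [Category.assoc] using h1
  refine ⟨M, fun k i hk => ?_⟩
  rw [← h.comp_rst_of_lies f hk, Category.assoc, hM, Category.assoc]

end IsSectionCover

namespace EtaleGroupoid

/-- A local section `σ i` of the source need not be a bisection, but its restriction to the points
where the inverse arrow lies in some `σ j` is one: there the target map is `inv ≫ r j`, a partial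
isomorphism. Each arrow lies in some `σ i` and its inverse in some `σ j`, so these restrictions
already cover. -/
lemma exists_isSectionCover (G : EtaleGroupoid C) :
    ∃ q : G.Bisections → (G.arr ⟶ G.obj),
      IsSectionCover G.src (fun s : G.Bisections => s.1.hom) q := by
  obtain ⟨I, σ, r, h⟩ := G.etale.exists_isSectionCover
  choose q hq hle using fun s : G.Bisections => h.exists_inverse s.1.src
  refine ⟨q, G.total_src, hq, ?_, fun k hk => ?_⟩
  · rintro _ ⟨s, rfl⟩
    exact hle s
  have hk' : ∀ s, rst (q s) ≫ k = q s := fun s => (hk _ ⟨s, rfl⟩).symm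
  have hinv : IsPartialInverse G.inv G.inv := by
    simp [IsPartialInverse, G.inv_inv, IsTotal.rst_eq]
  -- As the source map is total, an upper bound `k` of the `q s` must equal it. This is checked on
  -- the common refinement of the covers by `r i` and by `inv ≫ r j`.
  suffices h1 : G.src = k by rw [h1]; exact RLe.refl k
  have hcov := (h.isCover (𝟙 G.arr)).prod
    (e := rst (𝟙 G.arr)) (by simpa [IsTotal.rst_eq] using h.isCover G.inv)
  have h2 := hcov.ext (f := G.src) (g := k) fun ⟨i, j⟩ => by
    simp only [Category.id_comp]
    have hb : (σ i ≫ rst (G.inv ≫ r j)) ≫ G.src = rst (σ i ≫ rst (G.inv ≫ r j)) := by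
      rw [comp_rst, Category.assoc, h.sec, rst_rst_comp]
    have hb' : IsPartialIso ((σ i ≫ rst (G.inv ≫ r j)) ≫ G.tgt) := by
      have e : G.inv ≫ r j = rst (G.inv ≫ r j) ≫ G.tgt := by
        conv_lhs => rw [← h.q_le, ← Category.assoc, comp_rst, Category.assoc, G.inv_src]
      rw [Category.assoc, ← e]
      exact ⟨_, (h.inv i).symm.comp (hinv.comp (h.inv j))⟩
    have h3 := hk' ⟨⟨_, hb⟩, hb'⟩
    have h4 := hq ⟨⟨_, hb⟩, hb'⟩
    have h5 := hle ⟨⟨_, hb⟩, hb'⟩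
    generalize q ⟨⟨_, hb⟩, hb'⟩ = t at h3 h4 h5
    simp only at h4
    set d := rst (r i) ≫ rst (G.inv ≫ r j) with hd
    -- On the piece `d` every arrow lies in the restricted bisection, whose partial inverse `t`
    -- therefore agrees there with the source map (`h8`), and so does `k`.
    have h6 : d ≫ G.src ≫ σ i ≫ rst (G.inv ≫ r j) = d := by
      have h7 : rst (r i) ≫ G.src ≫ σ i = rst (r i) := by
        rw [← Category.assoc, h.q_le, h.rst_q]
      rw [hd, rst_comm]
      simp only [Category.assoc]
      rw [← Category.assoc G.src, ← Category.assoc (rst (r i)), h7, rst_comm (r i),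
        ← Category.assoc, rst_idem]
    have h8 : d ≫ t = d ≫ G.src := by
      have h10 := h4.2.trans hb.symm
      have h11 := congrArg (fun k => d ≫ G.src ≫ k) h10
      have h12 : (d ≫ G.src ≫ σ i ≫ rst (G.inv ≫ r j)) ≫ t =
          (d ≫ G.src ≫ σ i ≫ rst (G.inv ≫ r j)) ≫ G.src := by
        simpa only [Category.assoc] using h11
      rwa [h6] at h12
    have h9 : d ≫ rst t = d := by
      rw [comp_rst, h8, rst_comp_total, rst_comp_self]
    have h10 : d ≫ G.src = d ≫ k := by
      rw [← h8, ← h3, ← Category.assoc, h9]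
    simpa only [hd] using h10
  simpa using h2

end EtaleGroupoid

/-- Bisections cover the arrows, and by `Cofunctor.act_of_lies` the value on an arrow lying in `s`
depends only on the image of `s`. -/
instance : (bisectionFunctor C).Faithful where
  map_injective {G H} F F' hFF := by
    obtain ⟨q, h⟩ := G.exists_isSectionCover
    have hobj : F.obj = F'.obj := congrArg PsGrp.Hom.base hFF
    have hsec : ∀ s : G.Bisections, F.mapSection s.1 = F'.mapSection s.1 := fun s =>
      congrArg Subtype.val (DFunLike.congr_fun (congrArg PsGrp.Hom.hom hFF) s)
    refine Cofunctor.ext_act hobj fun {Z} f b hF hG => ?_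
    have e : rst b = rst f := (rst_eq_of_comp_total hF).symm
    refine h.ext' f (by rw [Cofunctor.rst_act, e]) (by rw [Cofunctor.rst_act, e]) fun s k hk => ?_
    rw [Cofunctor.precomp_act, Cofunctor.precomp_act, Cofunctor.act_of_lies _ _ hk,
      Cofunctor.act_of_lies _ _ hk, hsec]

/-! ### The cofunctor induced by a morphism of pseudogroups -/

namespace PsGrp.Hom

variable {G H : EtaleGroupoid C} (φ : PsGrp.Hom G.toPsGrp H.toPsGrp)

/-- The underlying map of the objects of objects. -/
def baseMap : H.obj ⟶ G.obj := φ.base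

instance : IsTotal φ.baseMap := φ.total_base

/-- The partial section of the target groupoid assigned to a bisection. -/
noncomputable def sec (s : G.Bisections) : H.Section :=
  ((show G.Bisections →* H.Bisections from φ.hom) s).1

lemma sec_mul (t s : G.Bisections) : φ.sec (t * s) = φ.sec t * φ.sec s := by
  unfold sec
  rw [map_mul]
  rfl

lemma sec_one : φ.sec 1 = 1 := by
  unfold sec
  rw [map_one]
  rfl

lemma base_sec (s : G.Bisections) :
    φ.baseMap ≫ s.1.hom ≫ G.tgt = (φ.sec s).hom ≫ H.tgt ≫ φ.baseMap :=
  (φ.comm s).trans (Category.assoc _ _ _)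

/-- Compatibility of `φ` with the anchors compares two composites whose last maps are total, so it
also compares domains. -/
lemma rst_sec (s : G.Bisections) : rst (φ.sec s).hom = rst (φ.baseMap ≫ s.1.hom) := by
  have h := φ.base_sec s
  rw [← Category.assoc] at h
  rw [rst_eq_of_comp_total h]

lemma sec_le {s t : G.Bisections} (h : RLe s.1.hom t.1.hom) : RLe (φ.sec s).hom (φ.sec t).hom :=
  (EtaleGroupoid.nle_iff _ _).1
    (((EtaleGroupoid.nle_iff s t).2 h).map (show G.Bisections →* H.Bisections from φ.hom))

variable {Z : C} {f : Z ⟶ G.arr} {x : Z ⟶ H.obj}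

lemma rst_comp_sec (hx : f ≫ G.src = x ≫ φ.baseMap) {s : G.Bisections}
    (hs : Lies G.src s.1.hom f) : rst (x ≫ (φ.sec s).hom) = rst x := by
  rw [← rst_comp_rst, φ.rst_sec, rst_comp_rst, ← Category.assoc, ← hx, Category.assoc]
  unfold Lies at hs
  rw [hs, rst_eq_of_comp_total hx]

lemma comp_sec_src (hx : f ≫ G.src = x ≫ φ.baseMap) {s : G.Bisections}
    (hs : Lies G.src s.1.hom f) : (x ≫ (φ.sec s).hom) ≫ H.src = x := by
  rw [Category.assoc, (φ.sec s).src, comp_rst, φ.rst_comp_sec hx hs, rst_comp_self]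

lemma comp_sec_tgt (hx : f ≫ G.src = x ≫ φ.baseMap) {s : G.Bisections}
    (hs : Lies G.src s.1.hom f) : (x ≫ (φ.sec s).hom) ≫ H.tgt ≫ φ.baseMap = f ≫ G.tgt := by
  rw [Category.assoc, ← φ.base_sec, ← Category.assoc, ← hx]
  unfold Lies at hs
  conv_rhs => rw [← hs]
  simp only [Category.assoc]

/-- Let `w` be `s` restricted to its extent of agreement with `t`. It is a bisection below both and
still contains `f`. As `φ` is monotone, the images of `s` and `t` both extend that of `w`, which is
already defined at `x`. -/
lemma comp_sec_eq (hx : f ≫ G.src = x ≫ φ.baseMap) {s t : G.Bisections}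
    (hs : Lies G.src s.1.hom f) (ht : Lies G.src t.1.hom f) :
    x ≫ (φ.sec s).hom = x ≫ (φ.sec t).hom := by
  obtain ⟨q, h⟩ := G.exists_isSectionCover
  have hst := h.lies_lies hs ht
  have e := h.idem s t
  have e' := h.comp_σ s t
  beta_reduce at e e' hst
  have hw : ((s.1.hom ≫ q t) ≫ s.1.hom) ≫ G.src = rst ((s.1.hom ≫ q t) ≫ s.1.hom) := by
    rw [Category.assoc, s.1.src]
    conv_rhs => rw [← e, rst_rst_comp, e]
  have hw' : IsPartialIso (((s.1.hom ≫ q t) ≫ s.1.hom) ≫ G.tgt) := by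
    obtain ⟨k, hk⟩ := s.2
    rw [Category.assoc, ← e]
    exact ⟨_, (IsPartialInverse.rst_self _).comp hk⟩
  let w : G.Bisections := ⟨⟨_, hw⟩, hw'⟩
  have hfw : Lies G.src w.1.hom f := by
    unfold Lies at hs ⊢
    calc f ≫ G.src ≫ w.1.hom = ((f ≫ G.src) ≫ s.1.hom ≫ q t) ≫ s.1.hom := by
          simp only [Category.assoc, w]
      _ = f := by rw [hst, Category.assoc, hs]
  have hle : ∀ {y : G.obj ⟶ G.arr}, RLe ((s.1.hom ≫ q t) ≫ y) y := fun {y} => by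
    have := (rst_le_id (s.1.hom ≫ q t)).postcomp y
    rwa [e, Category.id_comp] at this
  have key : ∀ {r : G.Bisections}, RLe w.1.hom r.1.hom →
      x ≫ (φ.sec w).hom = x ≫ (φ.sec r).hom := fun {r} hr => by
    have h1 := (φ.sec_le hr).precomp x
    rw [RLe, φ.rst_comp_sec hx hfw, ← Category.assoc, rst_comp_self] at h1
    exact h1
  rw [← key (r := s) hle, ← key (r := t)]
  change RLe ((s.1.hom ≫ q t) ≫ s.1.hom) t.1.hom
  rw [e']
  exact hle

/-- The arrow map sends `(f, x)` to the image of `s` at `x`, for any bisection `s` in which `f`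
lies; `hact` records this, and each cofunctor axiom is verified from it locally. -/
lemma exists_cofunctor : ∃ F : Cofunctor G.toInternalCategory H.toInternalCategory,
    Cofunctor.toPsGrpHom F = φ := by
  obtain ⟨q, h⟩ := G.exists_isSectionCover
  obtain ⟨M, hM⟩ := h.exists_glue (pullback.fst G.src φ.baseMap)
    (fun s => pullback.snd G.src φ.baseMap ≫ (φ.sec s).hom) fun s t k hs ht => by
      have hx : (k ≫ pullback.fst G.src φ.baseMap) ≫ G.src =
          (k ≫ pullback.snd G.src φ.baseMap) ≫ φ.baseMap := by
        simp only [Category.assoc, pullback.condition]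
      simpa only [Category.assoc] using φ.comp_sec_eq hx hs ht
  have hact : ∀ {Z : C} (f : Z ⟶ G.arr) (x : Z ⟶ H.obj) (hx : f ≫ G.src = x ≫ φ.baseMap)
      (s : G.Bisections), Lies G.src s.1.hom f →
      pullback.lift f x hx ≫ M = x ≫ (φ.sec s).hom := fun f x hx s hs => by
    rw [hM _ s (by rwa [pullback.lift_fst]), pullback.lift_snd_assoc]
  have hsrc : M ≫ H.src = pullback.snd G.src φ.baseMap := by
    have := h.total
    refine h.ext (pullback.fst G.src φ.baseMap) ?_ ?_ fun s k hk => ?_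
    · rw [IsTotal.rst_eq, Category.id_comp]
    · rw [IsTotal.rst_eq, Category.id_comp]
    · have hx : (k ≫ pullback.fst G.src φ.baseMap) ≫ G.src =
          (k ≫ pullback.snd G.src φ.baseMap) ≫ φ.baseMap := by
        simp only [Category.assoc, pullback.condition]
      rw [← Category.assoc, hM k s hk, ← Category.assoc, φ.comp_sec_src hx hk]
  have htot : ∀ {Z : C} (u : Z ⟶ pullback G.src φ.baseMap),
      rst (u ≫ M) = rst (u ≫ pullback.snd G.src φ.baseMap) := fun u => by
    rw [← hsrc, ← Category.assoc, rst_comp_total (u ≫ M) H.src]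
  have : IsTotal M := ⟨by
    have h1 := htot (𝟙 _)
    rwa [Category.id_comp, Category.id_comp, IsTotal.rst_eq (f := pullback.snd _ _)] at h1⟩
  have htgt : M ≫ H.tgt ≫ φ.baseMap = pullback.fst G.src φ.baseMap ≫ G.tgt := by
    refine h.ext (pullback.fst G.src φ.baseMap) ?_ ?_ fun s k hk => ?_
    · rw [IsTotal.rst_eq, Category.id_comp]
    · rw [IsTotal.rst_eq, Category.id_comp]
    · have hx : (k ≫ pullback.fst G.src φ.baseMap) ≫ G.src =
          (k ≫ pullback.snd G.src φ.baseMap) ≫ φ.baseMap := by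
        simp only [Category.assoc, pullback.condition]
      rw [← Category.assoc, hM k s hk, ← Category.assoc k, φ.comp_sec_tgt hx hk, Category.assoc]
  refine ⟨{
    obj := φ.baseMap
    map := M
    map_src := hsrc
    map_tgt := htgt
    map_one := ?_
    map_comp := ?_ }, ?_⟩
  · rw [hact _ _ _ 1, φ.sec_one, Section.one_hom, Category.id_comp]
    -- Identity arrows lie in the unit bisection, which `φ` preserves.
    change Lies G.src G.one (φ.baseMap ≫ G.one)
    exact lies_comp (by rw [G.one_src, IsTotal.rst_eq]) _
  · intro Z g f b hg hf
    have hfg : rst g = rst f := rst_eq_of_comp_total hg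
    have hfb : rst b = rst f := (rst_eq_of_comp_total hf).symm
    refine h.ext₂ g f hfg ?_ ?_ fun t s k ht hs => ?_
    · rw [htot, pullback.lift_snd, hfb]
    · rw [rst_cmp, htot, pullback.lift_snd, hfb]
    · have hx : (k ≫ f) ≫ G.src = (k ≫ b) ≫ φ.baseMap := by simp only [Category.assoc, hf]
      have hgf : (k ≫ g) ≫ G.src = (k ≫ f) ≫ G.tgt := by simp only [Category.assoc, hg]
      have e1 : k ≫ pullback.lift f b hf ≫ M = (k ≫ b) ≫ (φ.sec s).hom := by
        rw [← Category.assoc, precomp_lift, hact _ _ _ s hs]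
      have e2 := φ.comp_sec_tgt hx hs
      have hy : (k ≫ g) ≫ G.src = ((k ≫ b) ≫ (φ.sec s).hom ≫ H.tgt) ≫ φ.baseMap := by
        rw [hgf, ← e2]; simp only [Category.assoc]
      have l1 : Lies H.src (φ.sec s).hom ((k ≫ b) ≫ (φ.sec s).hom) :=
        lies_comp (φ.sec s).src _
      have l2 : Lies H.src (φ.sec t).hom
          (((k ≫ b) ≫ (φ.sec s).hom ≫ H.tgt) ≫ (φ.sec t).hom) := lies_comp (φ.sec t).src _
      have c1 := φ.comp_sec_src hy ht
      -- With `g` in `t` and `f` in `s`, the composite of the images lies in `φ.sec t * φ.sec s` and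
      -- has source `k ≫ b`, so it is that product evaluated at `k ≫ b`. The composite `g` after `f`
      -- lies in `t * s`, and `φ.sec_mul` identifies the two values.
      have l3 := lies_cmp (A := H.toInternalCategory)
        (c1.trans (Category.assoc _ _ _).symm) l2 l1
      unfold Lies at l3
      rw [← Category.assoc, cmp_src, φ.comp_sec_src hx hs] at l3
      rw [← Category.assoc, precomp_lift]
      refine (hact _ _ _ (t * s) ?_).trans ?_
      · rw [precomp_cmp]
        exact lies_cmp hgf ht hs
      · rw [φ.sec_mul, l3, precomp_cmp]
        refine cmp_congr ?_ e1.symm _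
        rw [← Category.assoc k, precomp_lift]
        refine Eq.trans ?_ (hact _ _ ?_ t ht).symm
        · congr 1
          rw [← Category.assoc k, e1]
          simp only [Category.assoc]
        · rw [← Category.assoc k, e1, hy]
          simp only [Category.assoc]
  · refine PsGrp.Hom.ext (MonoidHom.ext fun (s : G.Bisections) =>
      Subtype.ext (Section.ext ?_)) rfl
    refine (hact _ _ _ s (lies_comp s.1.src _)).trans ?_
    change rst (φ.baseMap ≫ s.1.hom) ≫ (φ.sec s).hom = (φ.sec s).hom
    rw [← φ.rst_sec, rst_comp_self]

end PsGrp.Hom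

instance : (bisectionFunctor C).Full where
  map_surjective φ := PsGrp.Hom.exists_cofunctor φ

end FullyFaithful

/-! ### Inverse monoids and extents of equality -/

namespace InverseMonoid

variable {S : Type v} [InverseMonoid S]

lemma inv_inv_self (s : S) : s⁻¹⁻¹ = s :=
  (inv_unique _ _ (inv_mul_inv s) (mul_inv_mul s)).symm

lemma inv_of_idem {e : S} (he : IsIdempotentElem e) : e⁻¹ = e := by
  have : e * e * e = e := by rw [he.eq, he.eq]
  exact (inv_unique _ _ this this).symm

lemma idem_inv_mul (s : S) : IsIdempotentElem (s⁻¹ * s) := by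
  rw [IsIdempotentElem, ← mul_assoc, inv_mul_inv]

lemma idem_mul_inv (s : S) : IsIdempotentElem (s * s⁻¹) := by
  rw [IsIdempotentElem, ← mul_assoc, mul_inv_mul]

/-- The classical argument: `f * (e * f)⁻¹ * e` is again an inverse of `e * f`, hence equals `(e *
f)⁻¹`, and this form makes the inverse idempotent. Its own inverse `e * f` is then idempotent as
well. -/
lemma idem_mul {e f : S} (he : IsIdempotentElem e) (hf : IsIdempotentElem f) :
    IsIdempotentElem (e * f) := by
  have he' : ∀ x, e * (e * x) = e * x := fun x => by rw [← mul_assoc, he.eq]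
  have hf' : ∀ x, f * (f * x) = f * x := fun x => by rw [← mul_assoc, hf.eq]
  have h1 : e * f * (e * f)⁻¹ * (e * f) = e * f := mul_inv_mul _
  have h2 : (e * f)⁻¹ * (e * f) * (e * f)⁻¹ = (e * f)⁻¹ := inv_mul_inv _
  have h3 : f * (e * f)⁻¹ * e = (e * f)⁻¹ := by
    refine inv_unique _ _ ?_ ?_
    · simp only [mul_assoc, he', hf'] at h1 ⊢
      exact h1
    · have h4 := congrArg (fun x => f * x * e) h2
      simp only [mul_assoc, he', hf'] at h4 ⊢
      exact h4
  have h5 : IsIdempotentElem (e * f)⁻¹ := by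
    rw [IsIdempotentElem]
    conv_lhs => rw [← h3]
    have h4 := congrArg (fun x => f * x * e) h2
    simp only [mul_assoc] at h4 ⊢
    rw [h4, ← mul_assoc, h3]
  have h6 := inv_of_idem h5
  rw [inv_inv_self] at h6
  rw [h6]
  exact h5

/-- Both products are idempotent, so `f * e` is an inverse of `e * f`, which is its own inverse. -/
lemma idem_comm {e f : S} (he : IsIdempotentElem e) (hf : IsIdempotentElem f) :
    e * f = f * e := by
  have he' : ∀ x, e * (e * x) = e * x := fun x => by rw [← mul_assoc, he.eq]
  have hf' : ∀ x, f * (f * x) = f * x := fun x => by rw [← mul_assoc, hf.eq]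
  have h1 : e * f * (e * f) = e * f := idem_mul he hf
  have h2 : f * e * (f * e) = f * e := idem_mul hf he
  have h3 : f * e = (e * f)⁻¹ := by
    refine inv_unique _ _ ?_ ?_
    · simp only [mul_assoc, he', hf'] at h1 ⊢
      exact h1
    · simp only [mul_assoc, he', hf'] at h2 ⊢
      exact h2
  rw [h3, inv_of_idem (idem_mul he hf)]

lemma inv_mul_rev (s t : S) : (s * t)⁻¹ = t⁻¹ * s⁻¹ := by
  have h1 := idem_comm (idem_inv_mul s) (idem_mul_inv t)
  refine (inv_unique _ _ ?_ ?_).symm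
  · calc s * t * (t⁻¹ * s⁻¹) * (s * t) = s * (t * t⁻¹ * (s⁻¹ * s)) * t := by
          simp only [mul_assoc]
      _ = (s * s⁻¹ * s) * (t * t⁻¹ * t) := by rw [← h1]; simp only [mul_assoc]
      _ = s * t := by rw [mul_inv_mul, mul_inv_mul]
  · calc t⁻¹ * s⁻¹ * (s * t) * (t⁻¹ * s⁻¹) = t⁻¹ * (s⁻¹ * s * (t * t⁻¹)) * s⁻¹ := by
          simp only [mul_assoc]
      _ = (t⁻¹ * t * t⁻¹) * (s⁻¹ * s * s⁻¹) := by rw [h1]; simp only [mul_assoc]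
      _ = t⁻¹ * s⁻¹ := by rw [inv_mul_inv, inv_mul_inv]

/-- Conjugates of idempotents are idempotent, and conjugation moves idempotents past `s`. -/
lemma mul_conj (s : S) {l : S} (hl : IsIdempotentElem l) : s * (s⁻¹ * l * s) = l * s := by
  calc s * (s⁻¹ * l * s) = s * s⁻¹ * l * s := by simp only [mul_assoc]
    _ = l * s := by rw [idem_comm (idem_mul_inv s) hl, mul_assoc, mul_inv_mul]

lemma idem_conj (s : S) {l : S} (hl : IsIdempotentElem l) : IsIdempotentElem (s⁻¹ * l * s) := by
  calc s⁻¹ * l * s * (s⁻¹ * l * s) = s⁻¹ * l * (s * (s⁻¹ * l * s)) := by simp only [mul_assoc]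
    _ = s⁻¹ * (l * l) * s := by rw [mul_conj s hl]; simp only [mul_assoc]
    _ = s⁻¹ * l * s := by rw [hl.eq]

lemma inv_mul_of_idem (s : S) {e : S} (he : IsIdempotentElem e) :
    (s * e)⁻¹ * (s * e) = s⁻¹ * s * e := by
  rw [inv_mul_rev, inv_of_idem he]
  calc e * s⁻¹ * (s * e) = e * (s⁻¹ * s) * e := by simp only [mul_assoc]
    _ = s⁻¹ * s * e := by rw [idem_comm he (idem_inv_mul s), mul_assoc, he.eq]

lemma NLe.inv {s t : S} (h : NLe s t) : NLe s⁻¹ t⁻¹ := by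
  have h1 : s⁻¹ = s⁻¹ * s * t⁻¹ := by
    have h2 := congrArg (·⁻¹) h
    simp only [inv_mul_rev t, inv_of_idem (idem_inv_mul s)] at h2
    exact h2
  have h3 : s * s⁻¹ = t * (s⁻¹ * s) * t⁻¹ := by
    conv_lhs => rw [h1, ← mul_assoc, ← mul_assoc, mul_inv_mul]
    rw [← h]
  rw [NLe, inv_inv_self, h3]
  calc s⁻¹ = s⁻¹ * s * (t⁻¹ * t * t⁻¹) := by rw [inv_mul_inv, ← h1]
    _ = (s⁻¹ * s) * (t⁻¹ * t) * t⁻¹ := by simp only [mul_assoc]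
    _ = t⁻¹ * (t * (s⁻¹ * s) * t⁻¹) := by
      rw [idem_comm (idem_inv_mul s) (idem_inv_mul t)]; simp only [mul_assoc]

lemma NLe.ncompat {s t k : S} (h : NLe s k) (h' : NLe t k) : NCompat s t := by
  unfold NLe at h h'
  unfold NCompat
  conv_lhs => rw [h]
  conv_rhs => rw [h']
  rw [mul_assoc k, mul_assoc k, idem_comm (idem_inv_mul s) (idem_inv_mul t)]

lemma NLe.biCompat {s t k : S} (h : NLe s k) (h' : NLe t k) : BiCompat s t :=
  ⟨h.ncompat h', h.inv.ncompat h'.inv⟩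

lemma NLe.antisymm {s t : S} (h : NLe s t) (h' : NLe t s) : s = t := by
  unfold NLe at h h'
  calc s = t * (s⁻¹ * s) := h
    _ = s * (t⁻¹ * t) * (s⁻¹ * s) := by rw [← h']
    _ = s * s⁻¹ * s * (t⁻¹ * t) := by
      rw [mul_assoc, idem_comm (idem_inv_mul t) (idem_inv_mul s)]; simp only [mul_assoc]
    _ = t := by rw [mul_inv_mul, ← h']

lemma IsNJoin.unique {F : Set S} {j j' : S} (h : IsNJoin F j) (h' : IsNJoin F j') : j = j' :=
  (h.2 _ h'.1).antisymm (h'.2 _ h.1)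

lemma nle_iff_of_idem {e x : S} (he : IsIdempotentElem e) : NLe e x ↔ x * e = e := by
  rw [NLe, inv_of_idem he, he.eq, eq_comm]

lemma NCompat.of_map {T : Type*} [InverseMonoid T] {f : S →* T} (hf : Function.Injective f)
    {s t : S} (h : NCompat (f s) (f t)) : NCompat s t := by
  refine hf ?_
  rw [map_mul, map_mul, map_mul, map_mul, map_inv, map_inv]
  exact h

/-- Makes it possible to form in `S` the join of a family whose bicompatibility is visible only
after applying `f`. -/
lemma BiCompat.of_map {T : Type*} [InverseMonoid T] {f : S →* T} (hf : Function.Injective f)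
    {s t : S} (h : BiCompat (f s) (f t)) : BiCompat s t :=
  ⟨h.1.of_map hf, NCompat.of_map hf (by rw [map_inv, map_inv]; exact h.2)⟩

/-- `j` is the largest idempotent on which `s` and `t` are defined and agree. -/
structure IsEqIdem (s t j : S) : Prop where
  idem : IsIdempotentElem j
  left : s⁻¹ * s * j = j
  right : t⁻¹ * t * j = j
  eq : s * j = t * j
  max : ∀ e : S, IsIdempotentElem e → s⁻¹ * s * e = e → t⁻¹ * t * e = e → s * e = t * e →
    j * e = e

namespace IsEqIdem

lemma symm {s t j : S} (h : IsEqIdem s t j) : IsEqIdem t s j :=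
  ⟨h.idem, h.right, h.left, h.eq.symm, fun e he h1 h2 h3 => h.max e he h2 h1 h3.symm⟩

lemma unique {s t j j' : S} (h : IsEqIdem s t j) (h' : IsEqIdem s t j') : j = j' := by
  have h1 := h.max j' h'.idem h'.left h'.right h'.eq
  have h2 := h'.max j h.idem h.left h.right h.eq
  rw [← h2, idem_comm h'.idem h.idem, h1]

lemma restrict (s : S) {e : S} (he : IsIdempotentElem e) :
    IsEqIdem s (s * e) (s⁻¹ * s * e) := by
  have h1 := inv_mul_of_idem s he
  have h2 := idem_mul (idem_inv_mul s) he
  refine ⟨h2, ?_, ?_, ?_, fun f _ _ h3 _ => ?_⟩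
  · rw [← mul_assoc, (idem_inv_mul s).eq]
  · rw [h1, h2.eq]
  · rw [mul_assoc s e, idem_comm he h2, mul_assoc _ e e, he.eq]
  · rwa [h1] at h3

lemma refl (s : S) : IsEqIdem s s (s⁻¹ * s) :=
  ⟨idem_inv_mul s, (idem_inv_mul s).eq, (idem_inv_mul s).eq, rfl, fun _ _ h _ _ => h⟩

end IsEqIdem

/-- The join of all idempotents on which `s` and `t` are defined and agree is again one of them, so
the extent of equality is attained inside `S`. -/
lemma exists_isEqIdem {S : Type v} [JoinInverseMonoid S] (s t : S) : ∃ j, IsEqIdem s t j := by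
  let E : Set S := {e | IsIdempotentElem e ∧ s⁻¹ * s * e = e ∧ t⁻¹ * t * e = e ∧ s * e = t * e}
  have hE : ∀ e ∈ E, ∀ f ∈ E, BiCompat e f := by
    intro e he f hf
    have h1 : NCompat e f := by
      rw [NCompat, inv_of_idem he.1, inv_of_idem hf.1, he.1.eq, hf.1.eq, idem_comm he.1 hf.1]
    exact ⟨h1, by rwa [inv_of_idem he.1, inv_of_idem hf.1]⟩
  obtain ⟨j, hj⟩ := JoinInverseMonoid.exists_join E hE
  have hle : ∀ x : S, (∀ e ∈ E, x * e = e) → NLe j x := fun x hx =>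
    hj.2 x fun e he => (nle_iff_of_idem he.1).2 (hx e he)
  have h1 := hle (s⁻¹ * s) fun e he => he.2.1
  have h2 := hle (t⁻¹ * t) fun e he => he.2.2.1
  have hid : IsIdempotentElem j := by
    rw [h1]
    exact idem_mul (idem_inv_mul s) (idem_inv_mul j)
  refine ⟨j, hid, (nle_iff_of_idem hid).1 h1, (nle_iff_of_idem hid).1 h2, ?_,
    fun e he h3 h4 h5 => (nle_iff_of_idem he).1 (hj.1 e ⟨he, h3, h4, h5⟩)⟩
  -- Joins are only assumed to be preserved by right multiplication, so `s * j = t * j` is proved in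
  -- the inverted form `j * s⁻¹ = j * t⁻¹`.
  have h3 := JoinInverseMonoid.join_mul E j hE hj s⁻¹
  have h4 := JoinInverseMonoid.join_mul E j hE hj t⁻¹
  have h5 : ∀ e ∈ E, e * s⁻¹ = e * t⁻¹ := fun e he => by
    have := congrArg (·⁻¹) he.2.2.2
    simpa only [inv_mul_rev, inv_of_idem he.1] using this
  rw [Set.image_congr h5] at h3
  have h6 := congrArg (·⁻¹) (h3.unique h4)
  simpa only [inv_mul_rev, inv_of_idem hid, inv_inv_self] using h6

end InverseMonoid

/-! ### The local atlas of a complete pseudogroup -/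

section PseudoGroup

variable {C : Type u} [Category.{v} C] [RestrictionCategory C]

namespace PsGrp

variable (P : PsGrp C)

lemma act_mul (t s : P.carrier) : P.act (t * s) = P.act s ≫ P.act t := by
  unfold act
  rw [map_mul]
  rfl

lemma act_one : P.act 1 = 𝟙 P.base := by
  unfold act
  rw [map_one]
  rfl

lemma act_idem {e : P.carrier} (he : IsIdempotentElem e) : rst (P.act e) = P.act e := by
  refine (EtaleGroupoid.idem_eq_rst (P.θ e).2 ?_).symm
  exact (P.act_mul e e).symm.trans (by rw [he.eq]; rfl)

lemma rst_act (s : P.carrier) : rst (P.act s) = P.act (s⁻¹ * s) := by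
  have h1 := P.act_idem (idem_inv_mul s)
  have h2 : P.act (s⁻¹ * s) ≫ P.act s = P.act s := by
    rw [← P.act_mul, ← mul_assoc, mul_inv_mul]
  have h3 : rst (P.act (s⁻¹ * s)) ≫ rst (P.act s) = rst (P.act s) := by
    rw [← rst_rst_comp, h1, h2]
  have h4 : rst (P.act (s⁻¹ * s)) ≫ rst (P.act s) = rst (P.act (s⁻¹ * s)) := by
    rw [P.act_mul, rst_comp_rst_comp]
  rw [← h3, h4, h1]

lemma act_injOn {e f : P.carrier} (he : IsIdempotentElem e) (hf : IsIdempotentElem f)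
    (h : P.act e = P.act f) : e = f :=
  P.bijOn_idem.injOn he hf (Subtype.ext h)

lemma exists_act {d : P.base ⟶ P.base} (hd : rst d = d) :
    ∃ e : P.carrier, IsIdempotentElem e ∧ P.act e = d := by
  have hd' : IsPartialIso d := ⟨d, by rw [← hd]; exact IsPartialInverse.rst_self d⟩
  have h1 : d ≫ d = d := by rw [← hd, rst_idem]
  obtain ⟨e, he, h⟩ := P.bijOn_idem.surjOn
    (show (⟨End.of d, hd'⟩ : PartialAut P.base) ∈ {e | IsIdempotentElem e} from Subtype.ext h1)
  exact ⟨e, he, congrArg Subtype.val h⟩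

/-- The join in `C` is a maximum, attained at `j`; hence `θ` need not be known to preserve joins. -/
lemma isExtentOfEquality {s t j : P.carrier} (h : IsEqIdem s t j) :
    P.IsExtentOfEquality s t (P.act j) := by
  refine ⟨?_, fun k hk => hk _ ⟨j, h.idem, ?_, h.eq, rfl⟩⟩
  · rintro _ ⟨e, he, hle, heq, rfl⟩
    rw [nle_iff_of_idem he] at hle
    have h1 : s⁻¹ * s * e = e := by
      conv_lhs => rw [← hle, ← mul_assoc, ← mul_assoc, (idem_inv_mul s).eq]
      exact hle
    have h2 : t⁻¹ * t * e = e := by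
      conv_lhs => rw [← hle, idem_comm (idem_inv_mul s) (idem_inv_mul t), ← mul_assoc,
        ← mul_assoc, (idem_inv_mul t).eq, ← idem_comm (idem_inv_mul s) (idem_inv_mul t)]
      exact hle
    have h3 := h.max e he h1 h2 heq
    rw [RLe, P.act_idem he, ← P.act_mul, h3]
  · rw [nle_iff_of_idem h.idem, mul_assoc, h.right, h.left]

/-- Transitivity holds because `r`, `s` and `t` all agree on `j s t * j r s`, which is therefore
below the maximal `j r t`. -/
lemma isLocalAtlas {j : P.carrier → P.carrier → P.carrier} (hj : ∀ s t, IsEqIdem s t (j s t)) :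
    IsLocalAtlas fun s t => P.act (j s t) where
  idem s t := ⟨_, _, (P.act_idem (hj s t).idem).symm⟩
  symm s t := by rw [(hj s t).unique (hj t s).symm]
  trans r s t := by
    have h1 := hj r s
    have h2 := hj s t
    have hc := idem_comm h1.idem h2.idem
    have h3 : j r t * (j s t * j r s) = j s t * j r s := by
      refine (hj r t).max _ (idem_mul h2.idem h1.idem) ?_ ?_ ?_
      · rw [← hc, ← mul_assoc, h1.left]
      · rw [← mul_assoc, h2.right]
      · rw [← hc, ← mul_assoc, h1.eq, mul_assoc, hc, ← mul_assoc, h2.eq, mul_assoc]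
    rw [← P.act_mul, RLe, P.act_idem (idem_mul h2.idem h1.idem), ← P.act_mul, h3]

/-- A section cover indexed by the elements of a pseudogroup, which glues the local atlas of
extents of equality. -/
structure IsGluedBy {A : C} (p : A ⟶ P.base) (σ : P.carrier → (P.base ⟶ A))
    (q : P.carrier → (A ⟶ P.base)) : Prop extends IsSectionCover p σ q where
  extent : ∀ s t j, IsEqIdem s t j → σ s ≫ q t = P.act j

variable [JoinRestrictionCategory C]

lemma exists_isGluedBy (hC : HasLocalGlueings C) :
    ∃ (A : C) (p : A ⟶ P.base) (σ : P.carrier → (P.base ⟶ A)) (q : P.carrier → (A ⟶ P.base)),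
      P.IsGluedBy p σ q := by
  choose j hj using fun s t : P.carrier => exists_isEqIdem s t
  obtain ⟨A, p, σ, h⟩ := hC _ _ _ (P.isLocalAtlas hj)
  obtain ⟨q, h, hq⟩ := h.exists_isSectionCover
  exact ⟨A, p, σ, q, h, fun s t i hi => by rw [hq, (hj s t).unique hi]⟩

variable {P}

namespace IsGluedBy

variable {A : C} {p : A ⟶ P.base} {σ : P.carrier → (P.base ⟶ A)} {q : P.carrier → (A ⟶ P.base)}

lemma rst_σ (h : P.IsGluedBy p σ q) (s : P.carrier) : rst (σ s) = rst (P.act s) := by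
  rw [P.rst_act, ← h.σ_q, h.extent _ _ _ (IsEqIdem.refl s)]

/-- The extent of equality of `s` and `s * e` is the whole domain of `s * e`, so `σ (s * e)` is a
restriction of `σ s`. -/
lemma act_comp_σ (h : P.IsGluedBy p σ q) {e : P.carrier} (he : IsIdempotentElem e)
    (s : P.carrier) : P.act e ≫ σ s = σ (s * e) := by
  have h1 := h.extent _ _ _ (IsEqIdem.restrict s he)
  have h2 := h.comp_σ s (s * e)
  have h3 : rst (σ (s * e)) = P.act (s⁻¹ * s * e) := by
    rw [h.rst_σ, P.rst_act, inv_mul_of_idem s he]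
  rw [h1, ← h3, rst_comp_self, h3, P.act_mul, ← P.rst_act, Category.assoc, ← h.rst_σ,
    rst_comp_self] at h2
  exact h2

end IsGluedBy

end PsGrp

end PseudoGroup

/-! ### Target, multiplication and inversion glued from a pseudogroup -/

section Internalise

variable {C : Type u} [Category.{v} C] [RestrictionCategory C]

lemma Lies.ext {Z A X : C} {p : A ⟶ X} {s : X ⟶ A} {a b : Z ⟶ A} (ha : Lies p s a)
    (hb : Lies p s b) (h : a ≫ p = b ≫ p) : a = b := by
  unfold Lies at ha hb
  rw [← ha, ← hb, ← Category.assoc, h, Category.assoc]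

lemma rst_precomp_congr {W Z D D' : C} {x : Z ⟶ D} {y : Z ⟶ D'} (k : W ⟶ Z)
    (h : rst x = rst y) : rst (k ≫ x) = rst (k ≫ y) := by
  rw [← rst_comp_rst, h, rst_comp_rst]

variable [JoinRestrictionCategory C]

namespace IsSectionCover

variable {A X : C} {I : Type*} {p : A ⟶ X} {σ : I → (X ⟶ A)} {q : I → (A ⟶ X)}

lemma ext₃ (h : IsSectionCover p σ q) {Z B : C} (a b c : Z ⟶ A) {f g : Z ⟶ B}
    (hac : rst a = rst c) (hbc : rst b = rst c) (hf : rst f = rst c) (hg : rst g = rst c)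
    (hfg : ∀ i j l (k : Z ⟶ Z), Lies p (σ i) (k ≫ a) → Lies p (σ j) (k ≫ b) →
      Lies p (σ l) (k ≫ c) → k ≫ f = k ≫ g) : f = g := by
  refine h.ext₂ b c hbc hf hg fun j l k hj hl => ?_
  refine h.ext' (k ≫ a) (rst_precomp_congr k (hf.trans hac.symm))
    (rst_precomp_congr k (hg.trans hac.symm)) fun i m hm => ?_
  simpa only [Category.assoc] using hfg i j l (m ≫ k)
    (by simpa only [Category.assoc] using hm)
    (by simpa only [Category.assoc] using hj.precomp m)
    (by simpa only [Category.assoc] using hl.precomp m)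

lemma exists_glue₂ (h : IsSectionCover p σ q) {Z B : C} (f g : Z ⟶ A) [hf : IsTotal f]
    [hg : IsTotal g] (m : I → I → (Z ⟶ B))
    (hm : ∀ i j i' j' (k : Z ⟶ Z), Lies p (σ i) (k ≫ f) → Lies p (σ i') (k ≫ f) →
      Lies p (σ j) (k ≫ g) → Lies p (σ j') (k ≫ g) → k ≫ m i j = k ≫ m i' j') :
    ∃ M : Z ⟶ B, ∀ {W : C} (k : W ⟶ Z) i j, Lies p (σ i) (k ≫ f) → Lies p (σ j) (k ≫ g) →
      k ≫ M = k ≫ m i j := by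
  have hl : ∀ i j, Lies p (σ i) ((rst (f ≫ q i) ≫ rst (g ≫ q j)) ≫ f) := fun i j => by
    rw [rst_comm, Category.assoc]
    exact (h.lies f i).precomp _
  have hr : ∀ i j, Lies p (σ j) ((rst (f ≫ q i) ≫ rst (g ≫ q j)) ≫ g) := fun i j => by
    rw [Category.assoc]
    exact (h.lies g j).precomp _
  have hcov := (h.isCover f).prod (d' := fun i => rst (g ≫ q i)) (by
    rw [hf.rst_eq, ← hg.rst_eq]; exact h.isCover g)
  obtain ⟨M, -, hM⟩ := hcov.exists_glue (fun i => m i.1 i.2) fun ⟨i, j⟩ ⟨i', j'⟩ => by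
    have e := rst_comm_of_idem (hcov.idem (i, j)) (hcov.idem (i', j'))
    have h1 := hm i j i' j' ((rst (f ≫ q i) ≫ rst (g ≫ q j)) ≫ rst (f ≫ q i') ≫ rst (g ≫ q j'))
      (by rw [e, Category.assoc]; exact (hl i j).precomp _)
      (by rw [Category.assoc]; exact (hl i' j').precomp _)
      (by rw [e, Category.assoc]; exact (hr i j).precomp _)
      (by rw [Category.assoc]; exact (hr i' j').precomp _)
    simpa only [Category.assoc] using h1
  refine ⟨M, fun k i j hi hj => ?_⟩
  have h1 : k ≫ rst (f ≫ q i) ≫ rst (g ≫ q j) = k := by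
    rw [← Category.assoc, h.comp_rst_of_lies f hi, h.comp_rst_of_lies g hj]
  have h2 := congrArg (fun x => k ≫ x) (hM (i, j))
  simp only at h2
  rwa [← Category.assoc, h1, ← Category.assoc, h1] at h2

end IsSectionCover

namespace PsGrp.IsGluedBy

variable {P : PsGrp C} {A : C} {p : A ⟶ P.base} {σ : P.carrier → (P.base ⟶ A)}
  {q : P.carrier → (A ⟶ P.base)} {Z : C}

/-- The germ principle: if `f` lies in two sections, the two elements agree on an idempotent that
acts as the identity at the source of `f`. -/
lemma exists_idem (h : P.IsGluedBy p σ q) {f : Z ⟶ A} {s t : P.carrier} (hs : Lies p (σ s) f)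
    (ht : Lies p (σ t) f) :
    ∃ j : P.carrier, IsIdempotentElem j ∧ s * j = t * j ∧ f ≫ p ≫ P.act j = f ≫ p := by
  obtain ⟨j, hj⟩ := exists_isEqIdem s t
  have h1 := h.lies_lies hs ht
  rw [h.extent s t j hj, Category.assoc] at h1
  exact ⟨j, hj.idem, hj.eq, h1⟩

lemma rst_comp_act (h : P.IsGluedBy p σ q) {f : Z ⟶ A} {s : P.carrier} (hs : Lies p (σ s) f) :
    rst (f ≫ p ≫ P.act s) = rst f := by
  unfold Lies at hs
  rw [← Category.assoc, ← rst_comp_rst, ← h.rst_σ, rst_comp_rst, Category.assoc, hs]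

lemma comp_act_inv (h : P.IsGluedBy p σ q) {f : Z ⟶ A} {s : P.carrier} (hs : Lies p (σ s) f) :
    f ≫ p ≫ P.act (s⁻¹ * s) = f ≫ p := by
  have := h.total
  rw [← P.rst_act, ← Category.assoc, comp_rst, Category.assoc, h.rst_comp_act hs,
    ← Category.assoc, rst_comp_self]

/-- `τ` is the target map determined by a glued pseudogroup. -/
def IsTgt (_ : P.IsGluedBy p σ q) (τ : A ⟶ P.base) : Prop :=
  ∀ {Z : C} (f : Z ⟶ A) (s : P.carrier), Lies p (σ s) f → f ≫ τ = f ≫ p ≫ P.act s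

lemma exists_isTgt (h : P.IsGluedBy p σ q) : ∃ τ, h.IsTgt τ := by
  obtain ⟨τ, hτ⟩ := h.exists_glue (𝟙 A) (fun s => p ≫ P.act s) fun s t k hs ht => by
    rw [Category.comp_id] at hs ht
    obtain ⟨j, -, h1, h2⟩ := h.exists_idem hs ht
    have h3 : ∀ r, k ≫ p ≫ P.act r = k ≫ p ≫ P.act (r * j) := fun r => by
      rw [P.act_mul, ← Category.assoc, ← h2]
      simp only [Category.assoc]
    rw [h3, h1, ← h3]
  exact ⟨τ, fun f s hs => hτ f s (by rwa [Category.comp_id])⟩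

section Tgt

variable {h : P.IsGluedBy p σ q} {τ : A ⟶ P.base}

lemma IsTgt.isTotal (hτ : h.IsTgt τ) : IsTotal τ := by
  constructor
  refine h.ext (𝟙 A) (by rw [rst_id, Category.id_comp]) (by rw [rst_id, Category.id_comp])
    fun s k hs => ?_
  rw [Category.comp_id] at hs
  rw [comp_rst, hτ k s hs, h.rst_comp_act hs, rst_comp_self, Category.comp_id]

lemma IsTgt.σ_tgt (hτ : h.IsTgt τ) (s : P.carrier) : σ s ≫ τ = P.act s := by
  have h1 : Lies p (σ s) (σ s) := by
    simpa using lies_comp (h.sec s) (𝟙 _)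
  rw [hτ _ s h1, ← Category.assoc, h.sec, h.rst_σ, rst_comp_self]

/-- Replacing `s` by `s'` uses an idempotent `j` at the source of `f`. Replacing `t` by `t'` uses an
idempotent `l` at the source of `g`, that is, at the target of `f`; conjugation by `s'` carries it
back to the source of `f`. -/
lemma IsTgt.mul_congr (hτ : h.IsTgt τ) {f g : Z ⟶ A} (hgf : g ≫ p = f ≫ τ)
    {s s' t t' : P.carrier} (hs : Lies p (σ s) f) (hs' : Lies p (σ s') f) (ht : Lies p (σ t) g)
    (ht' : Lies p (σ t') g) : f ≫ p ≫ σ (t * s) = f ≫ p ≫ σ (t' * s') := by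
  obtain ⟨j, hj, h1, h2⟩ := h.exists_idem hs hs'
  obtain ⟨l, hl, h3, h4⟩ := h.exists_idem ht ht'
  have key : ∀ {e : P.carrier} (_ : IsIdempotentElem e) (_ : f ≫ p ≫ P.act e = f ≫ p)
      (r : P.carrier), f ≫ p ≫ σ r = f ≫ p ≫ σ (r * e) := fun {e} he hf r => by
    rw [← h.act_comp_σ he, ← Category.assoc, ← hf]
    simp only [Category.assoc]
  -- The element `s'` carries the source of `f` to its target, `l` acts there as the identity, and
  -- `s'⁻¹` carries it back.
  have h5 : f ≫ p ≫ P.act (s'⁻¹ * l * s') = f ≫ p := by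
    have h6 := congrArg (fun x => x ≫ P.act s'⁻¹) h4
    simp only [Category.assoc] at h6
    rw [← Category.assoc g, ← Category.assoc g, hgf, hτ f s' hs'] at h6
    simp only [Category.assoc, ← P.act_mul] at h6
    rw [h.comp_act_inv hs'] at h6
    exact h6
  rw [key hj h2, mul_assoc, h1, ← mul_assoc, ← key hj h2, key (idem_conj s' hl) h5, mul_assoc,
    mul_conj s' hl, ← mul_assoc, h3, mul_assoc, ← mul_conj s' hl, ← mul_assoc,
    ← key (idem_conj s' hl) h5]

/-- `m` is the multiplication determined by a glued pseudogroup. -/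
def IsMul (_ : P.IsGluedBy p σ q) (τ : A ⟶ P.base) [HasPullback p τ] (m : pullback p τ ⟶ A) :
    Prop :=
  ∀ {Z : C} (g f : Z ⟶ A) (hgf : g ≫ p = f ≫ τ) (t s : P.carrier), Lies p (σ t) g →
    Lies p (σ s) f → pullback.lift g f hgf ≫ m = f ≫ p ≫ σ (t * s)

lemma IsTgt.exists_isMul (hτ : h.IsTgt τ) [PullsBack p] [IsTotal τ] : ∃ m, h.IsMul τ m := by
  have := h.total
  obtain ⟨m, hm⟩ := h.exists_glue₂ (pullback.fst p τ) (pullback.snd p τ)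
    (fun t s => pullback.snd p τ ≫ p ≫ σ (t * s)) fun t s t' s' k ht ht' hs hs' => by
      have hgf : (k ≫ pullback.fst p τ) ≫ p = (k ≫ pullback.snd p τ) ≫ τ := by
        rw [Category.assoc, pullback.condition, Category.assoc]
      simpa only [Category.assoc] using hτ.mul_congr hgf hs hs' ht ht'
  refine ⟨m, fun g f hgf t s ht hs => ?_⟩
  rw [hm _ t s (by rwa [pullback.lift_fst]) (by rwa [pullback.lift_snd]),
    pullback.lift_snd_assoc]

/-- `ι` is the inversion determined by a glued pseudogroup. -/
def IsInv (_ : P.IsGluedBy p σ q) (τ : A ⟶ P.base) (ι : A ⟶ A) : Prop :=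
  ∀ {Z : C} (f : Z ⟶ A) (s : P.carrier), Lies p (σ s) f → f ≫ ι = f ≫ τ ≫ σ s⁻¹

lemma IsTgt.exists_isInv (hτ : h.IsTgt τ) : ∃ ι, h.IsInv τ ι := by
  obtain ⟨ι, hι⟩ := h.exists_glue (𝟙 A) (fun s => τ ≫ σ s⁻¹) fun s t k hs ht => by
    rw [Category.comp_id] at hs ht
    obtain ⟨j, hj, h1, h2⟩ := h.exists_idem hs ht
    -- The section `σ r⁻¹` is evaluated at the target of `k`, so `j` is first moved there as the
    -- conjugate of `j` by `r`.
    have h3 : ∀ r, Lies p (σ r) k → k ≫ τ ≫ σ r⁻¹ = k ≫ τ ≫ σ (r * j)⁻¹ := fun r hr => by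
      have hc := idem_conj r⁻¹ hj
      have h4 : k ≫ τ ≫ P.act (r⁻¹⁻¹ * j * r⁻¹) = k ≫ τ := by
        rw [← Category.assoc, hτ k r hr]
        have h5 := congrArg (fun x => x ≫ P.act r) h2
        simp only [Category.assoc, ← P.act_mul] at h5 ⊢
        rw [← h5, inv_inv_self]
        congr 3
        calc r * j * r⁻¹ * r = r * (j * (r⁻¹ * r)) := by simp only [mul_assoc]
          _ = r * r⁻¹ * r * j := by rw [idem_comm hj (idem_inv_mul r)]; simp only [mul_assoc]
          _ = r * j := by rw [mul_inv_mul]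
      rw [inv_mul_rev, inv_of_idem hj, ← mul_conj r⁻¹ hj, ← h.act_comp_σ hc]
      have h5 := congrArg (fun x => x ≫ σ r⁻¹) h4
      simpa only [Category.assoc] using h5.symm
    rw [h3 s hs, h1, ← h3 t ht]
  exact ⟨ι, fun f s hs => hι f s (by rwa [Category.comp_id])⟩

end Tgt

end PsGrp.IsGluedBy

end Internalise

/-! ### The groupoid laws and the comparison with bisections -/

section Internalise

variable {C : Type u} [Category.{v} C] [RestrictionCategory C] [JoinRestrictionCategory C]

namespace PsGrp.IsGluedBy

variable {P : PsGrp C} {A : C} {p : A ⟶ P.base} {σ : P.carrier → (P.base ⟶ A)}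
  {q : P.carrier → (A ⟶ P.base)} {Z : C} {h : P.IsGluedBy p σ q} {τ : A ⟶ P.base}

lemma one_src (h : P.IsGluedBy p σ q) : σ 1 ≫ p = 𝟙 P.base := by
  rw [h.sec, h.rst_σ, P.act_one, rst_id]

section Mul

variable [PullsBack p] [IsTotal p] [IsTotal τ] {m : pullback p τ ⟶ A}

lemma IsMul.lies (hm : h.IsMul τ m) {g f : Z ⟶ A} (hgf : g ≫ p = f ≫ τ) {t s : P.carrier}
    (ht : Lies p (σ t) g) (hs : Lies p (σ s) f) :
    Lies p (σ (t * s)) (pullback.lift g f hgf ≫ m) := by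
  rw [hm g f hgf t s ht hs, ← Category.assoc]
  exact lies_comp (h.sec _) _

lemma IsMul.comp_src (hm : h.IsMul τ m) (hτ : h.IsTgt τ) : m ≫ p = pullback.snd p τ ≫ p := by
  have key : ∀ (k : pullback p τ ⟶ pullback p τ) t s, Lies p (σ t) (k ≫ pullback.fst p τ) →
      Lies p (σ s) (k ≫ pullback.snd p τ) → k ≫ m ≫ p = k ≫ pullback.snd p τ ≫ p := by
    intro k t s ht hs
    have hgf : (k ≫ pullback.fst p τ) ≫ p = (k ≫ pullback.snd p τ) ≫ τ := by
      rw [Category.assoc, pullback.condition, Category.assoc]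
    have e : pullback.lift _ _ hgf = k := by
      apply pullback.hom_ext <;> simp only [pullback.lift_fst, pullback.lift_snd]
    have h1 := hm _ _ hgf t s ht hs
    rw [e] at h1
    set f := k ≫ pullback.snd p τ with hf
    -- The section `σ (t * s)` is defined at the source of `f`: the action of `s` leads to the
    -- target of `f`, which is the source of `g` and so lies in the domain of `t`.
    have h2 : rst (f ≫ p ≫ σ (t * s)) = rst f := by
      rw [← Category.assoc, ← rst_comp_rst, h.rst_σ, rst_comp_rst, P.act_mul, ← Category.assoc,
        Category.assoc f, ← hτ f s hs, ← hgf, Category.assoc, h.rst_comp_act ht,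
        rst_eq_of_comp_total hgf]
    have h3 : f ≫ p ≫ rst (σ (t * s)) = f ≫ p := by
      rw [← Category.assoc, comp_rst, Category.assoc, h2, ← Category.assoc, rst_comp_self]
    rw [← Category.assoc, h1, Category.assoc f, Category.assoc p, h.sec, h3, hf, Category.assoc]
  have hcov := (h.isCover (pullback.fst p τ)).prod (e := rst (pullback.fst p τ))
    (by simpa only [IsTotal.rst_eq] using h.isCover (pullback.snd p τ))
  have h1 := hcov.ext (f := m ≫ p) (g := pullback.snd p τ ≫ p) fun ⟨t, s⟩ => by
    refine key _ t s ?_ ?_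
    · rw [rst_comm, Category.assoc]
      exact (h.lies _ t).precomp _
    · rw [Category.assoc]
      exact (h.lies _ s).precomp _
  simpa only [IsTotal.rst_eq, Category.id_comp] using h1

lemma IsMul.lift_src (hm : h.IsMul τ m) (hτ : h.IsTgt τ) {g f : Z ⟶ A} (hgf : g ≫ p = f ≫ τ) :
    (pullback.lift g f hgf ≫ m) ≫ p = f ≫ p := by
  rw [Category.assoc, hm.comp_src hτ, pullback.lift_snd_assoc]

lemma IsMul.lift_tgt (hm : h.IsMul τ m) (hτ : h.IsTgt τ) {g f : Z ⟶ A} (hgf : g ≫ p = f ≫ τ) :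
    (pullback.lift g f hgf ≫ m) ≫ τ = g ≫ τ := by
  have e : rst g = rst f := rst_eq_of_comp_total hgf
  refine h.ext₂ g f e ?_ (by rw [rst_comp_total, e]) fun t s k ht hs => ?_
  · rw [rst_comp_total, ← rst_comp_total _ p, hm.lift_src hτ, rst_comp_total]
  · have hgf' : (k ≫ g) ≫ p = (k ≫ f) ≫ τ := by simp only [Category.assoc, hgf]
    rw [← Category.assoc, ← Category.assoc, precomp_lift, hτ _ _ (hm.lies hgf' ht hs),
      ← Category.assoc, hm.lift_src hτ, P.act_mul, ← Category.assoc, Category.assoc (k ≫ f),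
      ← hτ _ s hs, ← hgf', Category.assoc, ← hτ _ t ht, Category.assoc]

lemma IsMul.rst_lift (hm : h.IsMul τ m) (hτ : h.IsTgt τ) {g f : Z ⟶ A} (hgf : g ≫ p = f ≫ τ) :
    rst (pullback.lift g f hgf ≫ m) = rst f :=
  rst_eq_of_comp_total (hm.lift_src hτ hgf)

/-- Locally both triple composites lie in `σ (u * t * s)` and have the same source, so `Lies.ext`
identifies them. The unit laws and the involutivity of inversion follow the same pattern. -/
lemma IsMul.assoc (hm : h.IsMul τ m) (hτ : h.IsTgt τ) (a b c : Z ⟶ A) (hab : a ≫ p = b ≫ τ)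
    (hbc : b ≫ p = c ≫ τ) (h1 : a ≫ p = (pullback.lift b c hbc ≫ m) ≫ τ)
    (h2 : (pullback.lift a b hab ≫ m) ≫ p = c ≫ τ) :
    pullback.lift a (pullback.lift b c hbc ≫ m) h1 ≫ m =
      pullback.lift (pullback.lift a b hab ≫ m) c h2 ≫ m := by
  have e : rst b = rst c := rst_eq_of_comp_total hbc
  have e' : rst a = rst b := rst_eq_of_comp_total hab
  refine h.ext₃ a b c (e'.trans e) e ?_ ?_ fun u t s k hu ht hs => ?_
  · rw [hm.rst_lift hτ, hm.rst_lift hτ]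
  · rw [hm.rst_lift hτ]
  · have hbc' : (k ≫ b) ≫ p = (k ≫ c) ≫ τ := by simp only [Category.assoc, hbc]
    have hab' : (k ≫ a) ≫ p = (k ≫ b) ≫ τ := by simp only [Category.assoc, hab]
    have l1 := hm.lies hbc' ht hs
    have l2 := hm.lies hab' hu ht
    rw [← precomp_lift k hbc, Category.assoc] at l1
    rw [← precomp_lift k hab, Category.assoc] at l2
    have l3 := hm.lies (by simp only [Category.assoc, h1]) hu l1
    have l4 := hm.lies (by simpa only [Category.assoc] using congrArg (fun x => k ≫ x) h2) l2 hs
    rw [← precomp_lift _ h1, Category.assoc] at l3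
    rw [← precomp_lift _ h2, Category.assoc, mul_assoc] at l4
    refine l3.ext l4 ?_
    rw [Category.assoc k, Category.assoc k, hm.lift_src hτ, hm.lift_src hτ, hm.lift_src hτ]

lemma IsMul.mul_one (hm : h.IsMul τ m) (hτ : h.IsTgt τ) (hgf : 𝟙 A ≫ p = (p ≫ σ 1) ≫ τ) :
    pullback.lift (𝟙 A) (p ≫ σ 1) hgf ≫ m = 𝟙 A := by
  have e : (p ≫ σ 1) ≫ p = p := by rw [Category.assoc, h.one_src, Category.comp_id]
  refine h.ext (𝟙 A) (by rw [rst_id, Category.id_comp]) (by rw [rst_id, Category.id_comp])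
    fun s k hs => ?_
  have hgf' : (k ≫ 𝟙 A) ≫ p = (k ≫ p ≫ σ 1) ≫ τ := by
    rw [Category.assoc, hgf, ← Category.assoc]
  have l1 := hm.lies (s := 1) hgf' hs (by rw [← Category.assoc]; exact lies_comp (h.sec 1) _)
  rw [← precomp_lift _ hgf, Category.assoc, _root_.mul_one] at l1
  refine l1.ext hs ?_
  rw [Category.assoc, hm.lift_src hτ, e, Category.assoc, Category.id_comp]

lemma IsMul.one_mul (hm : h.IsMul τ m) (hτ : h.IsTgt τ) (hgf : (τ ≫ σ 1) ≫ p = 𝟙 A ≫ τ) :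
    pullback.lift (τ ≫ σ 1) (𝟙 A) hgf ≫ m = 𝟙 A := by
  refine h.ext (𝟙 A) (by rw [rst_id, Category.id_comp]) (by rw [rst_id, Category.id_comp])
    fun s k hs => ?_
  have hgf' : (k ≫ τ ≫ σ 1) ≫ p = (k ≫ 𝟙 A) ≫ τ := by
    rw [Category.assoc, hgf, ← Category.assoc]
  have l1 := hm.lies (t := 1) hgf' (by rw [← Category.assoc]; exact lies_comp (h.sec 1) _) hs
  rw [← precomp_lift _ hgf, Category.assoc, _root_.one_mul] at l1
  refine l1.ext hs ?_
  rw [Category.assoc, hm.lift_src hτ, Category.assoc]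

section Inv

variable {ι : A ⟶ A}

lemma IsInv.lies (hι : h.IsInv τ ι) {f : Z ⟶ A} {s : P.carrier} (hs : Lies p (σ s) f) :
    Lies p (σ s⁻¹) (f ≫ ι) := by
  rw [hι f s hs, ← Category.assoc]
  exact lies_comp (h.sec _) _

lemma IsInv.inv_src (hι : h.IsInv τ ι) (hτ : h.IsTgt τ) : ι ≫ p = τ := by
  refine h.ext (𝟙 A) (by rw [rst_id, Category.id_comp]) (by rw [rst_id, Category.id_comp])
    fun s k hs => ?_
  rw [Category.comp_id] at hs
  have h1 : τ ≫ σ s⁻¹ ≫ p = τ ≫ P.act (s * s⁻¹) := by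
    rw [h.sec, h.rst_σ, P.rst_act, inv_inv_self]
  rw [← Category.assoc, hι k s hs, Category.assoc, Category.assoc, h1, ← Category.assoc,
    hτ k s hs, Category.assoc, Category.assoc, ← P.act_mul, mul_inv_mul]

lemma IsInv.inv_tgt (hι : h.IsInv τ ι) (hτ : h.IsTgt τ) : ι ≫ τ = p := by
  refine h.ext (𝟙 A) (by rw [rst_id, Category.id_comp]) (by rw [rst_id, Category.id_comp])
    fun s k hs => ?_
  rw [Category.comp_id] at hs
  rw [← Category.assoc, hτ _ _ (hι.lies hs), Category.assoc, ← Category.assoc ι,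
    hι.inv_src hτ, ← Category.assoc, hτ k s hs, Category.assoc, Category.assoc, ← P.act_mul,
    h.comp_act_inv hs]

lemma IsInv.inv_inv (hι : h.IsInv τ ι) (hτ : h.IsTgt τ) : ι ≫ ι = 𝟙 A := by
  refine h.ext (𝟙 A) (by rw [rst_id, Category.id_comp]) (by rw [rst_id, Category.id_comp])
    fun s k hs => ?_
  have l1 := hι.lies (hι.lies hs)
  rw [inv_inv_self] at l1
  simp only [Category.assoc, Category.comp_id] at l1 hs ⊢
  refine l1.ext hs ?_
  rw [Category.assoc, Category.assoc, hι.inv_src hτ, hι.inv_tgt hτ]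

lemma IsInv.inv_mul (hι : h.IsInv τ ι) (hm : h.IsMul τ m)
    (hgf : ι ≫ p = 𝟙 A ≫ τ) : pullback.lift ι (𝟙 A) hgf ≫ m = p ≫ σ 1 := by
  refine h.ext (𝟙 A) (by rw [rst_id, Category.id_comp]) (by rw [rst_id, Category.id_comp])
    fun s k hs => ?_
  have hgf' : (k ≫ ι) ≫ p = (k ≫ 𝟙 A) ≫ τ := by
    rw [Category.assoc, hgf, ← Category.assoc]
  have hs' := hs
  rw [Category.comp_id] at hs'
  have l1 := hm _ _ hgf' _ s (hι.lies hs') hs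
  rw [← precomp_lift _ hgf, Category.assoc] at l1
  have l2 := h.act_comp_σ (idem_inv_mul s) 1
  rw [_root_.one_mul] at l2
  rw [l1, Category.comp_id, ← l2, ← Category.assoc p, ← Category.assoc k, h.comp_act_inv hs',
    Category.assoc]

end Inv

end Mul

/-- The étale groupoid determined by a glued pseudogroup. -/
noncomputable def etaleGroupoid (h : P.IsGluedBy p σ q) [PullsBack p] [IsTotal p] [IsTotal τ] (hτ : h.IsTgt τ)
    {m : pullback p τ ⟶ A} (hm : h.IsMul τ m) {ι : A ⟶ A} (hι : h.IsInv τ ι) :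
    EtaleGroupoid C where
  obj := P.base
  arr := A
  src := p
  tgt := τ
  one := σ 1
  one_src := h.one_src
  one_tgt := by rw [hτ.σ_tgt, P.act_one]
  comp := m
  comp_src := hm.comp_src hτ
  comp_tgt := by
    have h1 := hm.lift_tgt hτ (pullback.condition (f := p) (g := τ))
    have e : pullback.lift _ _ (pullback.condition (f := p) (g := τ)) = 𝟙 _ := by
      apply pullback.hom_ext <;> simp only [pullback.lift_fst, pullback.lift_snd, Category.id_comp]
    rwa [e, Category.id_comp] at h1
  comp_one := hm.mul_one hτ _
  one_comp := hm.one_mul hτ _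
  comp_assoc a b c hab hbc := hm.assoc hτ a b c hab hbc _ _
  inv := ι
  inv_inv := hι.inv_inv hτ
  inv_src := hι.inv_src hτ
  inv_comp := hι.inv_mul hm _
  etale := h.isLocalHomeo

section Sections

variable [PullsBack p] [IsTotal p] [IsTotal τ] {m : pullback p τ ⟶ A} {ι : A ⟶ A}

/-- The homomorphism from a pseudogroup to the partial bisections of its étale groupoid. -/
noncomputable def toBisections (h : P.IsGluedBy p σ q) (hτ : h.IsTgt τ) (hm : h.IsMul τ m) (hι : h.IsInv τ ι) :
    P.carrier →* (h.etaleGroupoid hτ hm hι).Bisections where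
  toFun s := ⟨⟨σ s, h.sec s⟩, by
    change IsPartialIso (σ s ≫ τ)
    rw [hτ.σ_tgt]
    exact (P.θ s).2⟩
  map_one' := rfl
  map_mul' t s := by
    refine Subtype.ext (Section.ext ?_)
    let G := h.etaleGroupoid hτ hm hι
    let σ' : P.carrier → G.Section := fun s => ⟨σ s, h.sec s⟩
    have l1 : Lies p (σ s) (rst (σ s ≫ τ ≫ σ t) ≫ σ s) := lies_comp (h.sec s) _
    have l2 : Lies p (σ t) (σ s ≫ τ ≫ σ t) := by
      rw [← Category.assoc]
      exact lies_comp (h.sec t) _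
    -- The two arrows composed in the product of sections lie in `σ t` and `σ s`, so the defining
    -- property of `m` evaluates the product as a restriction of `σ (t * s)`; `h2` shows that
    -- nothing is lost.
    have h1 := hm _ _ ((σ' t).mul_aux (σ' s)) t s l2 l1
    refine Eq.trans ?_ ((Section.mul_hom (σ' t) (σ' s)).trans h1).symm
    have h2 : rst (σ s ≫ τ ≫ σ t) = rst (σ (t * s)) := by
      rw [← Category.assoc, hτ.σ_tgt, ← rst_comp_rst, h.rst_σ, rst_comp_rst, ← P.act_mul, h.rst_σ]
    have h3 : rst (σ (t * s)) ≫ rst (σ s) = rst (σ (t * s)) := by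
      rw [← h2, rst_comp_rst_comp]
    change σ (t * s) = (rst (σ s ≫ τ ≫ σ t) ≫ σ s) ≫ p ≫ σ (t * s)
    rw [h2, Category.assoc, ← Category.assoc (σ s), h.sec, ← Category.assoc, h3, rst_comp_self]

variable (h : P.IsGluedBy p σ q) (hτ : h.IsTgt τ) (hm : h.IsMul τ m) (hι : h.IsInv τ ι)

lemma toBisections_hom (s : P.carrier) : (h.toBisections hτ hm hι s).1.hom = σ s := rfl

/-- If `σ s = σ t`, their extent of equality is the domain of each. As `θ` is injective on
idempotents, `j` equals both `s⁻¹ * s` and `t⁻¹ * t`, and `s * j = t * j` becomes `s = t`. -/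
lemma toBisections_injective : Function.Injective (h.toBisections hτ hm hι) := by
  intro s t hst
  have h1 : σ s = σ t := congrArg (fun b => b.1.hom) hst
  obtain ⟨j, hj⟩ := exists_isEqIdem s t
  have h2 : P.act j = rst (σ s) := by rw [← h.extent s t j hj, h1, h.σ_q]
  have h3 : j = s⁻¹ * s := P.act_injOn hj.idem (idem_inv_mul s) (by
    rw [h2, h.rst_σ, P.rst_act])
  have h4 : j = t⁻¹ * t := P.act_injOn hj.idem (idem_inv_mul t) (by
    rw [h2, h1, h.rst_σ, P.rst_act])
  calc s = s * j := by rw [h3, ← mul_assoc, mul_inv_mul]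
    _ = t := by rw [hj.eq, h4, ← mul_assoc, mul_inv_mul]

/-- A bisection `β` is covered by its restrictions to the places where it agrees with some `σ s`.
Each restriction comes from an element `s * e s`; these have a common upper bound after mapping to
bisections, so they are bicompatible in `P` and have a join `j` there. -/
lemma toBisections_surjective : Function.Surjective (h.toBisections hτ hm hι) := by
  intro b
  have hb : b.1.hom ≫ p = rst b.1.hom := b.1.src
  set β : P.base ⟶ A := b.1.hom with hβ
  choose e he heq using fun s => P.exists_act (h.sec_comp hb s)
  have hσ : ∀ s, σ (s * e s) = rst (β ≫ q s) ≫ β := fun s => by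
    rw [← h.act_comp_σ (he s), heq, ← h.comp_sec hb, h.sec_comp hb]
  have hle : ∀ s, NLe (h.toBisections hτ hm hι (s * e s)) b := fun s => by
    rw [EtaleGroupoid.nle_iff, toBisections_hom, hσ]
    have := (rst_le_id (β ≫ q s)).postcomp β
    rwa [Category.id_comp] at this
  obtain ⟨j, hj⟩ := JoinInverseMonoid.exists_join (Set.range fun s => s * e s) (by
    rintro _ ⟨s, rfl⟩ _ ⟨t, rfl⟩
    exact BiCompat.of_map (h.toBisections_injective hτ hm hι) ((hle s).biCompat (hle t)))
  have h1 : rst β ≫ β = rst β ≫ σ j := (h.isCover β).ext fun s => by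
    have h2 : RLe (σ (s * e s)) (σ j) :=
      (EtaleGroupoid.nle_iff _ _).1 ((hj.1 _ ⟨s, rfl⟩).map (h.toBisections hτ hm hι))
    rwa [RLe, hσ, rst_rst_comp, rst_comp_rst_comp] at h2
  rw [rst_comp_self] at h1
  -- So far `β` is only known to be a restriction of `σ j`; multiplying `j` by the idempotent of the
  -- domain of `β` gives equality.
  obtain ⟨d, hd, hdβ⟩ := P.exists_act (rst_rst β)
  refine ⟨j * d, Subtype.ext (Section.ext ?_)⟩
  rw [toBisections_hom, ← h.act_comp_σ hd, hdβ, ← h1]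

/-- A pseudogroup is isomorphic to the pseudogroup of partial bisections of its étale groupoid. -/
noncomputable def isoBisections : (bisectionFunctor C).obj (h.etaleGroupoid hτ hm hι) ≅ P :=
  let ψ := MulEquiv.ofBijective (h.toBisections hτ hm hι)
    ⟨h.toBisections_injective hτ hm hι, h.toBisections_surjective hτ hm hι⟩
  have hcomm : ∀ s, (h.toBisections hτ hm hι s).1.hom ≫ τ = P.act s := fun s => hτ.σ_tgt s
  { hom := PsGrp.Hom.mk (P := EtaleGroupoid.toPsGrp (h.etaleGroupoid hτ hm hι)) (Q := P)
      ψ.symm.toMonoidHom (𝟙 P.base) (show IsTotal (𝟙 P.base) from inferInstance) fun b => by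
        refine (Category.id_comp _).trans (Eq.trans ?_ (Category.comp_id _).symm)
        obtain ⟨s, rfl⟩ := ψ.surjective b
        refine (hcomm s).trans ?_
        exact congrArg P.act (ψ.symm_apply_apply s).symm
    inv := PsGrp.Hom.mk (P := P) (Q := EtaleGroupoid.toPsGrp (h.etaleGroupoid hτ hm hι))
      (h.toBisections hτ hm hι) (𝟙 P.base) (show IsTotal (𝟙 P.base) from inferInstance) fun s => by
        refine (Category.id_comp _).trans (Eq.trans ?_ (Category.comp_id _).symm)
        exact (hcomm s).symm
    hom_inv_id := PsGrp.Hom.ext (MonoidHom.ext fun b => ψ.apply_symm_apply b)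
      (Category.comp_id _)
    inv_hom_id := PsGrp.Hom.ext (MonoidHom.ext fun s => ψ.symm_apply_apply s)
      (Category.comp_id _) }

end Sections

end PsGrp.IsGluedBy

lemma essSurj_bisectionFunctor (hC : HasLocalGlueings C) : (bisectionFunctor C).EssSurj where
  mem_essImage P := by
    obtain ⟨A, p, σ, q, h⟩ := P.exists_isGluedBy hC
    have := h.total
    have := h.pullsBack hC
    obtain ⟨τ, hτ⟩ := h.exists_isTgt
    have := hτ.isTotal
    obtain ⟨m, hm⟩ := hτ.exists_isMul
    obtain ⟨ι, hι⟩ := hτ.exists_isInv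
    exact ⟨_, ⟨h.isoBisections hτ hm hι⟩⟩

/-! ### Recognising internalisations -/

section OfIso

variable {G : EtaleGroupoid C} {q : G.Bisections → (G.arr ⟶ G.obj)}

lemma EtaleGroupoid.mul_idem_hom (u : G.Bisections) {e : G.Bisections}
    (he : IsIdempotentElem e) : (u * e).1.hom = rst e.1.hom ≫ u.1.hom := by
  have h1 : (u * e).1 = u.1 * e.1.restr := by
    rw [← EtaleGroupoid.idem_eq_restr he]
    rfl
  rw [h1, Section.mul_restr_hom]

lemma EtaleGroupoid.idem_hom {e : G.Bisections} (he : IsIdempotentElem e) :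
    e.1.hom = rst e.1.hom ≫ G.one := by
  rw [← Section.restr_hom, ← EtaleGroupoid.idem_eq_restr he]

lemma EtaleGroupoid.tgt_eq_rst {e : G.Bisections} (he : IsIdempotentElem e) :
    e.1.hom ≫ G.tgt = rst e.1.hom := by
  conv_lhs => rw [EtaleGroupoid.idem_hom he, Category.assoc, G.one_tgt, Category.comp_id]

lemma EtaleGroupoid.inv_mul_mul_idem (u : G.Bisections) {e : G.Bisections}
    (he : IsIdempotentElem e) :
    u⁻¹ * u * e = e ↔ rst e.1.hom ≫ rst u.1.hom = rst e.1.hom := by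
  have h1 : (u⁻¹ * u * e).1.hom = rst e.1.hom ≫ rst u.1.hom ≫ G.one := by
    rw [EtaleGroupoid.mul_idem_hom _ he, EtaleGroupoid.inv_mul_eq, Section.restr_hom]
  have h2 := EtaleGroupoid.idem_hom he
  constructor
  · intro h
    rw [h] at h1
    have h3 := congrArg (fun x => x ≫ G.src) h1
    simp only [Category.assoc, G.one_src, Category.comp_id, e.1.src] at h3
    exact h3.symm
  · intro h
    refine Subtype.ext (Section.ext ?_)
    rw [h1, ← Category.assoc, h, ← h2]

/-- The extent of equality of two partial bisections, as an idempotent. -/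
lemma EtaleGroupoid.tgt_of_isEqIdem
    (h : IsSectionCover G.src (fun s : G.Bisections => s.1.hom) q) {u v j : G.Bisections}
    (hj : IsEqIdem u v j) : j.1.hom ≫ G.tgt = u.1.hom ≫ q v := by
  have hd := h.idem u v
  rw [tgt_eq_rst hj.idem]
  -- Let `w` be the idempotent bisection over the extent `u ≫ q v`. Maximality of `j` puts `w` below
  -- `j` (`h3`); conversely `u * j = v * j` puts the domain of `j` inside `u ≫ q v` (`h5`).
  obtain ⟨w, hw, hwd⟩ : ∃ w : G.Bisections, IsIdempotentElem w ∧
      w.1.hom ≫ G.tgt = u.1.hom ≫ q v := G.toPsGrp.exists_act hd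
  rw [tgt_eq_rst hw] at hwd
  have h3 : j * w = w := by
    refine hj.max w hw ?_ ?_ ?_
    · rw [inv_mul_mul_idem _ hw, hwd, ← hd, rst_comp_rst_comp]
    · have h4 := h.symm u v
      beta_reduce at h4
      rw [inv_mul_mul_idem _ hw, hwd, ← hd, h4, rst_comp_rst_comp]
    · refine Subtype.ext (Section.ext ?_)
      rw [mul_idem_hom _ hw, mul_idem_hom _ hw, hwd]
      exact h.comp_σ u v
  have h4 : rst w.1.hom ≫ rst j.1.hom = rst w.1.hom := by
    rw [← rst_rst_comp, ← mul_idem_hom _ hw, h3]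
  have h5 : rst j.1.hom ≫ u.1.hom ≫ q v = rst j.1.hom := by
    have h6 := congrArg (fun b : G.Bisections => b.1.hom) hj.eq
    simp only [mul_idem_hom _ hj.idem] at h6
    rw [← Category.assoc, h6, Category.assoc, h.σ_q]
    exact (inv_mul_mul_idem _ hj.idem).1 hj.right
  rw [← h5, ← hwd, rst_comm, h4]

end OfIso

lemma InverseMonoid.IsEqIdem.map {S T : Type v} [InverseMonoid S] [InverseMonoid T]
    {ψ : S →* T} (hψ : Function.Bijective ψ) {s t j : S} (h : IsEqIdem s t j) :
    IsEqIdem (ψ s) (ψ t) (ψ j) where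
  idem := h.idem.map ψ
  left := by rw [← map_inv, ← map_mul, ← map_mul, h.left]
  right := by rw [← map_inv, ← map_mul, ← map_mul, h.right]
  eq := by rw [← map_mul, ← map_mul, h.eq]
  max e he h1 h2 h3 := by
    obtain ⟨e, rfl⟩ := hψ.2 e
    rw [← map_inv, ← map_mul, ← map_mul] at h1 h2
    rw [← map_mul, ← map_mul] at h3
    rw [← map_mul, h.max e (hψ.1 (by rw [map_mul]; exact he)) (hψ.1 h1) (hψ.1 h2) (hψ.1 h3)]

/-- The isomorphism matches elements of `P` with partial bisections of `G`, which cover the arrows.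
It transports extents of equality because they are characterised algebraically by `IsEqIdem`. -/
lemma isInternalisation_of_iso {P : PsGrp C} {G : EtaleGroupoid C}
    (e : (bisectionFunctor C).obj G ≅ P) : IsInternalisation P G := by
  obtain ⟨q, h⟩ := G.exists_isSectionCover
  let η : PsGrp.Hom P G.toPsGrp := e.inv
  let ε : PsGrp.Hom G.toPsGrp P := e.hom
  let ψ : P.carrier →* G.Bisections := η.hom
  have h1 : ∀ s, ε.hom (ψ s) = s := fun s =>
    DFunLike.congr_fun (congrArg PsGrp.Hom.hom e.inv_hom_id) s
  have h2 : ∀ b, ψ (ε.hom b) = b := fun b =>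
    DFunLike.congr_fun (congrArg PsGrp.Hom.hom e.hom_inv_id) b
  have hψ : Function.Bijective ψ :=
    ⟨Function.LeftInverse.injective h1, Function.RightInverse.surjective h2⟩
  let i : G.obj ≅ P.base :=
    ⟨η.base, ε.base, congrArg PsGrp.Hom.base e.hom_inv_id, congrArg PsGrp.Hom.base e.inv_hom_id⟩
  have hact : ∀ s, i.hom ≫ P.act s ≫ i.inv = (ψ s).1.hom ≫ G.tgt := fun s => by
    rw [← Category.assoc, Iso.comp_inv_eq]
    exact η.comm s
  choose j hj using fun s t : P.carrier => exists_isEqIdem s t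
  refine ⟨i, fun s t => P.act (j s t), G.Bisections.subtype.comp ψ,
    fun s t => P.isExtentOfEquality (hj s t), ⟨h.total, q ∘ ψ, fun s => h.inv (ψ s), ?_, ?_⟩,
    fun s => (hact s).symm⟩
  · rw [hψ.2.range_comp]
    exact h.join
  · intro s t
    exact (hact _).trans (EtaleGroupoid.tgt_of_isEqIdem h ((hj s t).map hψ))

end Internalise

end EtaleCorr

/-- The inverse functor is an arbitrary choice; the counit at `P` is the isomorphism that makes its
value an internalisation of `P`. -/
theorem mainTheorem6 {C : Type u} [Category.{v} C] [EtaleCorr.RestrictionCategory C]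
    [EtaleCorr.JoinRestrictionCategory C] (hC : EtaleCorr.HasLocalGlueings C) :
    ∃ E : EtaleCorr.EtaleGroupoid C ≌ EtaleCorr.PsGrp C,
      E.functor = EtaleCorr.bisectionFunctor C ∧
      ∀ P : EtaleCorr.PsGrp C, EtaleCorr.IsInternalisation P (E.inverse.obj P) := by
  have := EtaleCorr.essSurj_bisectionFunctor hC
  have : (EtaleCorr.bisectionFunctor C).IsEquivalence := { }
  exact ⟨(EtaleCorr.bisectionFunctor C).asEquivalence, rfl, fun P =>
    EtaleCorr.isInternalisation_of_iso
      ((EtaleCorr.bisectionFunctor C).asEquivalence.counitIso.app P)⟩
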